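/- **Setting.** Let $N\in\mathbb Z$, $a=2^{-N}$, $L=na$ with $n\ge 1$ an integer, $\Lambda=a\mathbb Z^2/L\mathbb Z^2$ (with representatives in $(-\frac L2,\frac L2]^2$), $\Lambda^*=\frac{2\pi}{L}\mathbb Z^2\cap\mathcal B_a$ with $\mathcal B_a=(-\frac\pi a,\frac\pi a]^2$, $\int_\Lambda dx=a^2\sum_{x\in\Lambda}$. Let $\gamma_0=\begin{pmatrix}1&0\\0&-1\end{pmatrix}$, $\gamma_1=\begin{pmatrix}0&-i\\i&0\end{pmatrix}$, $s_\mu(k)=2^N\sin(2^{-N}k_\mu)$ and $M_N(k)=2\sum_{\mu=0,1}2^N\sin^2(2^{-N-1}k_\mu)$. For $m_N\in\mathbb R$ and a weight $w$ on $\mathcal B_a$ let $$g(x)=\frac1{L^2}\sum_{k\in\Lambda^*}e^{-ik\cdot x}\,w(k)\Big(-i\sum_\mu\gamma_\mu s_\mu(k)+m_N+M_N(k)\Big)^{-1}.$$ The propagator $g^{(\le N)}$ has $w\equiv1$ and $g^{(h,N]}$ has $w(k)=1-\chi(2^{-h}|k|)$, where $\chi\in C^\infty(\mathbb R)$ is a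 Gevrey-2 function ($\|\chi^{(j)}\|_\infty\le C_1C_2^j\,j!^2$ for all $j$) which on $[0,\infty)$ is non-negative and non-increasing, with $\chi=1$ on $[0,\frac12]$ and $\chi=0$ on $[1,\infty)$. For $M>0$ put $h^*_M=\lfloor\log_2M\rfloor$. For $b=(y,\mu,\epsilon)\in\Lambda\times\{0,1\}\times\{\pm\}$ let $c_b$ be the kernel of the bilinear $\int d\eta\,d\eta'\,\psi^+_\eta c_b(\eta,\eta')\psi^-_{\eta'}$ equal to $\frac12\psi^+_y(\gamma_\mu-1)\psi^-_{y+a\hat e_\mu}$ if $\epsilon=+$ and to $-\frac12\psi^+_{y+a\hat e_\mu}(\gamma_\mu+1)\psi^-_y$ if $\epsilon=-$; here $\eta=(x,s)$ with $x\in\Lambda$, $s\in\{1,2\}$, $\int d\eta=\sum_s\int_\Lambda dx$, and $g_{\eta,\eta'}=g_{s,s'}(x-x')$. The free tadpole and the free bubble are $$\mathcal T=-2^{-N}\int d\eta_1d\eta_2\,c_b(\eta_1,\eta_2)\,g_{\eta_2,\eta_1},$$ $$\Pi(b_1,b_2)=\tfrac12\int d\eta_1d\eta_1'd\eta_2d\eta_2'\,c_{b_1}(\eta_1,\eta_1')c_{b_2}(\eta_2,\eta_2')\,g_{\eta_1',\eta_2}\,g_{\eta_2',\eta_1},$$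 $$\hat\Pi_{\mu,\nu}(p)=\tfrac12\sum_{\epsilon,\epsilon'=\pm}\epsilon\epsilon'\int_\Lambda\int_\Lambda\frac{dx\,dy}{L^2}e^{-ip\cdot(x-y)}\,\Pi\big((x,\mu,\epsilon),(y,\nu,\epsilon')\big),\qquad p\in\Lambda^*,$$ with superscript $(\le N)$ or $(h,N]$ according to the propagator used, and the free current correlation is $\hat{\mathfrak B}_{\mu,\nu}(p)=-2\big(\delta_{\mu,\nu}\mathcal T+2\hat\Pi_{\mu,\nu}(p)\big)$, with the same superscripts. The parameters are such that $h^*_M<N$ and $0<|m_N|<2^{h^*_M}$ for the $(h^*_M,N]$ quantities, and $0<|m_N|<2^{N-1}$ for the $(\le N)$ quantities; $L\to\infty$ means $n\to\infty$ at fixed $a$. **Proposition.** There are a constant $C>0$, a number $\mathcal T_0$ and functions $\tilde R_{\mu,\nu}$ on $(-\pi,\pi]^2$ ($\mu,\nu\in\{0,1\}$), all independent of $N$ and $\chi$, with $$|\tilde R_{\mu,\nu}(q)-\tilde R_{\mu,\nu}(0)|\le C|q|^{1/2}\qquad\text{for all }q\in(-\pi,\pi]^2,$$ such that, for every $N$ and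 $\chi$ as above: 1. The tadpoles $\mathcal T^{(\le N)}$ and $\mathcal T^{(h^*_M,N]}$ do not depend on $b$. Viewed as functions of $p\in\Lambda^*$ (the tadpoles being constant in $p$), $\hat\Pi^{(\le N)}_{\mu,\nu}$, $\hat\Pi^{(h^*_M,N]}_{\mu,\nu}$, $\mathcal T^{(\le N)}$, $\mathcal T^{(h^*_M,N]}$, $\hat{\mathfrak B}^{(\le N)}_{\mu,\nu}$ and $\hat{\mathfrak B}^{(h^*_M,N]}_{\mu,\nu}$ have continuous extensions to $\mathcal B_a$ (denoted by the same symbols) whose limits as $L\to\infty$ exist, uniformly in $p\in\mathcal B_a$. 2. For every $p\in\mathcal B_a\setminus\{0\}$ the following iterated limits exist, and $$\lim_{M\to0^+}\lim_{m_N\to0}\lim_{L\to\infty}\hat\Pi^{(h^*_M,N]}_{\mu,\nu}(p)=\lim_{m_N\to0}\lim_{L\to\infty}\hat\Pi^{(\le N)}_{\mu,\nu}(p)=\frac{1}{8\pi|p|^2}\big(2p_\mu p_\nu-|p|^2\delta_{\mu,\nu}\big)+\tilde R_{\mu,\nu}(ap),$$ $$\lim_{M\to0^+}\lim_{m_N\to0}\lim_{L\to\infty}\mathcal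 T^{(h^*_M,N]}=\lim_{m_N\to0}\lim_{L\to\infty}\mathcal T^{(\le N)}=\mathcal T_0.$$ 3. For every $p\in\mathcal B_a\setminus\{0\}$ the following iterated limits exist, and $$\lim_{M\to0^+}\lim_{m_N\to0}\lim_{L\to\infty}\hat{\mathfrak B}^{(h^*_M,N]}_{\mu,\nu}(p)=\lim_{m_N\to0}\lim_{L\to\infty}\hat{\mathfrak B}^{(\le N)}_{\mu,\nu}(p)=\frac1\pi\Big(\delta_{\mu,\nu}-\frac{p_\mu p_\nu}{|p|^2}\Big)-4\big(\tilde R_{\mu,\nu}(ap)-\tilde R_{\mu,\nu}(0)\big).$$ -/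

import Mathlib

open Filter Topology
open scoped ContDiff Nat

noncomputable section

namespace LatticeQED

/-! ### The lattice, its dual, and integrals over them

The lattice spacing is `a = 2 ^ (-N)` with `N : ℤ`, and the side of the periodic box is `L = n a`
with `n : ℕ+`, so that the limit `L → ∞` is the limit `n → ∞`. The Wilson parameter is `r = 1`. -/

/-- Momentum space `ℝ²`, with the Euclidean norm. -/
abbrev Mom := EuclideanSpace ℝ (Fin 2)

/-- The lattice spacing `a = 2 ^ (-N)`. -/
def spacing (N : ℤ) : ℝ := (2 : ℝ) ^ (-N)

/-- The side `L = n a` of the box. -/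
def boxSide (N : ℤ) (n : ℕ+) : ℝ := (n : ℕ) * spacing N

/-- The periodic lattice `Λ = aℤ² / Lℤ²`, in units of the spacing. -/
abbrev Site (n : ℕ+) := Fin 2 → ZMod (n : ℕ)

/-- Labels for the dual lattice `Λ* = (2π/L) ℤ² ∩ (-π/a, π/a]²`. -/
abbrev DualSite (n : ℕ+) := Fin 2 → ZMod (n : ℕ)

/-- The position in `(-L/2, L/2]²` of a site; `ZMod.valMinAbs` is the representative
in `(-n/2, n/2]`. -/
def position (N : ℤ) {n : ℕ+} (x : Site n) (μ : Fin 2) : ℝ :=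
  spacing N * ((x μ).valMinAbs : ℝ)

/-- The momentum in `(2π/L) ℤ² ∩ (-π/a, π/a]²` with a given label. -/
def momentum (N : ℤ) {n : ℕ+} (k : DualSite n) : Mom :=
  WithLp.toLp 2 fun μ => 2 * Real.pi / boxSide N n * ((k μ).valMinAbs : ℝ)

/-- The Brillouin zone `(-π/a, π/a]²`. -/
def brillouin (a : ℝ) : Set Mom :=
  {p | ∀ μ, p μ ∈ Set.Ioc (-(Real.pi / a)) (Real.pi / a)}

/-- `k · x`. -/
def pairing (k : Mom) (x : Fin 2 → ℝ) : ℝ := ∑ μ, k μ * x μ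

/-- The unit lattice step in direction `μ`. -/
def latticeStep {n : ℕ+} (μ : Fin 2) : Site n := Pi.single μ 1

/-- `∫_Λ dx f(x) = a² ∑_{x ∈ Λ} f(x)`. -/
def siteInt (N : ℤ) {n : ℕ+} (f : Site n → ℂ) : ℂ :=
  (spacing N : ℂ) ^ 2 * ∑ x, f x

/-- Fermionic labels `η = (x, s)`; the two spinor indices are `0` and `1`. -/
abbrev FermionLabel (n : ℕ+) := Site n × Fin 2

/-- Bosonic labels `b = (x, μ, ε)`, `ε = ±1`. -/
abbrev BosonLabel (n : ℕ+) := Site n × Fin 2 × ℤˣ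

/-- `∫ dη f(η) = ∑_s ∫_Λ dx f(x, s)`. -/
def fermionInt (N : ℤ) {n : ℕ+} (f : FermionLabel n → ℂ) : ℂ :=
  ∑ s, siteInt N fun x => f (x, s)

/-- The lattice delta function, periodic with period `L`. -/
def latticeDelta (N : ℤ) {n : ℕ+} (x : Site n) : ℂ :=
  if x = 0 then (2 : ℂ) ^ (2 * N) else 0

/-! ### The free Wilson fermion -/

/-- The Euclidean gamma matrices. -/
def gamma : Fin 2 → Matrix (Fin 2) (Fin 2) ℂ :=
  ![!![1, 0; 0, -1], !![0, -Complex.I; Complex.I, 0]]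

/-- `s_μ(k) = 2^N sin(2^{-N} k_μ)`. -/
def latticeSin (N : ℤ) (k : Mom) (μ : Fin 2) : ℝ :=
  (2 : ℝ) ^ N * Real.sin ((2 : ℝ) ^ (-N) * k μ)

/-- The Wilson mass `M_N(k) = 2 ∑_μ 2^N sin²(2^{-N-1} k_μ)`. -/
def wilsonMass (N : ℤ) (k : Mom) : ℝ :=
  2 * ∑ μ, (2 : ℝ) ^ N * Real.sin ((2 : ℝ) ^ (-N - 1) * k μ) ^ 2

/-- The matrix `-i ∑_μ γ_μ s_μ(k) + m + M_N(k)`. -/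
def diracSymbol (N : ℤ) (m : ℝ) (k : Mom) : Matrix (Fin 2) (Fin 2) ℂ :=
  -(Complex.I • ∑ μ, (latticeSin N k μ : ℂ) • gamma μ)
    + ((m + wilsonMass N k : ℝ) : ℂ) • (1 : Matrix (Fin 2) (Fin 2) ℂ)

/-- The propagator with momentum weight `w`,
`g(x) = L^{-2} ∑_{k ∈ Λ*} e^{-ik·x} w(k) (-i s̸(k) + m + M_N(k))⁻¹`. -/
def propagator (N : ℤ) {n : ℕ+} (m : ℝ) (w : Mom → ℝ) (x : Site n) :
    Matrix (Fin 2) (Fin 2) ℂ :=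
  ((boxSide N n : ℂ) ^ 2)⁻¹ • ∑ k : DualSite n,
    (Complex.exp (-Complex.I * (pairing (momentum N k) (position N x) : ℂ))
        * (w (momentum N k) : ℂ)) •
      (diracSymbol N m (momentum N k))⁻¹

/-- The propagator between two fermionic labels. -/
def propagatorEntry (N : ℤ) {n : ℕ+} (m : ℝ) (w : Mom → ℝ) (η η' : FermionLabel n) : ℂ :=
  propagator N m w (η.1 - η'.1) η.2 η'.2

/-- The momentum weight `1` of the full propagator `g^{(≤N)}`. -/
def fullWeight : Mom → ℝ := fun _ => 1

/-- The momentum weight `1 - χ(2^{-h}|k|)` of the ultraviolet propagator `g^{(h,N]}`. -/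
def uvWeight (χ : ℝ → ℝ) (h : ℤ) : Mom → ℝ := fun k => 1 - χ ((2 : ℝ) ^ (-h) * ‖k‖)

/-- The scale `h*_M = ⌊log₂ M⌋` of the boson mass. -/
def massScale (M : ℝ) : ℤ := ⌊Real.logb 2 M⌋

/-- The momentum cutoff: a non-negative, non-increasing function of Gevrey class 2 on the half
line, equal to `1` on `[0, 1/2]` and to `0` on `[1, ∞)`. -/
structure IsCutoff (χ : ℝ → ℝ) : Prop where
  nonneg : ∀ t, 0 ≤ t → 0 ≤ χ t
  anti : AntitoneOn χ (Set.Ici 0)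
  smooth : ContDiff ℝ ∞ χ
  gevrey : ∃ C₁ C₂ : ℝ, 0 < C₁ ∧ 0 < C₂ ∧
    ∀ (j : ℕ) (t : ℝ), |iteratedDeriv j χ t| ≤ C₁ * C₂ ^ j * (j ! : ℝ) ^ 2
  one_of_le : ∀ t ∈ Set.Icc (0 : ℝ) (1 / 2), χ t = 1
  zero_of_ge : ∀ t, 1 ≤ t → χ t = 0

/-! ### The bare vertex, the tadpole and the bubble -/

/-- The kernel `c_b(η, η')` of the bilinear `O_b(ψ) = ∫ dη dη' ψ⁺_η c_b(η,η') ψ⁻_{η'}`, that is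
`O_{x,μ,+} = ½ ψ⁺_x (γ_μ - 1) ψ⁻_{x+aê_μ}` and `O_{x,μ,-} = -½ ψ⁺_{x+aê_μ} (γ_μ + 1) ψ⁻_x`. -/
def bareVertex (N : ℤ) {n : ℕ+} : BosonLabel n → FermionLabel n → FermionLabel n → ℂ
  | (y, μ, ε), (x, s), (x', s') =>
    if ε = 1 then
      1 / 2 * latticeDelta N (x - y) * latticeDelta N (x' - y - latticeStep μ)
        * (gamma μ - 1) s s'
    else
      -(1 / 2) * latticeDelta N (x' - y) * latticeDelta N (x - y - latticeStep μ)
        * (gamma μ + 1) s s'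

/-- The tadpole `T = -2^{-N} ∫ dη₁ dη₂ c_b(η₁,η₂) g_{η₂,η₁}`. -/
def tadpole (N : ℤ) {n : ℕ+} (m : ℝ) (w : Mom → ℝ) (b : BosonLabel n) : ℂ :=
  -(2 : ℂ) ^ (-N) * fermionInt N fun η₁ => fermionInt N fun η₂ =>
    bareVertex N b η₁ η₂ * propagatorEntry N m w η₂ η₁

/-- The bubble in position space,
`Π(b₁,b₂) = ½ ∫ dη₁ dη₁' dη₂ dη₂' c_{b₁}(η₁,η₁') c_{b₂}(η₂,η₂') g_{η₁',η₂} g_{η₂',η₁}`. -/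
def bubble (N : ℤ) {n : ℕ+} (m : ℝ) (w : Mom → ℝ) (b₁ b₂ : BosonLabel n) : ℂ :=
  1 / 2 * fermionInt N fun η₁ => fermionInt N fun η₁' =>
    fermionInt N fun η₂ => fermionInt N fun η₂' =>
      bareVertex N b₁ η₁ η₁' * bareVertex N b₂ η₂ η₂'
        * propagatorEntry N m w η₁' η₂ * propagatorEntry N m w η₂' η₁

/-- The bubble in momentum space, a function on `Λ*`:
`Π̂_{μν}(p) = ½ ∑_{ε,ε'} ε ε' L^{-2} ∫ dx dy e^{-ip·(x-y)} Π((x,μ,ε),(y,ν,ε'))`. -/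
def bubbleHat (N : ℤ) {n : ℕ+} (m : ℝ) (w : Mom → ℝ) (μ ν : Fin 2) (p : DualSite n) : ℂ :=
  1 / 2 * ∑ ε : ℤˣ, ∑ ε' : ℤˣ, ((ε : ℤ) : ℂ) * ((ε' : ℤ) : ℂ) *
    (((boxSide N n : ℂ) ^ 2)⁻¹ * siteInt N fun x : Site n => siteInt N fun y : Site n =>
      Complex.exp (-Complex.I * (pairing (momentum N p)
          (fun α => position N x α - position N y α) : ℂ))
        * bubble N m w (x, μ, ε) (y, ν, ε'))

/-- The Kronecker delta. -/
def kron (μ ν : Fin 2) : ℂ := if μ = ν then 1 else 0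

/-- The free current correlation `-2 (δ_{μν} T + 2 Π̂_{μν}(p))` on `Λ*`. -/
def currentHat (N : ℤ) {n : ℕ+} (m : ℝ) (w : Mom → ℝ) (μ ν : Fin 2) (p : DualSite n) : ℂ :=
  -2 * (kron μ ν * tadpole N m w ((0, 0, 1) : BosonLabel n) + 2 * bubbleHat N m w μ ν p)

/-! ### Limits -/

/-- The functions `F n` on `Λ*` extend to continuous functions on the Brillouin zone
`(-π/a, π/a]²`, and the extensions converge to `G` as `L → ∞`, uniformly on that zone. -/
def ExtendsWithUniformLimit (N : ℤ) (F : (n : ℕ+) → DualSite n → ℂ) (G : Mom → ℂ) : Prop :=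
  ∃ E : ℕ+ → Mom → ℂ,
    (∀ n, ContinuousOn (E n) (brillouin (spacing N))) ∧
    (∀ (n : ℕ+) (p : DualSite n), E n (momentum N p) = F n p) ∧
    TendstoUniformlyOn E G atTop (brillouin (spacing N))

/-- For a family `F M m n` of functions on `Λ*`, defined for `M > 0`, `h*_M < N` and
`0 < |m| < 2^{h*_M}`: continuous extension in `p` and existence of the `L → ∞` limit uniformly
in `p`; and, at each `p ≠ 0`, existence of the limits `m → 0` and then `M → 0⁺`, with value
`G p`. -/
def UVLimits (N : ℤ) (F : (M m : ℝ) → (n : ℕ+) → DualSite n → ℂ) (G : Mom → ℂ) : Prop :=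
  ∃ (F₁ : ℝ → ℝ → Mom → ℂ) (F₂ : ℝ → Mom → ℂ),
    (∀ M m : ℝ, 0 < M → massScale M < N → m ≠ 0 → |m| < (2 : ℝ) ^ massScale M →
      ExtendsWithUniformLimit N (F M m) (F₁ M m)) ∧
    (∀ M : ℝ, 0 < M → massScale M < N → ∀ p ∈ brillouin (spacing N), p ≠ 0 →
      Tendsto (fun m => F₁ M m p) (𝓝[≠] 0) (𝓝 (F₂ M p))) ∧
    (∀ p ∈ brillouin (spacing N), p ≠ 0 →
      Tendsto (fun M => F₂ M p) (𝓝[>] 0) (𝓝 (G p)))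

/-- The same for a family that does not depend on `M`, defined for `0 < |m| < 2^{N-1}`. -/
def FullLimits (N : ℤ) (F : (m : ℝ) → (n : ℕ+) → DualSite n → ℂ) (G : Mom → ℂ) : Prop :=
  ∃ F₁ : ℝ → Mom → ℂ,
    (∀ m : ℝ, m ≠ 0 → |m| < (2 : ℝ) ^ (N - 1) → ExtendsWithUniformLimit N (F m) (F₁ m)) ∧
    (∀ p ∈ brillouin (spacing N), p ≠ 0 →
      Tendsto (fun m => F₁ m p) (𝓝[≠] 0) (𝓝 (G p)))

/-- The limiting bubble `(2 p_μ p_ν - |p|² δ_{μν}) / (8π|p|²) + R(ap)`. -/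
def limitBubble (N : ℤ) (R : Fin 2 → Fin 2 → Mom → ℂ) (μ ν : Fin 2) (p : Mom) : ℂ :=
  1 / (8 * (Real.pi : ℂ) * (‖p‖ : ℂ) ^ 2)
      * (2 * (p μ : ℂ) * (p ν : ℂ) - (‖p‖ : ℂ) ^ 2 * kron μ ν)
    + R μ ν (spacing N • p)

/-- The limiting current correlation
`(1/π) (δ_{μν} - p_μ p_ν / |p|²) - 4 (R(ap) - R(0))`. -/
def limitCurrent (N : ℤ) (R : Fin 2 → Fin 2 → Mom → ℂ) (μ ν : Fin 2) (p : Mom) : ℂ :=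
  1 / (Real.pi : ℂ) * (kron μ ν - (p μ : ℂ) * (p ν : ℂ) / (‖p‖ : ℂ) ^ 2)
    - 4 * (R μ ν (spacing N • p) - R μ ν 0)

end LatticeQED

end

/-! In units of the lattice spacing, momenta live on the unit torus, and `N` survives only in the
rescaled mass `2^(-N) m` and in the argument of `χ`. Lattice exponentials are group characters, so
summing over positions enforces momentum conservation and turns the finite-volume tadpole and bubble
into averages over the dual lattice of functions on the torus (`tadpole_eq_latticeAvg`,
`bubbleHat_eq_latticeAvg`). The Wilson term leaves the origin as the only possible zero of the Dirac
determinant, and `m ≠ 0` removes it. The integrands are then continuous, and `L → ∞` is the uniform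
convergence of Riemann sums.

The propagator is bounded by `1/|x|`, uniformly in the mass and in the weight. The two poles of the
bubble are separated by `q ≠ 0`, and `1/(|x||x+q|)` is at most `|q|^(-1/2) (|x|^(-3/2) +
|x+q|^(-3/2))`, which is integrable in two dimensions. Dominated convergence gives `m → 0` and
afterwards `M → 0`, where the weight at a fixed nonzero momentum is eventually equal to one. Both
propagators therefore lead to the same massless integrals `massless` and `tadpoleLimit`, in which
the spacing enters only through `q = ap`.

It remains to study `massless` near the origin. The massless lattice propagator differs from the
continuum one by a bounded amount. Replacing both factors of the bubble by their continuum models,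
cut off to a disc, costs a constant and an error `O(|q|^(1/2))` (`IsSingular.hasModel`). The
continuum trace involves only `z⁻¹ (z+w)⁻¹`, whose radially cut off integral is exactly `-π
conj(w)/w` (`chiralIntegral_eq`). This is the explicit tensor of the theorem.

The constant is found without evaluating any integral. When the momentum points along the axis `μ`,
the Ward identity reduces the bubble to tadpoles (`massless_single`): it equals `-δ T₀/2` there,
while the explicit part equals `δ/(8π)`. Hence `R(0) = -δ (T₀/2 + 1/(8π))`. This value cancels the
tadpole in the current correlation and makes the remaining tensor transverse (`limitCurrent_eq`). -/

noncomputable section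

namespace LatticeQED

open MeasureTheory

/-! ### The Brillouin torus -/

/-- The two-dimensional unit torus. -/
abbrev Torus := Fin 2 → UnitAddCircle

/-- The covering map from the plane to the torus. -/
def toTorus (z : ℂ) : Torus := ![(z.re : UnitAddCircle), (z.im : UnitAddCircle)]

/-- A fundamental cell of the covering `toTorus`. -/
def cell : Set ℂ :=
  {z | z.re ∈ Set.Ioc (-1 / 2 : ℝ) (1 / 2) ∧ z.im ∈ Set.Ioc (-1 / 2 : ℝ) (1 / 2)}

lemma measurableSet_cell : MeasurableSet cell :=
  (Complex.measurable_re measurableSet_Ioc).inter (Complex.measurable_im measurableSet_Ioc)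

lemma toTorus_add (z w : ℂ) : toTorus (z + w) = toTorus z + toTorus w := by
  ext i; fin_cases i <;> simp [toTorus]

lemma toTorus_sub (z w : ℂ) : toTorus (z - w) = toTorus z - toTorus w := by
  ext i; fin_cases i <;> simp [toTorus]

lemma continuous_toTorus : Continuous toTorus := by
  refine continuous_pi fun i => ?_
  fin_cases i
  · exact (AddCircle.continuous_mk' 1).comp Complex.continuous_re
  · exact (AddCircle.continuous_mk' 1).comp Complex.continuous_im

/-- This is the bridge to the plane: torus integrals become integrals over `cell`, where the
singular part can be compared with a function on all of `ℂ` and treated in polar coordinates. -/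
lemma measurePreserving_toTorus : MeasurePreserving toTorus (volume.restrict cell) volume := by
  have h1 : MeasurePreserving (fun (a : Fin 2 → ℝ) i => (a i : UnitAddCircle))
      (Measure.pi fun _ => volume.restrict (Set.Ioc (-1 / 2 : ℝ) (1 / 2))) volume := by
    refine measurePreserving_pi _ _ fun i => ?_
    have := UnitAddCircle.measurePreserving_mk (-1 / 2)
    norm_num at this ⊢
    exact this
  rw [← Measure.restrict_pi_pi] at h1
  have h2 := Complex.volume_preserving_equiv_pi.restrict_preimage
    (s := Set.univ.pi fun _ : Fin 2 => Set.Ioc (-1 / 2 : ℝ) (1 / 2))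
    (MeasurableSet.univ_pi fun _ => measurableSet_Ioc)
  have h3 := h1.comp h2
  have hc : cell = Complex.measurableEquivPi ⁻¹'
      Set.univ.pi fun _ : Fin 2 => Set.Ioc (-1 / 2 : ℝ) (1 / 2) := by
    ext z
    simp [cell, Fin.forall_fin_two]
  have ht : toTorus = (fun (a : Fin 2 → ℝ) i => (a i : UnitAddCircle)) ∘
      Complex.measurableEquivPi := by
    funext z i
    fin_cases i <;> rfl
  rw [hc, ht]
  exact h3

lemma norm_toTorus_le (z : ℂ) : ‖toTorus z‖ ≤ ‖z‖ := by
  have key : ∀ t : ℝ, ‖(t : UnitAddCircle)‖ ≤ |t| := fun t => by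
    rw [UnitAddCircle.norm_eq]
    simpa using round_le t 0
  refine (pi_norm_le_iff_of_nonneg (norm_nonneg _)).2 fun i => ?_
  fin_cases i
  · exact (key _).trans (Complex.abs_re_le_norm z)
  · exact (key _).trans (Complex.abs_im_le_norm z)

lemma norm_coe_of_abs_le {t : ℝ} (h : |t| ≤ 1 / 2) : ‖(t : UnitAddCircle)‖ = |t| := by
  rw [AddCircle.norm_coe_eq_abs_iff _ one_ne_zero]; simpa using h

/-- The torus carries the supremum norm and the plane the Euclidean one; `|re| + |im|` accounts for
the factor 2. Together with `norm_toTorus_le` the two norms are comparable on the cell. -/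
lemma norm_le_two_mul_norm_toTorus {z : ℂ} (h0 : |z.re| ≤ 1 / 2) (h1 : |z.im| ≤ 1 / 2) :
    ‖z‖ ≤ 2 * ‖toTorus z‖ := by
  have a := norm_le_pi_norm (toTorus z) 0
  have b := norm_le_pi_norm (toTorus z) 1
  simp only [toTorus, Matrix.cons_val_zero, Matrix.cons_val_one, norm_coe_of_abs_le h0,
    norm_coe_of_abs_le h1] at a b
  exact (Complex.norm_le_abs_re_add_abs_im z).trans (by simp only [toTorus]; linarith)

lemma norm_le_two_mul_norm_toTorus_of_norm_le {z : ℂ} (h : ‖z‖ ≤ 1 / 2) :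
    ‖z‖ ≤ 2 * ‖toTorus z‖ :=
  norm_le_two_mul_norm_toTorus ((Complex.abs_re_le_norm z).trans h)
    ((Complex.abs_im_le_norm z).trans h)

lemma norm_le_two_mul_norm_toTorus_of_mem_cell {z : ℂ} (h : z ∈ cell) :
    ‖z‖ ≤ 2 * ‖toTorus z‖ := by
  obtain ⟨⟨a, b⟩, c, d⟩ := h
  exact norm_le_two_mul_norm_toTorus (abs_le.2 ⟨by linarith, b⟩) (abs_le.2 ⟨by linarith, d⟩)

lemma norm_le_one_of_mem_cell {z : ℂ} (h : z ∈ cell) : ‖z‖ ≤ 1 := by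
  obtain ⟨⟨a, b⟩, c, d⟩ := h
  have h0 : |z.re| ≤ 1 / 2 := abs_le.2 ⟨by linarith, b⟩
  have h1 : |z.im| ≤ 1 / 2 := abs_le.2 ⟨by linarith, d⟩
  exact (Complex.norm_le_abs_re_add_abs_im z).trans (by linarith)

lemma mem_cell_of_norm_lt {z : ℂ} (h : ‖z‖ < 1 / 2) : z ∈ cell := by
  have h0 := abs_lt.1 ((Complex.abs_re_le_norm z).trans_lt h)
  have h1 := abs_lt.1 ((Complex.abs_im_le_norm z).trans_lt h)
  exact ⟨⟨by linarith, by linarith⟩, by linarith, by linarith⟩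

lemma norm_torus_le (x : Torus) : ‖x‖ ≤ 1 / 2 := by
  refine (pi_norm_le_iff_of_nonneg (by norm_num)).2 fun i => ?_
  simpa using AddCircle.norm_le_half_period (1 : ℝ) (x := x i) one_ne_zero

lemma integral_torus {f : Torus → ℂ} (hf : Measurable f) :
    ∫ x, f x = ∫ z in cell, f (toTorus z) := by
  rw [← measurePreserving_toTorus.map_eq, integral_map
    measurePreserving_toTorus.measurable.aemeasurable hf.aestronglyMeasurable]

lemma integrable_torus_iff {f : Torus → ℂ} (hf : Measurable f) :
    Integrable f ↔ IntegrableOn (fun z => f (toTorus z)) cell := by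
  conv_lhs => rw [← measurePreserving_toTorus.map_eq]
  rw [integrable_map_measure hf.aestronglyMeasurable
    measurePreserving_toTorus.measurable.aemeasurable]
  rfl

/-! ### The integrable majorant `t ↦ t ^ (-3/2)` -/

/-- The function `t ^ (-3/2)`. -/
def majorant (t : ℝ) : ℝ := (√t)⁻¹ ^ 3

lemma majorant_nonneg (t : ℝ) : 0 ≤ majorant t := by unfold majorant; positivity

lemma majorant_anti {s t : ℝ} (hs : 0 < s) (h : s ≤ t) : majorant t ≤ majorant s := by
  unfold majorant
  have : 0 < √s := Real.sqrt_pos.2 hs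
  gcongr

lemma measurable_majorant : Measurable majorant := by unfold majorant; fun_prop

/-- With `A = a^(-1/2)` and `B = b^(-1/2)`, the bound `√w ≤ √a + √b` reduces the claim to `A B² + A²
B ≤ A³ + B³`, that is `(A + B)(A - B)² ≥ 0`. Half a power of the distance `w` between two poles is
traded for separate singularities of order 3/2, which are integrable in the plane. -/
lemma inv_mul_inv_le_majorant {a b w : ℝ} (ha : 0 < a) (hb : 0 < b) (hw : w ≤ a + b) :
    √w * (a⁻¹ * b⁻¹) ≤ majorant a + majorant b := by
  have h1 : √w ≤ √a + √b := by
    rw [Real.sqrt_le_left (by positivity)]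
    nlinarith [Real.sq_sqrt ha.le, Real.sq_sqrt hb.le, Real.sqrt_nonneg a, Real.sqrt_nonneg b,
      mul_nonneg (Real.sqrt_nonneg a) (Real.sqrt_nonneg b)]
  have ea : a⁻¹ = (√a)⁻¹ ^ 2 := by rw [inv_pow, Real.sq_sqrt ha.le]
  have eb : b⁻¹ = (√b)⁻¹ ^ 2 := by rw [inv_pow, Real.sq_sqrt hb.le]
  have pa : 0 < √a := Real.sqrt_pos.2 ha
  have pb : 0 < √b := Real.sqrt_pos.2 hb
  have step : √w * (a⁻¹ * b⁻¹) ≤ (√a + √b) * (a⁻¹ * b⁻¹) := by gcongr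
  refine step.trans ?_
  unfold majorant
  rw [ea, eb]
  have e : (√a + √b) * ((√a)⁻¹ ^ 2 * (√b)⁻¹ ^ 2)
      = (√a)⁻¹ * (√b)⁻¹ ^ 2 + (√a)⁻¹ ^ 2 * (√b)⁻¹ := by field_simp
  rw [e]
  have pA : 0 < (√a)⁻¹ := by positivity
  have pB : 0 < (√b)⁻¹ := by positivity
  nlinarith [mul_nonneg (add_pos pA pB).le (sq_nonneg ((√a)⁻¹ - (√b)⁻¹))]

lemma mul_inv_mul_inv_le_majorant {a b w : ℝ} (ha : 0 < a) (hb : 0 < b) (hw : w ≤ a + b)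
    (hw0 : 0 ≤ w) : w * (a⁻¹ * b⁻¹) ≤ √w * (majorant a + majorant b) := by
  have := mul_le_mul_of_nonneg_left (inv_mul_inv_le_majorant ha hb hw) (Real.sqrt_nonneg w)
  rwa [← mul_assoc, Real.mul_self_sqrt hw0] at this

lemma inv_mul_inv_le_majorant' {a b w : ℝ} (ha : 0 < a) (hb : 0 < b) (hw : w ≤ a + b)
    (hw0 : 0 < w) : a⁻¹ * b⁻¹ ≤ (√w)⁻¹ * (majorant a + majorant b) := by
  have h := inv_mul_inv_le_majorant ha hb hw
  have p : 0 < √w := Real.sqrt_pos.2 hw0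
  calc a⁻¹ * b⁻¹ = (√w)⁻¹ * (√w * (a⁻¹ * b⁻¹)) := by field_simp
    _ ≤ _ := by gcongr

/-- In polar coordinates the Jacobian turns `t^(-3/2)` into `t^(-1/2)`. -/
lemma integrableOn_majorant_norm (r : ℝ) :
    IntegrableOn (fun z : ℂ => majorant ‖z‖) (Metric.ball 0 r) := by
  rw [integrableOn_fun_norm_addHaar]
  have h : IntegrableOn (fun y : ℝ => y ^ (-1 / 2 : ℝ)) (Set.Ioo 0 r) := by
    rcases le_or_gt r 0 with hr | hr
    · rw [Set.Ioo_eq_empty (by simpa using hr)]; exact integrableOn_empty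
    · have := intervalIntegral.intervalIntegrable_rpow' (a := 0) (b := r)
        (r := (-1 / 2 : ℝ)) (by norm_num)
      rw [intervalIntegrable_iff_integrableOn_Ioo_of_le hr.le] at this
      exact this
  refine h.congr_fun (fun y hy => ?_) measurableSet_Ioo
  have hy0 : 0 < y := hy.1
  simp only [Complex.finrank_real_complex, majorant, smul_eq_mul]
  have p : 0 < √y := Real.sqrt_pos.2 hy0
  rw [show (-1 / 2 : ℝ) = -(1 / 2) by norm_num, Real.rpow_neg hy0.le, ← Real.sqrt_eq_rpow]
  norm_num
  field_simp
  exact Real.sq_sqrt hy0.le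

lemma majorant_div_two (t : ℝ) : majorant (t / 2) = (√2) ^ 3 * majorant t := by
  unfold majorant
  rw [Real.sqrt_div' _ (by norm_num), inv_div, div_eq_mul_inv, mul_pow]

lemma integrable_majorant_torus : Integrable (fun x : Torus => majorant ‖x‖) := by
  have hm : Measurable (fun x : Torus => majorant ‖x‖) := measurable_majorant.comp measurable_norm
  rw [← measurePreserving_toTorus.map_eq, integrable_map_measure hm.aestronglyMeasurable
    measurePreserving_toTorus.measurable.aemeasurable]
  have h1 : IntegrableOn (fun z : ℂ => (√2) ^ 3 * majorant ‖z‖) cell :=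
    ((integrableOn_majorant_norm 2).mono_set fun z hz => by
      simpa using (norm_le_one_of_mem_cell hz).trans_lt one_lt_two).const_mul _
  refine Integrable.mono' h1 (hm.comp continuous_toTorus.measurable).aestronglyMeasurable ?_
  refine (ae_restrict_iff' measurableSet_cell).2 (Eventually.of_forall fun z hz => ?_)
  simp only [Function.comp]
  rw [Real.norm_of_nonneg (majorant_nonneg _), ← majorant_div_two]
  -- At the origin both sides vanish, because `majorant 0 = 0`.
  rcases eq_or_ne z 0 with rfl | h0
  · have : toTorus 0 = 0 := by simpa using toTorus_sub 0 0
    simp [majorant, this]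
  · exact majorant_anti (by positivity) (by linarith [norm_le_two_mul_norm_toTorus_of_mem_cell hz])

lemma integrable_majorant_add (q : Torus) :
    Integrable (fun x : Torus => majorant ‖x‖ + majorant ‖x + q‖) :=
  integrable_majorant_torus.add (integrable_majorant_torus.comp_add_right q)

lemma integral_majorant_add (q : Torus) :
    ∫ x : Torus, (majorant ‖x‖ + majorant ‖x + q‖) = 2 * ∫ x : Torus, majorant ‖x‖ := by
  rw [integral_add integrable_majorant_torus (integrable_majorant_torus.comp_add_right q),
    integral_add_right_eq_self (fun x : Torus => majorant ‖x‖), two_mul]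

lemma ae_ne_torus (q : Torus) : ∀ᵐ x : Torus, x ≠ q := by
  have : (volume : Measure Torus) {q} = 0 := by
    have h (x : UnitAddCircle) : (volume : Measure UnitAddCircle) {x} = 0 := by
      simpa using AddCircle.volume_closedBall 1 (x := x) 0
    rw [← Set.univ_pi_singleton q, volume_pi_pi]
    simp [h]
  exact compl_mem_ae_iff.2 this

lemma ae_norm_pos (q : Torus) : ∀ᵐ x : Torus, 0 < ‖x‖ ∧ 0 < ‖x + q‖ := by
  filter_upwards [ae_ne_torus 0, ae_ne_torus (-q)] with x h1 h2
  exact ⟨norm_pos_iff.2 h1, norm_pos_iff.2 fun h => h2 (eq_neg_of_add_eq_zero_left h)⟩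

lemma norm_le_add_norm (x q : Torus) : ‖q‖ ≤ ‖x‖ + ‖x + q‖ := by
  calc ‖q‖ = ‖(x + q) - x‖ := by congr 1; abel
    _ ≤ _ := by rw [add_comm ‖x‖]; exact norm_sub_le _ _

/-! ### Convolutions of functions with an inverse-distance singularity -/

/-- `f` has an inverse-distance singularity at the origin of the torus, modelled up to a bounded
error by the function `α` on the plane. -/
structure IsSingular (f : Torus → ℂ) (α : ℂ → ℂ) (K : ℝ) : Prop where
  measurable : Measurable f
  measurable_model : Measurable α
  norm_le : ∀ x, x ≠ 0 → ‖f x‖ ≤ K * ‖x‖⁻¹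
  lip : ∀ x y, x ≠ 0 → y ≠ 0 → ‖f x - f y‖ ≤ K * (‖x - y‖ * (‖x‖⁻¹ * ‖y‖⁻¹))
  model_norm_le : ∀ z, z ≠ 0 → ‖α z‖ ≤ K * ‖z‖⁻¹
  model_lip : ∀ z w, z ≠ 0 → w ≠ 0 → ‖α z - α w‖ ≤ K * (‖z - w‖ * (‖z‖⁻¹ * ‖w‖⁻¹))
  close : ∀ z, z ≠ 0 → ‖z‖ ≤ 1 / 8 → ‖f (toTorus z) - α z‖ ≤ K

/-- A radial Lipschitz cutoff, equal to `1` for `‖z‖ ≤ 1/32` and to `0` for `‖z‖ ≥ 1/16`. -/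
def cutoff (z : ℂ) : ℝ := max 0 (min 1 (2 - 32 * ‖z‖))

lemma cutoff_nonneg (z : ℂ) : 0 ≤ cutoff z := le_max_left _ _

lemma cutoff_le_one (z : ℂ) : cutoff z ≤ 1 := max_le zero_le_one (min_le_left _ _)

lemma cutoff_eq_one {z : ℂ} (h : ‖z‖ ≤ 1 / 32) : cutoff z = 1 := by
  unfold cutoff
  rw [min_eq_left (by linarith), max_eq_right zero_le_one]

lemma cutoff_eq_zero {z : ℂ} (h : 1 / 16 ≤ ‖z‖) : cutoff z = 0 := by
  unfold cutoff
  exact max_eq_left ((min_le_right _ _).trans (by linarith))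

lemma continuous_cutoff : Continuous cutoff := by unfold cutoff; fun_prop

lemma abs_cutoff_sub_le (z w : ℂ) : |cutoff z - cutoff w| ≤ 32 * ‖z - w‖ := by
  unfold cutoff
  refine (abs_max_sub_max_le_max _ _ _ _).trans ?_
  rw [sub_self, abs_zero, max_eq_right (abs_nonneg _)]
  refine (abs_min_sub_min_le_max _ _ _ _).trans ?_
  rw [sub_self, abs_zero, max_eq_right (abs_nonneg _)]
  have := abs_norm_sub_norm_le w z
  rw [show 2 - 32 * ‖z‖ - (2 - 32 * ‖w‖) = 32 * (‖w‖ - ‖z‖) by ring, abs_mul,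
    norm_sub_rev z w]
  norm_num
  exact this

/-- The majorant, cut off to a disc in the plane. -/
def discMajorant (z : ℂ) : ℝ := (Metric.ball (0 : ℂ) (1 / 2)).indicator (fun z => majorant ‖z‖) z

lemma discMajorant_nonneg (z : ℂ) : 0 ≤ discMajorant z :=
  Set.indicator_nonneg (fun _ _ => majorant_nonneg _) _

lemma discMajorant_eq {z : ℂ} (h : ‖z‖ < 1 / 2) : discMajorant z = majorant ‖z‖ :=
  Set.indicator_of_mem (by simpa using h) _

lemma integrable_discMajorant : Integrable discMajorant :=
  (integrableOn_majorant_norm _).integrable_indicator measurableSet_ball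

lemma inv_le_majorant {t : ℝ} (h0 : 0 < t) (h1 : t ≤ 1) : t⁻¹ ≤ majorant t := by
  have p : 0 < √t := Real.sqrt_pos.2 h0
  have q : 1 ≤ (√t)⁻¹ := (one_le_inv₀ p).2 (Real.sqrt_le_one.2 h1)
  calc t⁻¹ = (√t)⁻¹ ^ 2 := by rw [inv_pow, Real.sq_sqrt h0.le]
    _ ≤ _ := pow_le_pow_right₀ q (by norm_num)

/-- The model singularity of an `IsSingular` function, cut off to a disc. -/
def cutModel (α : ℂ → ℂ) (z : ℂ) : ℂ := cutoff z * α z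

lemma nonneg_of_norm_le {α : ℂ → ℂ} {K : ℝ} (h : ∀ z, z ≠ 0 → ‖α z‖ ≤ K * ‖z‖⁻¹) : 0 ≤ K := by
  have := h 1 one_ne_zero
  simp only [norm_one, inv_one, mul_one] at this
  exact (norm_nonneg _).trans this

lemma measurable_cutModel {α : ℂ → ℂ} (h : Measurable α) : Measurable (cutModel α) :=
  (Complex.measurable_ofReal.comp continuous_cutoff.measurable).mul h

lemma ae_ne_plane (w : ℂ) : ∀ᵐ z : ℂ, z ≠ w := compl_mem_ae_iff.2 (measure_singleton w)

/-- The two poles are separated by `w`, and the cutoff keeps both `z` and `z + w` in the disc of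
radius 1/2. Only the bounds by inverse distances enter, so the lemma also covers the plain function
`z⁻¹`. -/
lemma integrable_cutModel_mul {α β : ℂ → ℂ} {K K' : ℝ} (hα : Measurable α) (hβ : Measurable β)
    (hαK : ∀ z, z ≠ 0 → ‖α z‖ ≤ K * ‖z‖⁻¹) (hβK : ∀ z, z ≠ 0 → ‖β z‖ ≤ K' * ‖z‖⁻¹) {w : ℂ}
    (hw0 : w ≠ 0) (hw : ‖w‖ ≤ 1 / 16) : Integrable fun z => cutModel α z * β (z + w) := by
  refine (((integrable_discMajorant.add (integrable_discMajorant.comp_add_right w)).const_mul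
    (√‖w‖)⁻¹).const_mul (K * K')).mono' ((measurable_cutModel hα).mul
      (hβ.comp (measurable_add_const w))).aestronglyMeasurable ?_
  filter_upwards [ae_ne_plane 0, ae_ne_plane (-w)] with z h1 h2
  have hzw : z + w ≠ 0 := fun h => h2 (eq_neg_of_add_eq_zero_left h)
  have hK := nonneg_of_norm_le hαK
  have hK' := nonneg_of_norm_le hβK
  simp only [Pi.add_apply]
  rcases lt_or_ge ‖z‖ (1 / 16) with h | h
  · have hs : ‖z + w‖ < 1 / 2 := (norm_add_le _ _).trans_lt (by linarith)
    rw [discMajorant_eq (by linarith), discMajorant_eq hs, cutModel, norm_mul, norm_mul,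
      Complex.norm_real, Real.norm_of_nonneg (cutoff_nonneg z)]
    have t : ‖w‖ ≤ ‖z‖ + ‖z + w‖ := by
      calc ‖w‖ = ‖(z + w) - z‖ := by congr 1; ring
        _ ≤ _ := by rw [add_comm ‖z‖]; exact norm_sub_le _ _
    have h3 := inv_mul_inv_le_majorant' (norm_pos_iff.2 h1) (norm_pos_iff.2 hzw) t
      (norm_pos_iff.2 hw0)
    calc cutoff z * ‖α z‖ * ‖β (z + w)‖ ≤ 1 * (K * ‖z‖⁻¹) * (K' * ‖z + w‖⁻¹) := by
          have := cutoff_nonneg z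
          gcongr
          · exact cutoff_le_one z
          · exact hαK z h1
          · exact hβK _ hzw
      _ = K * K' * (‖z‖⁻¹ * ‖z + w‖⁻¹) := by ring
      _ ≤ _ := by gcongr
  · simp only [cutModel, cutoff_eq_zero h, Complex.ofReal_zero, zero_mul, norm_zero]
    have := discMajorant_nonneg z
    have := discMajorant_nonneg (z + w)
    positivity

/-- `J` agrees near the origin with `M`, up to a constant and an error of order `|w| ^ (1/2)`. -/
def HasModel (J : Torus → ℂ) (M : ℂ → ℂ) : Prop :=
  ∃ (c : ℂ) (A : ℝ), ∀ w : ℂ, w ≠ 0 → ‖w‖ ≤ 1 / 16 → ‖J (toTorus w) - M w - c‖ ≤ A * √‖w‖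

namespace IsSingular

variable {f g : Torus → ℂ} {α β : ℂ → ℂ} {K K' : ℝ}

lemma nonneg (hf : IsSingular f α K) : 0 ≤ K := nonneg_of_norm_le hf.model_norm_le

lemma norm_cutModel_le (hf : IsSingular f α K) {z : ℂ} (hz : z ≠ 0) :
    ‖cutModel α z‖ ≤ K * discMajorant z := by
  rcases lt_or_ge ‖z‖ (1 / 16) with h | h
  · rw [discMajorant_eq (by linarith), cutModel, norm_mul, Complex.norm_real,
      Real.norm_of_nonneg (cutoff_nonneg z)]
    have h1 := hf.model_norm_le z hz
    have h2 := inv_le_majorant (norm_pos_iff.2 hz) (by linarith)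
    calc cutoff z * ‖α z‖ ≤ 1 * (K * ‖z‖⁻¹) := by gcongr; exact cutoff_le_one z
      _ ≤ K * majorant ‖z‖ := by rw [one_mul]; exact mul_le_mul_of_nonneg_left h2 hf.nonneg
  · simp only [cutModel, cutoff_eq_zero h, Complex.ofReal_zero, zero_mul, norm_zero]
    exact mul_nonneg hf.nonneg (discMajorant_nonneg z)

lemma integrable_cutModel (hf : IsSingular f α K) : Integrable (cutModel α) := by
  refine (integrable_discMajorant.const_mul K).mono' (measurable_cutModel hf.measurable_model).aestronglyMeasurable ?_
  filter_upwards [compl_mem_ae_iff.2 (measure_singleton (0 : ℂ))] with z hz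
  exact hf.norm_cutModel_le hz

/-- The constant is `33 = 1 + 32`: the bound for the model itself plus the Lipschitz constant of the
cutoff. The latter term has only one inverse distance, and `‖w‖ ≤ 1` allows the second to be
inserted. -/
lemma norm_cutModel_sub_le (hf : IsSingular f α K) {z w : ℂ} (hz : z ≠ 0) (hw : w ≠ 0)
    (h : ‖w‖ ≤ 1) :
    ‖cutModel α w - cutModel α z‖ ≤ 33 * K * (‖w - z‖ * (‖z‖⁻¹ * ‖w‖⁻¹)) := by
  have e : cutModel α w - cutModel α z
      = cutoff w * (α w - α z) + ((cutoff w - cutoff z : ℝ) : ℂ) * α z := by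
    simp only [cutModel]; push_cast; ring
  have h1 := hf.model_lip w z hw hz
  have h2 := hf.model_norm_le z hz
  have h3 := abs_cutoff_sub_le w z
  have p : 1 ≤ ‖w‖⁻¹ := (one_le_inv₀ (norm_pos_iff.2 hw)).2 h
  have hK := hf.nonneg
  rw [e]
  refine (norm_add_le _ _).trans ?_
  rw [norm_mul, norm_mul, Complex.norm_real, Complex.norm_real,
    Real.norm_of_nonneg (cutoff_nonneg w), Real.norm_eq_abs]
  calc cutoff w * ‖α w - α z‖ + |cutoff w - cutoff z| * ‖α z‖
      ≤ 1 * (K * (‖w - z‖ * (‖w‖⁻¹ * ‖z‖⁻¹))) + 32 * ‖w - z‖ * (K * (‖z‖⁻¹ * ‖w‖⁻¹)) := by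
        gcongr
        · exact cutoff_le_one w
        · exact h2.trans (mul_le_mul_of_nonneg_left
            (le_mul_of_one_le_right (by positivity) p) hK)
    _ = _ := by ring

/-- The bounded difference between `g` and its model, near the singularity. -/
def remainder (g : Torus → ℂ) (β : ℂ → ℂ) (z : ℂ) : ℂ :=
  (Metric.closedBall (0 : ℂ) (1 / 8) \ {0}).indicator (fun z => g (toTorus z) - β z) z

lemma measurable_remainder (hg : IsSingular g β K) : Measurable (remainder g β) :=
  ((hg.measurable.comp continuous_toTorus.measurable).sub hg.measurable_model).indicator
    (measurableSet_closedBall.diff (measurableSet_singleton 0))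

lemma norm_remainder_le (hg : IsSingular g β K) (z : ℂ) : ‖remainder g β z‖ ≤ K := by
  unfold remainder
  by_cases h : z ∈ Metric.closedBall (0 : ℂ) (1 / 8) \ {0}
  · rw [Set.indicator_of_mem h]
    exact hg.close z h.2 (by simpa using h.1)
  · rw [Set.indicator_of_notMem h, norm_zero]; exact hg.nonneg

lemma remainder_eq_zero {z : ℂ} (h : 1 / 8 < ‖z‖) : remainder g β z = 0 := by
  refine Set.indicator_of_notMem (fun h' => ?_) _
  have := h'.1
  rw [mem_closedBall_zero_iff] at this
  linarith

lemma remainder_eq {z : ℂ} (h0 : z ≠ 0) (h : ‖z‖ ≤ 1 / 8) :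
    remainder g β z = g (toTorus z) - β z := by
  unfold remainder
  exact Set.indicator_of_mem (show z ∈ Metric.closedBall (0 : ℂ) (1 / 8) \ {0} from
    ⟨by simpa using h, h0⟩) _

/-- Up to radius 1/32 the cutoff is one and the modelling error is bounded. Between 1/32 and 1/8 the
model is at most `32 K` in addition. Beyond 1/8 the cutoff vanishes and `f` is at a distance at
least 1/16 from its pole. -/
lemma norm_sub_cutModel_le (hf : IsSingular f α K) {z : ℂ} (hz : z ∈ cell) (h0 : z ≠ 0) :
    ‖f (toTorus z) - cutModel α z‖ ≤ 64 * K := by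
  have hK := hf.nonneg
  rcases le_or_gt ‖z‖ (1 / 32) with h | h
  · rw [cutModel, cutoff_eq_one h, Complex.ofReal_one, one_mul]
    exact (hf.close z h0 (by linarith)).trans (by linarith)
  · rcases le_or_gt ‖z‖ (1 / 8) with h8 | h8
    · have e : f (toTorus z) - cutModel α z
          = (f (toTorus z) - α z) + ((1 - cutoff z : ℝ) : ℂ) * α z := by
        simp only [cutModel]; push_cast; ring
      rw [e]
      refine (norm_add_le _ _).trans ?_
      rw [norm_mul, Complex.norm_real,
        Real.norm_of_nonneg (by linarith [cutoff_le_one z])]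
      have h1 := hf.close z h0 h8
      have h2 := hf.model_norm_le z h0
      have h3 : ‖z‖⁻¹ ≤ 32 := by
        rw [inv_le_comm₀ (norm_pos_iff.2 h0) (by norm_num)]; linarith
      have h4 : (1 - cutoff z) * ‖α z‖ ≤ 1 * (K * 32) := by
        have := cutoff_nonneg z
        have := cutoff_le_one z
        gcongr
        · linarith
        · exact h2.trans (by gcongr)
      linarith
    · rw [cutModel, cutoff_eq_zero (by linarith), Complex.ofReal_zero, zero_mul, sub_zero]
      have h1 := norm_le_two_mul_norm_toTorus_of_mem_cell hz
      have h2 : 0 < ‖toTorus z‖ := by linarith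
      have h3 : ‖toTorus z‖⁻¹ ≤ 16 := by
        rw [inv_le_comm₀ h2 (by norm_num)]; linarith
      have := hf.norm_le _ (norm_pos_iff.1 h2)
      nlinarith

lemma integrable (hg : IsSingular g β K) : Integrable g := by
  refine (integrable_majorant_torus.const_mul K).mono' hg.measurable.aestronglyMeasurable ?_
  filter_upwards [ae_ne_torus 0] with x hx
  have hp := norm_pos_iff.2 hx
  exact (hg.norm_le x hx).trans (mul_le_mul_of_nonneg_left
    (inv_le_majorant hp (by linarith [norm_torus_le x])) hg.nonneg)

/-- The Hölder exponent 1/2 originates here: a translation by `q` costs `√‖q‖` times a function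
whose integral does not depend on `q`. -/
lemma norm_shift_sub_le (hg : IsSingular g β K) {x q : Torus} (hx : 0 < ‖x‖)
    (hxq : 0 < ‖x + q‖) :
    ‖g (x + q) - g x‖ ≤ K * (√‖q‖ * (majorant ‖x‖ + majorant ‖x + q‖)) := by
  refine (hg.lip _ _ (norm_pos_iff.1 hxq) (norm_pos_iff.1 hx)).trans ?_
  rw [add_sub_cancel_left, mul_comm ‖x + q‖⁻¹]
  exact mul_le_mul_of_nonneg_left
    (mul_inv_mul_inv_le_majorant hx hxq (norm_le_add_norm x q) (norm_nonneg _)) hg.nonneg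

lemma norm_mul_shift_le (hf : IsSingular f α K) (hg : IsSingular g β K') {x q : Torus}
    (hq : q ≠ 0) (hx : 0 < ‖x‖) (hxq : 0 < ‖x + q‖) :
    ‖f x * g (x + q)‖ ≤ K * K' * ((√‖q‖)⁻¹ * (majorant ‖x‖ + majorant ‖x + q‖)) := by
  rw [norm_mul]
  have h1 := hf.norm_le x (norm_pos_iff.1 hx)
  have h2 := hg.norm_le (x + q) (norm_pos_iff.1 hxq)
  have h3 := inv_mul_inv_le_majorant' hx hxq (norm_le_add_norm x q) (norm_pos_iff.2 hq)
  have hK := hf.nonneg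
  have hK' := hg.nonneg
  calc ‖f x‖ * ‖g (x + q)‖ ≤ (K * ‖x‖⁻¹) * (K' * ‖x + q‖⁻¹) := by gcongr
    _ = K * K' * (‖x‖⁻¹ * ‖x + q‖⁻¹) := by ring
    _ ≤ _ := by gcongr

lemma integrable_mul_shift (hf : IsSingular f α K) (hg : IsSingular g β K') {q : Torus}
    (hq : q ≠ 0) : Integrable fun x => f x * g (x + q) := by
  refine (((integrable_majorant_add q).const_mul (√‖q‖)⁻¹).const_mul (K * K')).mono'
    (hf.measurable.mul (hg.measurable.comp (measurable_add_const q))).aestronglyMeasurable ?_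
  filter_upwards [ae_norm_pos q] with x hx
  exact hf.norm_mul_shift_le hg hq hx.1 hx.2

/-- The integral of a product stays bounded away from coinciding singularities. -/
lemma norm_integral_mul_shift_le (hf : IsSingular f α K) (hg : IsSingular g β K') {q : Torus}
    (hq : q ≠ 0) :
    ‖∫ x, f x * g (x + q)‖ ≤ K * K' * ((√‖q‖)⁻¹ * (2 * ∫ x : Torus, majorant ‖x‖)) := by
  refine (norm_integral_le_of_norm_le
    (((integrable_majorant_add q).const_mul (√‖q‖)⁻¹).const_mul (K * K')) ?_).trans_eq ?_
  · filter_upwards [ae_norm_pos q] with x hx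
    exact hf.norm_mul_shift_le hg hq hx.1 hx.2
  · rw [integral_const_mul, integral_const_mul, integral_majorant_add]

lemma ae_torus_of_cell {p : Torus → Prop} (h : ∀ᵐ x, p x) :
    ∀ᵐ z ∂(volume.restrict cell), p (toTorus z) :=
  measurePreserving_toTorus.quasiMeasurePreserving.ae h

lemma integrable_cutModel_mul_model (hf : IsSingular f α K) (hg : IsSingular g β K') {w : ℂ}
    (hw0 : w ≠ 0) (hw : ‖w‖ ≤ 1 / 16) : Integrable fun z => cutModel α z * β (z + w) :=
  integrable_cutModel_mul hf.measurable_model hg.measurable_model hf.model_norm_le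
    hg.model_norm_le hw0 hw

lemma integrable_cutModel_mul_remainder (hf : IsSingular f α K) (hg : IsSingular g β K')
    (v w : ℂ) : Integrable fun z => cutModel α (z - v) * remainder g β (z + w) :=
  (hf.integrable_cutModel.comp_sub_right v).mul_bdd (c := K')
    (hg.measurable_remainder.comp (measurable_add_const w)).aestronglyMeasurable
    (Eventually.of_forall fun _ => hg.norm_remainder_le _)

lemma integrableOn_error_mul (hf : IsSingular f α K) (hg : IsSingular g β K') (q : Torus) :
    IntegrableOn (fun z => (f (toTorus z) - cutModel α z) * g (toTorus z + q)) cell := by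
  have h := (integrable_torus_iff (hg.measurable.comp (measurable_add_const q))).1
    (hg.integrable.comp_add_right q)
  refine Integrable.bdd_mul (c := 64 * K) h ((hf.measurable.comp continuous_toTorus.measurable).sub
    (measurable_cutModel hf.measurable_model)).aestronglyMeasurable ?_
  filter_upwards [ae_restrict_mem measurableSet_cell, ae_restrict_of_ae (ae_ne_plane 0)] with z h1 h2
  exact hf.norm_sub_cutModel_le h1 h2

/-- Each factor is split into its model and a bounded remainder. In the first term the bounded
factor does not move and the shift acts on `g`. In the second the change of variables moves the
shift from the remainder, which is only known to be bounded, onto the cut-off model, whose modulus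
of continuity is known. The third term is the model correlation. -/
lemma integral_mul_shift_eq (hf : IsSingular f α K) (hg : IsSingular g β K') {w : ℂ}
    (hw0 : w ≠ 0) (hw : ‖w‖ ≤ 1 / 16) :
    ∫ x, f x * g (x + toTorus w)
      = (∫ z in cell, (f (toTorus z) - cutModel α z) * g (toTorus z + toTorus w))
        + (∫ z, cutModel α (z - w) * remainder g β z)
        + ∫ z, cutModel α z * β (z + w) := by
  have hsupp : ∀ (h : ℂ → ℂ), ∫ z in cell, cutModel α z * h z = ∫ z, cutModel α z * h z := by
    intro h
    refine setIntegral_eq_integral_of_forall_compl_eq_zero fun z hz => ?_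
    have : 1 / 16 ≤ ‖z‖ := by
      by_contra hlt
      exact hz (mem_cell_of_norm_lt (by linarith))
    simp [cutModel, cutoff_eq_zero this]
  have e1 : ∫ z, cutModel α (z - w) * remainder g β z
      = ∫ z, cutModel α z * remainder g β (z + w) := by
    rw [← integral_add_right_eq_self (fun z => cutModel α (z - w) * remainder g β z) w]
    simp
  have i0 : Integrable fun z => cutModel α z * remainder g β (z + w) := by
    simpa using hf.integrable_cutModel_mul_remainder hg 0 w
  have e2 := integral_torus (f := fun x => f x * g (x + toTorus w))
    (hf.measurable.mul (hg.measurable.comp (measurable_add_const _)))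
  rw [e2, e1,
    ← hsupp, ← hsupp, ← integral_add (hf.integrableOn_error_mul hg _),
    ← integral_add]
  · refine integral_congr_ae (ae_restrict_of_ae ?_)
    filter_upwards [ae_ne_plane (-w)] with z hz
    have hzw : z + w ≠ 0 := fun h => hz (eq_neg_of_add_eq_zero_left h)
    rw [← toTorus_add]
    rcases lt_or_ge ‖z‖ (1 / 16) with h | h
    -- On the support of the cutoff `‖z‖ < 1/16`, and `‖w‖ ≤ 1/16`, so `z + w` stays in the disc of
    -- radius 1/8 where the remainder is `g - β`.
    · rw [remainder_eq hzw ((norm_add_le _ _).trans (by linarith))]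
      ring
    · have : cutModel α z = 0 := by simp [cutModel, cutoff_eq_zero h]
      rw [this]; ring
  · exact (hf.integrableOn_error_mul hg _).add
      i0.integrableOn
  · exact (hf.integrable_cutModel_mul_model hg hw0 hw).integrableOn
  · exact i0.integrableOn

lemma norm_integral_error_sub_le (hf : IsSingular f α K) (hg : IsSingular g β K') (q : Torus) :
    ‖(∫ z in cell, (f (toTorus z) - cutModel α z) * g (toTorus z + q))
        - ∫ z in cell, (f (toTorus z) - cutModel α z) * g (toTorus z)‖
      ≤ 128 * K * K' * (∫ x : Torus, majorant ‖x‖) * √‖q‖ := by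
  have h0 := hf.integrableOn_error_mul hg 0
  simp only [add_zero] at h0
  rw [← integral_sub (hf.integrableOn_error_mul hg q) h0]
  have hm : Measurable fun x : Torus => majorant ‖x‖ + majorant ‖x + q‖ :=
    (measurable_majorant.comp measurable_norm).add
      (measurable_majorant.comp (measurable_norm.comp (measurable_add_const q)))
  have hI := integrable_majorant_add q
  rw [← measurePreserving_toTorus.map_eq, integrable_map_measure hm.aestronglyMeasurable
    measurePreserving_toTorus.measurable.aemeasurable] at hI
  have hE : ∫ z in cell, (majorant ‖toTorus z‖ + majorant ‖toTorus z + q‖)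
      = 2 * ∫ x : Torus, majorant ‖x‖ := by
    rw [← integral_majorant_add q]
    conv_rhs => rw [← measurePreserving_toTorus.map_eq, integral_map
      measurePreserving_toTorus.measurable.aemeasurable hm.aestronglyMeasurable]
  refine (norm_integral_le_of_norm_le (hI.const_mul (64 * K * (K' * √‖q‖))) ?_).trans_eq ?_
  · filter_upwards [ae_restrict_mem measurableSet_cell, ae_restrict_of_ae (ae_ne_plane 0),
      ae_torus_of_cell (ae_norm_pos q)] with z h1 h2 h3
    rw [← mul_sub, norm_mul]
    have a := hf.norm_sub_cutModel_le h1 h2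
    have b := hg.norm_shift_sub_le h3.1 h3.2
    have hK := hf.nonneg
    calc _ ≤ (64 * K) * (K' * (√‖q‖ * (majorant ‖toTorus z‖ + majorant ‖toTorus z + q‖))) := by
          gcongr
      _ = _ := by simp only [Function.comp]; ring
  · simp only [Function.comp]
    rw [integral_const_mul, hE]; ring

lemma norm_integral_remainder_sub_le (hf : IsSingular f α K) (hg : IsSingular g β K') {w : ℂ}
    (hw : ‖w‖ ≤ 1 / 16) :
    ‖(∫ z, cutModel α (z - w) * remainder g β z) - ∫ z, cutModel α z * remainder g β z‖
      ≤ 66 * K * K' * (∫ z, discMajorant z) * √‖w‖ := by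
  have i1 := hf.integrable_cutModel_mul_remainder hg w 0
  have i0 := hf.integrable_cutModel_mul_remainder hg 0 0
  simp only [add_zero, sub_zero] at i1 i0
  rw [← integral_sub i1 i0]
  have hI := (integrable_discMajorant.add (integrable_discMajorant.comp_sub_right w)).const_mul
    (33 * K * K' * √‖w‖)
  refine (norm_integral_le_of_norm_le hI ?_).trans_eq ?_
  · filter_upwards [ae_ne_plane 0, ae_ne_plane w] with z h1 h2
    have hzw : z - w ≠ 0 := sub_ne_zero.2 h2
    rw [← sub_mul, norm_mul]
    have hK := hf.nonneg
    have hK' := hg.nonneg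
    simp only [Pi.add_apply]
    -- Inside radius 1/8, both `z` and `z - w` lie in the disc where `discMajorant` is the majorant;
    -- outside, the remainder vanishes.
    rcases le_or_gt ‖z‖ (1 / 8) with h | h
    · have hn : ‖z - w‖ < 1 / 2 := (norm_sub_le _ _).trans_lt (by linarith)
      rw [discMajorant_eq (by linarith), discMajorant_eq hn]
      have a := hf.norm_cutModel_sub_le h1 hzw (by linarith)
      have e : ‖z - w - z‖ = ‖w‖ := by rw [← norm_neg]; congr 1; ring
      rw [e] at a
      have t : ‖w‖ ≤ ‖z‖ + ‖z - w‖ := by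
        calc ‖w‖ = ‖z - (z - w)‖ := by congr 1; ring
          _ ≤ _ := norm_sub_le _ _
      have b := mul_inv_mul_inv_le_majorant (norm_pos_iff.2 h1) (norm_pos_iff.2 hzw) t
        (norm_nonneg _)
      calc _ ≤ (33 * K * (√‖w‖ * (majorant ‖z‖ + majorant ‖z - w‖))) * K' := by
            refine mul_le_mul (a.trans ?_) (hg.norm_remainder_le z) (norm_nonneg _) ?_
            · gcongr
            · have := majorant_nonneg ‖z‖
              have := majorant_nonneg ‖z - w‖
              positivity
        _ = _ := by ring
    · rw [remainder_eq_zero h, norm_zero, mul_zero]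
      have := discMajorant_nonneg z
      have := discMajorant_nonneg (z - w)
      positivity
  · rw [integral_const_mul, integral_add' integrable_discMajorant
      (integrable_discMajorant.comp_sub_right w), integral_sub_right_eq_self discMajorant]
    ring

/-- The correlation of two functions with inverse-distance singularities agrees, up to a constant
and an error of order `|w| ^ (1/2)`, with that of their models. -/
theorem hasModel (hf : IsSingular f α K) (hg : IsSingular g β K') :
    HasModel (fun q => ∫ x, f x * g (x + q)) (fun w => ∫ z, cutModel α z * β (z + w)) := by
  -- The constant is the value at `w = 0` of the first two terms of the decomposition; the model
  -- term, singular there, is kept in full.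
  refine ⟨(∫ z in cell, (f (toTorus z) - cutModel α z) * g (toTorus z))
      + ∫ z, cutModel α z * remainder g β z,
    128 * K * K' * (∫ x : Torus, majorant ‖x‖) + 66 * K * K' * ∫ z, discMajorant z,
    fun w hw0 hw => ?_⟩
  beta_reduce
  rw [hf.integral_mul_shift_eq hg hw0 hw]
  have h1 := hf.norm_integral_error_sub_le hg (toTorus w)
  have h2 := hf.norm_integral_remainder_sub_le hg hw
  have hK := hf.nonneg
  have hK' := hg.nonneg
  have hs : √‖toTorus w‖ ≤ √‖w‖ := Real.sqrt_le_sqrt (norm_toTorus_le w)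
  have hM : 0 ≤ ∫ x : Torus, majorant ‖x‖ := integral_nonneg fun _ => majorant_nonneg _
  have h3 : 128 * K * K' * (∫ x : Torus, majorant ‖x‖) * √‖toTorus w‖
      ≤ 128 * K * K' * (∫ x : Torus, majorant ‖x‖) * √‖w‖ := by gcongr
  set A1 := ∫ z in cell, (f (toTorus z) - cutModel α z) * g (toTorus z + toTorus w)
  set A0 := ∫ z in cell, (f (toTorus z) - cutModel α z) * g (toTorus z)
  set B1 := ∫ z, cutModel α (z - w) * remainder g β z
  set B0 := ∫ z, cutModel α z * remainder g β z
  set Mn := ∫ z, cutModel α z * β (z + w)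
  calc ‖A1 + B1 + Mn - Mn - (A0 + B0)‖ = ‖(A1 - A0) + (B1 - B0)‖ := by congr 1; ring
    _ ≤ ‖A1 - A0‖ + ‖B1 - B0‖ := norm_add_le _ _
    _ ≤ _ := by linarith

end IsSingular

/-! ### The continuum bubble -/

/-- The chiral continuum bubble with a radial cutoff. -/
def chiralIntegral (w : ℂ) : ℂ := ∫ z : ℂ, (cutoff z : ℂ) * (z⁻¹ * (z + w)⁻¹)

lemma integrable_chiral {w : ℂ} (hw0 : w ≠ 0) (hw : ‖w‖ ≤ 1 / 16) :
    Integrable fun z : ℂ => (cutoff z : ℂ) * (z⁻¹ * (z + w)⁻¹) := by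
  have := integrable_cutModel_mul (α := fun z : ℂ => z⁻¹) (β := fun z : ℂ => z⁻¹) (K := 1) (K' := 1)
    measurable_inv measurable_inv (by simp) (by simp) hw0 hw
  simpa only [cutModel, mul_assoc] using this

/-- By partial fractions, `1/(z²(z+w)) = 1/(w z²) - 1/(w² z) + 1/(w² (z+w))`. The first term
integrates to zero. If `-w` is inside the circle the other two residues cancel; if it is outside,
only the pole at the origin counts. -/
lemma circleIntegral_inv_sq_mul_inv {r : ℝ} (hr : 0 < r) {w : ℂ} (hw : w ≠ 0) (hne : r ≠ ‖w‖) :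
    (∮ z in C(0, r), (z ^ 2)⁻¹ * (z + w)⁻¹)
      = if r < ‖w‖ then -(2 * Real.pi * Complex.I) / w ^ 2 else 0 := by
  have hsph : ∀ z ∈ Metric.sphere (0 : ℂ) r, z ≠ 0 ∧ z + w ≠ 0 := by
    intro z hz
    have hz' : ‖z‖ = r := by simpa using hz
    refine ⟨norm_pos_iff.1 (hz' ▸ hr), fun h => hne ?_⟩
    rw [← hz', eq_neg_of_add_eq_zero_left h, norm_neg]
  have i1 : CircleIntegrable (fun z : ℂ => (z - 0) ^ (-2 : ℤ)) 0 r :=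
    ContinuousOn.circleIntegrable hr.le fun z hz =>
      ((continuousAt_zpow₀ _ _ (Or.inl (by simpa using (hsph z hz).1))).comp
        (by fun_prop)).continuousWithinAt
  have i2 : CircleIntegrable (fun z : ℂ => (z - 0)⁻¹) 0 r :=
    ContinuousOn.circleIntegrable hr.le fun z hz =>
      (ContinuousAt.inv₀ (by fun_prop) (by simpa using (hsph z hz).1)).continuousWithinAt
  have i3 : CircleIntegrable (fun z : ℂ => (z - -w)⁻¹) 0 r :=
    ContinuousOn.circleIntegrable hr.le fun z hz =>
      (ContinuousAt.inv₀ (by fun_prop) (by simpa using (hsph z hz).2)).continuousWithinAt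
  have e : (∮ z in C(0, r), (z ^ 2)⁻¹ * (z + w)⁻¹)
      = ∮ z in C(0, r), (w⁻¹ * (z - 0) ^ (-2 : ℤ) - (w ^ 2)⁻¹ * (z - 0)⁻¹)
          + (w ^ 2)⁻¹ * (z - -w)⁻¹ := by
    refine circleIntegral.integral_congr hr.le fun z hz => ?_
    obtain ⟨h1, h2⟩ := hsph z hz
    simp only [sub_zero, sub_neg_eq_add]
    rw [zpow_neg]
    norm_cast
    field_simp
    ring
  have j1 : CircleIntegrable (fun z : ℂ => w⁻¹ * (z - 0) ^ (-2 : ℤ)) 0 r := i1.const_smul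
  have j2 : CircleIntegrable (fun z : ℂ => (w ^ 2)⁻¹ * (z - 0)⁻¹) 0 r := i2.const_smul
  have j3 : CircleIntegrable (fun z : ℂ => (w ^ 2)⁻¹ * (z - -w)⁻¹) 0 r := i3.const_smul
  have j12 : CircleIntegrable (fun z : ℂ => w⁻¹ * (z - 0) ^ (-2 : ℤ) - (w ^ 2)⁻¹ * (z - 0)⁻¹)
    0 r := j1.sub j2
  rw [e, circleIntegral.integral_add j12 j3, circleIntegral.integral_sub j1 j2,
    circleIntegral.integral_const_mul, circleIntegral.integral_const_mul,
    circleIntegral.integral_const_mul, circleIntegral.integral_sub_zpow_of_ne (by norm_num),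
    circleIntegral.integral_sub_center_inv _ hr.ne']
  split_ifs with h
  · have : (∮ z in C(0, r), (z - -w)⁻¹) = 0 := by
      have hne' : ∀ z ∈ Metric.closedBall (0 : ℂ) r, z - -w ≠ 0 := by
        intro z hz h0
        have : ‖z‖ ≤ r := by simpa using hz
        rw [sub_eq_zero.1 h0, norm_neg] at this
        linarith
      refine Complex.circleIntegral_eq_zero_of_differentiable_on_off_countable hr.le
        Set.countable_empty (fun z hz => ?_) fun z hz => ?_
      · exact (ContinuousAt.inv₀ (f := fun z => z - -w) (by fun_prop)
          (hne' z hz)).continuousWithinAt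
      · exact DifferentiableAt.inv (by fun_prop) (hne' z (Metric.ball_subset_closedBall hz.1))
    rw [this]
    field_simp
    ring
  · have : (∮ z in C(0, r), (z - -w)⁻¹) = 2 * Real.pi * Complex.I :=
      circleIntegral.integral_sub_inv_of_mem_ball
        (by simpa using lt_of_le_of_ne (not_lt.1 h) hne.symm)
    rw [this]
    ring

lemma integral_angle_inv_mul_inv {r : ℝ} (hr : 0 < r) {w : ℂ} (hw : w ≠ 0) (hne : r ≠ ‖w‖) :
    (∫ θ in Set.Ioo (-Real.pi) Real.pi,
      (circleMap 0 r θ)⁻¹ * (circleMap 0 r θ + w)⁻¹)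
      = if r < ‖w‖ then -(2 * Real.pi) / w ^ 2 else 0 := by
  have hper : Function.Periodic (fun θ => (circleMap 0 r θ)⁻¹ * (circleMap 0 r θ + w)⁻¹)
      (2 * Real.pi) := fun θ => by simp only [periodic_circleMap 0 r θ]
  rw [← integral_Ioc_eq_integral_Ioo,
    ← intervalIntegral.integral_of_le (by linarith [Real.pi_pos])]
  have h := hper.intervalIntegral_add_eq (-Real.pi) 0
  rw [show -Real.pi + 2 * Real.pi = Real.pi by ring, zero_add] at h
  rw [h]
  have h2 := circleIntegral_inv_sq_mul_inv hr hw hne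
  rw [circleIntegral] at h2
  -- Since `dθ = dz/(iz)`, the angular integral is a contour integral with one more factor `z⁻¹`.
  have e : ∀ θ, (circleMap 0 r θ)⁻¹ * (circleMap 0 r θ + w)⁻¹ = -Complex.I *
      (deriv (circleMap 0 r) θ • (((circleMap 0 r θ) ^ 2)⁻¹ * (circleMap 0 r θ + w)⁻¹)) := by
    intro θ
    have h0 : circleMap 0 r θ ≠ 0 := circleMap_ne_center hr.ne'
    have h1 : circleMap 0 r θ + w ≠ 0 := fun h => hne (by
      rw [← abs_of_pos hr, ← norm_circleMap_zero r θ, eq_neg_of_add_eq_zero_left h, norm_neg])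
    rw [deriv_circleMap, smul_eq_mul]
    field_simp
    rw [Complex.I_sq]; ring
  simp_rw [e]
  rw [intervalIntegral.integral_const_mul, h2]
  split_ifs
  · rw [show -Complex.I * (-(2 * Real.pi * Complex.I) / w ^ 2)
      = (Complex.I * Complex.I) * (2 * Real.pi) / w ^ 2 by ring, Complex.I_mul_I]
    ring
  · simp

/-- Absolute integrability in polar coordinates, required to integrate over the angle first. -/
lemma integrableOn_polarCoord {f : ℂ → ℂ} (hm : Measurable f) (hf : Integrable f) :
    IntegrableOn (fun p : ℝ × ℝ => p.1 • f (Complex.polarCoord.symm p)) polarCoord.target := by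
  have hmeas : Measurable fun p : ℝ × ℝ => f (Complex.polarCoord.symm p) := by
    refine hm.comp ?_
    rw [show (Complex.polarCoord.symm : ℝ × ℝ → ℂ) = fun p =>
      p.1 * (Real.cos p.2 + Real.sin p.2 * Complex.I) from funext Complex.polarCoord_symm_apply]
    fun_prop
  refine ⟨(measurable_fst.smul hmeas).aestronglyMeasurable, ?_⟩
  have h := Complex.lintegral_comp_polarCoord_symm fun z => ‖f z‖ₑ
  have h2 := hf.2
  rw [HasFiniteIntegral, ← h] at h2
  rw [HasFiniteIntegral]
  refine lt_of_le_of_lt (le_of_eq ?_) h2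
  refine setLIntegral_congr_fun polarCoord.open_target.measurableSet fun p hp => ?_
  have hp1 : 0 < p.1 := hp.1
  rw [enorm_smul, smul_eq_mul, Real.enorm_of_nonneg hp1.le]

/-- The cutoff is radial and leaves the angular integral, which is `-2π/w²` for `r < ‖w‖` and zero
for `r > ‖w‖`. Because `‖w‖ ≤ 1/32`, the cutoff equals one on the contributing disc, so the answer
does not depend on its shape: `-2π/w² · ‖w‖²/2 = -π conj(w)/w`. -/
theorem chiralIntegral_eq {w : ℂ} (hw0 : w ≠ 0) (hw : ‖w‖ ≤ 1 / 32) :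
    chiralIntegral w = -Real.pi * (starRingEnd ℂ w / w) := by
  have hI := integrable_chiral hw0 (hw.trans (by norm_num))
  have hm : Measurable fun z : ℂ => (cutoff z : ℂ) * (z⁻¹ * (z + w)⁻¹) :=
    (Complex.measurable_ofReal.comp continuous_cutoff.measurable).mul
      (measurable_inv.mul (measurable_add_const w).inv)
  have hP := integrableOn_polarCoord hm hI
  rw [chiralIntegral, ← Complex.integral_comp_polarCoord_symm]
  rw [show polarCoord.target = Set.Ioi (0 : ℝ) ×ˢ Set.Ioo (-Real.pi) Real.pi from rfl] at hP ⊢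
  rw [Measure.volume_eq_prod, setIntegral_prod _ hP]
  have hr0 : ∀ᵐ r : ℝ, r ≠ ‖w‖ := compl_mem_ae_iff.2 (measure_singleton _)
  have e : ∫ r in Set.Ioi (0 : ℝ), ∫ θ in Set.Ioo (-Real.pi) Real.pi,
      r • ((cutoff (Complex.polarCoord.symm (r, θ)) : ℂ) * ((Complex.polarCoord.symm (r, θ))⁻¹
        * (Complex.polarCoord.symm (r, θ) + w)⁻¹))
      = ∫ r in Set.Ioi (0 : ℝ),
        (Set.Ioo (0 : ℝ) ‖w‖).indicator (fun r => ((r * (-(2 * Real.pi) / w ^ 2) : ℂ))) r := by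
    refine integral_congr_ae ?_
    filter_upwards [ae_restrict_mem measurableSet_Ioi, ae_restrict_of_ae hr0] with r hr hrw
    have hr' : 0 < r := hr
    have ec : ∀ θ, Complex.polarCoord.symm (r, θ) = circleMap 0 r θ := fun θ => by
      simp [circleMap, Complex.exp_mul_I]
    have hc : ∀ θ, cutoff (circleMap 0 r θ) = cutoff (r : ℂ) := fun θ => by
      simp [cutoff]
    simp only [ec, hc, Complex.real_smul]
    rw [integral_const_mul, integral_const_mul, integral_angle_inv_mul_inv hr' hw0 hrw]
    split_ifs with h
    · rw [Set.indicator_of_mem (Set.mem_Ioo.2 ⟨hr', h⟩), cutoff_eq_one]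
      · simp
      · simp only [Complex.norm_real, Real.norm_eq_abs, abs_of_pos hr']; linarith
    · rw [Set.indicator_of_notMem fun h' => h (Set.mem_Ioo.1 h').2]; simp
  rw [e, setIntegral_indicator measurableSet_Ioo,
    Set.inter_eq_right.2 (fun r hr => hr.1), integral_mul_const, ← integral_Ioc_eq_integral_Ioo,
    ← intervalIntegral.integral_of_le (norm_nonneg w), intervalIntegral.integral_ofReal,
    integral_id]
  have : ((‖w‖ ^ 2 : ℝ) : ℂ) = starRingEnd ℂ w * w := by
    rw [← Complex.normSq_eq_norm_sq, Complex.normSq_eq_conj_mul_self]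
  push_cast at this ⊢
  rw [this]
  field_simp
  ring

/-! ### The fundamental character -/

/-- The fundamental character of the circle, `t ↦ exp (2 π i t)`. -/
def ch (x : UnitAddCircle) : ℂ := AddCircle.toCircle x

lemma ch_add (x y : UnitAddCircle) : ch (x + y) = ch x * ch y := by
  simp [ch, AddCircle.toCircle_add]

@[simp] lemma ch_zero : ch 0 = 1 := by simp [ch]

@[simp] lemma norm_ch (x : UnitAddCircle) : ‖ch x‖ = 1 := Circle.norm_coe _

lemma ch_neg (x : UnitAddCircle) : ch (-x) = starRingEnd ℂ (ch x) := by
  rw [ch, AddCircle.toCircle_neg, Circle.coe_inv_eq_conj]; rfl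

lemma continuous_ch : Continuous ch :=
  continuous_subtype_val.comp AddCircle.continuous_toCircle

lemma ch_coe (t : ℝ) : ch (t : UnitAddCircle) = Complex.exp (2 * Real.pi * t * Complex.I) := by
  simp [ch, AddCircle.toCircle_apply_mk, Circle.coe_exp]

lemma exists_rep (x : UnitAddCircle) : ∃ t : ℝ, (t : UnitAddCircle) = x ∧ |t| ≤ 1 / 2 ∧ ‖x‖ = |t| := by
  obtain ⟨t, rfl⟩ := QuotientAddGroup.mk_surjective x
  refine ⟨t - round t, ?_, abs_sub_round t, UnitAddCircle.norm_eq⟩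
  have : ((round t : ℝ) : UnitAddCircle) = 0 := by
    rw [AddCircle.coe_eq_zero_iff]; exact ⟨round t, by simp⟩
  rw [AddCircle.coe_sub, this, sub_zero]

lemma norm_ch_coe_sub_one (t : ℝ) : ‖ch (t : UnitAddCircle) - 1‖ = 2 * |Real.sin (Real.pi * t)| := by
  rw [ch_coe, show (2 * Real.pi * t * Complex.I : ℂ) = Complex.I * ((2 * Real.pi * t : ℝ) : ℂ) by
    push_cast; ring, Complex.norm_exp_I_mul_ofReal_sub_one, norm_mul, Real.norm_eq_abs,
    Real.norm_eq_abs, show 2 * Real.pi * t / 2 = Real.pi * t by ring]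
  norm_num

lemma norm_ch_sub_one_le (x : UnitAddCircle) : ‖ch x - 1‖ ≤ 2 * Real.pi * ‖x‖ := by
  obtain ⟨t, rfl, -, ht⟩ := exists_rep x
  rw [norm_ch_coe_sub_one, ht]
  have := Real.abs_sin_le_abs (x := Real.pi * t)
  rw [abs_mul, abs_of_pos Real.pi_pos] at this
  linarith

/-- Jordan's inequality `sin s ≥ 2s/π` on `[0, π/2]`, applied at the representative of least
absolute value. -/
lemma le_norm_ch_sub_one (x : UnitAddCircle) : 4 * ‖x‖ ≤ ‖ch x - 1‖ := by
  obtain ⟨t, rfl, h2, ht⟩ := exists_rep x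
  rw [norm_ch_coe_sub_one, ht]
  have h : |Real.sin (Real.pi * t)| = |Real.sin (Real.pi * |t|)| := by
    rcases abs_choice t with h | h <;> rw [h]
    rw [mul_neg, Real.sin_neg, abs_neg]
  have hp := Real.pi_pos
  have := Real.mul_le_sin (x := Real.pi * |t|) (by positivity) (by nlinarith)
  rw [h]
  have e : 2 / Real.pi * (Real.pi * |t|) = 2 * |t| := by field_simp
  rw [e] at this
  linarith [le_abs_self (Real.sin (Real.pi * |t|))]

lemma norm_ch_sub_le (x y : UnitAddCircle) : ‖ch x - ch y‖ ≤ 2 * Real.pi * ‖x - y‖ := by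
  have : ch x - ch y = ch y * (ch (x - y) - 1) := by
    rw [mul_sub, ← ch_add, mul_one, add_sub_cancel]
  rw [this, norm_mul, norm_ch, one_mul]
  exact norm_ch_sub_one_le _

/-- The cosine on the circle of length one. -/
def cs (x : UnitAddCircle) : ℝ := (ch x).re

/-- The sine on the circle of length one. -/
def sn (x : UnitAddCircle) : ℝ := (ch x).im

lemma cs_sq_add_sn_sq (x : UnitAddCircle) : cs x ^ 2 + sn x ^ 2 = 1 := by
  have := Complex.sq_norm (ch x)
  rw [norm_ch, Complex.normSq_apply] at this
  unfold cs sn; linarith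

lemma continuous_cs : Continuous cs := Complex.continuous_re.comp continuous_ch

lemma continuous_sn : Continuous sn := Complex.continuous_im.comp continuous_ch

@[simp] lemma cs_neg (x : UnitAddCircle) : cs (-x) = cs x := by simp [cs, ch_neg]

@[simp] lemma sn_neg (x : UnitAddCircle) : sn (-x) = -sn x := by simp [sn, ch_neg]

lemma ch_eq (x : UnitAddCircle) : ch x = cs x + sn x * Complex.I := (Complex.re_add_im _).symm

lemma ch_neg_eq (x : UnitAddCircle) : ch (-x) = cs x - sn x * Complex.I := by
  rw [ch_eq, cs_neg, sn_neg]; push_cast; ring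

lemma abs_cs_sub_le (x y : UnitAddCircle) : |cs x - cs y| ≤ 2 * Real.pi * ‖x - y‖ := by
  rw [cs, cs, ← Complex.sub_re]
  exact (Complex.abs_re_le_norm _).trans (norm_ch_sub_le x y)

lemma abs_sn_sub_le (x y : UnitAddCircle) : |sn x - sn y| ≤ 2 * Real.pi * ‖x - y‖ := by
  rw [sn, sn, ← Complex.sub_im]
  exact (Complex.abs_im_le_norm _).trans (norm_ch_sub_le x y)

lemma one_sub_cs (x : UnitAddCircle) : 2 * (1 - cs x) = ‖ch x - 1‖ ^ 2 := by
  rw [Complex.sq_norm, Complex.normSq_apply]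
  have := cs_sq_add_sn_sq x
  simp only [Complex.sub_re, Complex.sub_im, Complex.one_re, Complex.one_im]
  change _ = (cs x - 1) * (cs x - 1) + (sn x - 0) * (sn x - 0)
  nlinarith

lemma le_one_sub_cs (x : UnitAddCircle) : 8 * ‖x‖ ^ 2 ≤ 1 - cs x := by
  have := one_sub_cs x
  have h := pow_le_pow_left₀ (by positivity) (le_norm_ch_sub_one x) 2
  nlinarith

lemma one_sub_cs_le (x : UnitAddCircle) : 1 - cs x ≤ 2 * Real.pi ^ 2 * ‖x‖ ^ 2 := by
  have := one_sub_cs x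
  have h := pow_le_pow_left₀ (norm_nonneg _) (norm_ch_sub_one_le x) 2
  nlinarith

/-! ### The Dirac operator in lattice units -/

/-- The Wilson mass term in lattice units. -/
def mass (m : ℝ) (x : Torus) : ℝ := m + ((1 - cs (x 0)) + (1 - cs (x 1)))

/-- The determinant of the Dirac symbol. -/
def diracDet (m : ℝ) (x : Torus) : ℝ := mass m x ^ 2 + sn (x 0) ^ 2 + sn (x 1) ^ 2

/-- The Dirac symbol in lattice units. -/
def dirac (m : ℝ) (x : Torus) : Matrix (Fin 2) (Fin 2) ℂ :=
  !![mass m x - Complex.I * sn (x 0), -sn (x 1); sn (x 1), mass m x + Complex.I * sn (x 0)]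

/-- The propagator in lattice units. -/
def prop (m : ℝ) (x : Torus) : Matrix (Fin 2) (Fin 2) ℂ :=
  ((diracDet m x : ℂ))⁻¹ • !![mass m x + Complex.I * sn (x 0), sn (x 1) ; -sn (x 1),
    mass m x - Complex.I * sn (x 0)]

/-- This expresses the absence of fermion doublers. If both cosines are nonnegative, then `sn² = (1
- cs)(1 + cs) ≥ 1 - cs` in each direction and the sines control the norm. Otherwise the Wilson term
exceeds 1, so the mass is at least 1/2 for every admissible `m`, while the norm on the torus is at
most 1/2. The bound is uniform in `m`, as dominated convergence requires. -/
lemma sq_norm_le_diracDet {m : ℝ} (hm : |m| ≤ 1 / 2) (x : Torus) : ‖x‖ ^ 2 ≤ diracDet m x := by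
  have h0 : 0 ≤ diracDet m x := by unfold diracDet; positivity
  rw [← Real.sqrt_le_sqrt_iff h0, Real.sqrt_sq (norm_nonneg _)]
  refine (pi_norm_le_iff_of_nonneg (Real.sqrt_nonneg _)).2 fun μ => ?_
  rw [Real.le_sqrt (norm_nonneg _) h0]
  have hm' := abs_le.1 hm
  have hx : ‖x μ‖ ≤ 1 / 2 := (norm_le_pi_norm x μ).trans (norm_torus_le x)
  have a0 := le_one_sub_cs (x 0)
  have a1 := le_one_sub_cs (x 1)
  have p0 := sq_nonneg ‖x 0‖
  have p1 := sq_nonneg ‖x 1‖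
  by_cases hc : 0 ≤ cs (x 0) ∧ 0 ≤ cs (x 1)
  · have key : ∀ ν : Fin 2, 0 ≤ cs (x ν) → ‖x ν‖ ^ 2 ≤ sn (x ν) ^ 2 := fun ν hν => by
      have h1 := le_one_sub_cs (x ν)
      have h2 := cs_sq_add_sn_sq (x ν)
      have h3 := sq_nonneg ‖x ν‖
      nlinarith
    have k0 := key 0 hc.1
    have k1 := key 1 hc.2
    unfold diracDet
    have := sq_nonneg (mass m x)
    fin_cases μ
    · simp only [Fin.zero_eta]; nlinarith [sq_nonneg (sn (x 1))]
    · simp only [Fin.mk_one]; nlinarith [sq_nonneg (sn (x 0))]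
  · have : 1 / 2 ≤ mass m x := by
      unfold mass
      rcases not_and_or.1 hc with h | h <;> push Not at h <;> linarith
    unfold diracDet
    nlinarith [sq_nonneg (sn (x 0)), sq_nonneg (sn (x 1)), norm_nonneg (x μ)]

lemma diracDet_pos {m : ℝ} (hm : |m| ≤ 1 / 2) {x : Torus} (hx : x ≠ 0) : 0 < diracDet m x :=
  (pow_pos (norm_pos_iff.2 hx) 2).trans_le (sq_norm_le_diracDet hm x)

/-- At the origin the determinant is `m²`. A nonzero mass thus makes the propagator continuous on
the whole torus, which the Riemann sums need. -/
lemma diracDet_pos_of_mass {m : ℝ} (hm : |m| ≤ 1 / 2) (h0 : m ≠ 0) (x : Torus) :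
    0 < diracDet m x := by
  rcases eq_or_ne x 0 with rfl | hx
  · simp only [diracDet, mass, Pi.zero_apply, cs, sn, ch_zero, Complex.one_re, Complex.one_im]
    norm_num
    positivity
  · exact diracDet_pos hm hx

lemma prop_mul_dirac {m : ℝ} {x : Torus} (h : diracDet m x ≠ 0) : prop m x * dirac m x = 1 := by
  have h' : (diracDet m x : ℂ) ≠ 0 := by exact_mod_cast h
  rw [prop, Matrix.smul_mul, inv_smul_eq_iff₀ h', dirac]
  ext i j
  fin_cases i <;> fin_cases j <;>
    simp [Matrix.mul_apply, Fin.sum_univ_two, diracDet] <;> ring_nf <;> simp [Complex.I_sq]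

lemma dirac_mul_prop {m : ℝ} {x : Torus} (h : diracDet m x ≠ 0) : dirac m x * prop m x = 1 :=
  mul_eq_one_comm.1 (prop_mul_dirac h)

lemma continuous_mass (m : ℝ) : Continuous (mass m) := by
  unfold mass
  have h0 := continuous_cs.comp (continuous_apply (A := fun _ : Fin 2 => UnitAddCircle) 0)
  have h1 := continuous_cs.comp (continuous_apply (A := fun _ : Fin 2 => UnitAddCircle) 1)
  simp only [Function.comp_def] at h0 h1
  fun_prop

lemma continuous_sn_apply (μ : Fin 2) : Continuous fun x : Torus => sn (x μ) :=
  continuous_sn.comp (continuous_apply μ)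

lemma continuous_ch_apply (μ : Fin 2) : Continuous fun x : Torus => ch (x μ) :=
  continuous_ch.comp (continuous_apply μ)

lemma continuous_diracDet (m : ℝ) : Continuous (diracDet m) := by
  unfold diracDet
  have h0 := continuous_sn_apply 0
  have h1 := continuous_sn_apply 1
  have := continuous_mass m
  fun_prop

/-- The numerator of the propagator. -/
def propNum (m : ℝ) (x : Torus) : Matrix (Fin 2) (Fin 2) ℂ :=
  !![mass m x + Complex.I * sn (x 0), sn (x 1) ; -sn (x 1), mass m x - Complex.I * sn (x 0)]

lemma prop_apply (m : ℝ) (x : Torus) (i j : Fin 2) :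
    prop m x i j = (diracDet m x : ℂ)⁻¹ * propNum m x i j := rfl

lemma continuous_propNum (m : ℝ) (i j : Fin 2) : Continuous fun x => propNum m x i j := by
  have h0 := Complex.continuous_ofReal.comp (continuous_sn_apply 0)
  have h1 := Complex.continuous_ofReal.comp (continuous_sn_apply 1)
  have h2 := Complex.continuous_ofReal.comp (continuous_mass m)
  simp only [Function.comp_def] at h0 h1 h2
  fin_cases i <;> fin_cases j <;> simp [propNum] <;> fun_prop

lemma measurable_prop (m : ℝ) (i j : Fin 2) : Measurable fun x => prop m x i j :=
  (Complex.measurable_ofReal.comp (continuous_diracDet m).measurable).inv.mul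
    (continuous_propNum m i j).measurable

lemma continuous_prop {m : ℝ} (hm : |m| ≤ 1 / 2) (h0 : m ≠ 0) (i j : Fin 2) :
    Continuous fun x => prop m x i j := by
  simp only [prop_apply]
  refine Continuous.mul (Continuous.inv₀ (Complex.continuous_ofReal.comp (continuous_diracDet m))
    fun x => ?_) (continuous_propNum m i j)
  exact_mod_cast (diracDet_pos_of_mass hm h0 x).ne'

lemma norm_propNum_sq_le (m : ℝ) (x : Torus) (i j : Fin 2) :
    ‖propNum m x i j‖ ^ 2 ≤ diracDet m x := by
  rw [Complex.sq_norm, Complex.normSq_apply, diracDet]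
  fin_cases i <;> fin_cases j <;> simp [propNum] <;>
    nlinarith [sq_nonneg (sn (x 0)), sq_nonneg (sn (x 1)), sq_nonneg (mass m x)]

lemma norm_prop_le {m : ℝ} (hm : |m| ≤ 1 / 2) {x : Torus} (hx : x ≠ 0) (i j : Fin 2) :
    ‖prop m x i j‖ ≤ ‖x‖⁻¹ := by
  have hd := diracDet_pos hm hx
  have hx' := norm_pos_iff.2 hx
  have hs : ‖x‖ ≤ √(diracDet m x) := Real.le_sqrt_of_sq_le (sq_norm_le_diracDet hm x)
  have hn : ‖propNum m x i j‖ ≤ √(diracDet m x) :=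
    Real.le_sqrt_of_sq_le (norm_propNum_sq_le m x i j)
  have hs0 := Real.sqrt_pos.2 hd
  rw [prop_apply, norm_mul, norm_inv, Complex.norm_real, Real.norm_of_nonneg hd.le]
  calc (diracDet m x)⁻¹ * ‖propNum m x i j‖ ≤ (diracDet m x)⁻¹ * √(diracDet m x) := by gcongr
    _ = (√(diracDet m x))⁻¹ := by
        nth_rewrite 1 [← Real.mul_self_sqrt hd.le]
        field_simp
    _ ≤ ‖x‖⁻¹ := by gcongr

lemma tendsto_prop {x : Torus} (hx : x ≠ 0) (i j : Fin 2) (s : ℝ) :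
    Tendsto (fun m => prop (s * m) x i j) (𝓝 0) (𝓝 (prop 0 x i j)) := by
  have hd := (diracDet_pos (m := 0) (by norm_num) hx).ne'
  have hc : ContinuousAt (fun m : ℝ => prop (s * m) x i j) 0 := by
    simp only [prop_apply]
    have hm : Continuous fun m : ℝ => (mass (s * m) x : ℂ) := by
      unfold mass; fun_prop
    refine ContinuousAt.mul (ContinuousAt.inv₀ ?_ ?_) ?_
    · unfold diracDet
      push_cast
      exact (((hm.pow 2).add continuous_const).add continuous_const).continuousAt
    · simp only [mul_zero]; exact_mod_cast hd
    · refine Continuous.continuousAt ?_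
      fin_cases i <;> fin_cases j <;> simp [propNum] <;> fun_prop
  simpa [ContinuousAt] using hc

/-! ### Comparison of lattice and continuum propagators -/

lemma norm_mul_mul_apply_le {A D B : Matrix (Fin 2) (Fin 2) ℂ} {a d b : ℝ}
    (hA : ∀ i j, ‖A i j‖ ≤ a) (hD : ∀ i j, ‖D i j‖ ≤ d) (hB : ∀ i j, ‖B i j‖ ≤ b) (i j : Fin 2) :
    ‖(A * D * B) i j‖ ≤ 4 * (a * d * b) := by
  have ha : 0 ≤ a := (norm_nonneg _).trans (hA 0 0)
  have hd : 0 ≤ d := (norm_nonneg _).trans (hD 0 0)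
  have key : ∀ k l, ‖A i k * D k l * B l j‖ ≤ a * d * b := fun k l => by
    rw [norm_mul, norm_mul]
    have h1 := hA i k
    have h2 := hD k l
    have h3 := hB l j
    gcongr
  simp only [Matrix.mul_apply, Fin.sum_univ_two, add_mul]
  have n := norm_add_le (A i 0 * D 0 0 * B 0 j + A i 1 * D 1 0 * B 0 j)
    (A i 0 * D 0 1 * B 1 j + A i 1 * D 1 1 * B 1 j)
  have n1 := norm_add_le (A i 0 * D 0 0 * B 0 j) (A i 1 * D 1 0 * B 0 j)
  have n2 := norm_add_le (A i 0 * D 0 1 * B 1 j) (A i 1 * D 1 1 * B 1 j)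
  linarith [key 0 0, key 0 1, key 1 0, key 1 1]

/-- The resolvent identity. It reduces every estimate on a difference of propagators to one on their
symbols, with an inverse distance on each side. -/
lemma sub_eq_mul_sub_mul {A B D E : Matrix (Fin 2) (Fin 2) ℂ} (hA : A * D = 1) (hB : E * B = 1) :
    A - B = A * (E - D) * B := by
  rw [mul_sub, sub_mul, mul_assoc A E B, hB, hA, mul_one, one_mul]

/-- The Wilson mass contributes `4π` and one sine `2π`; 19 is above `6π`. -/
lemma norm_dirac_sub_le (m : ℝ) (x y : Torus) (i j : Fin 2) :
    ‖dirac m y i j - dirac m x i j‖ ≤ 19 * ‖x - y‖ := by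
  have hc : |mass m y - mass m x| ≤ 4 * Real.pi * ‖x - y‖ := by
    have e : mass m y - mass m x = (cs (x 0) - cs (y 0)) + (cs (x 1) - cs (y 1)) := by
      unfold mass; ring
    rw [e]
    have h0 := abs_cs_sub_le (x 0) (y 0)
    have h1 := abs_cs_sub_le (x 1) (y 1)
    have g0 : ‖x 0 - y 0‖ ≤ ‖x - y‖ := norm_le_pi_norm (x - y) 0
    have g1 : ‖x 1 - y 1‖ ≤ ‖x - y‖ := norm_le_pi_norm (x - y) 1
    have := abs_add_le (cs (x 0) - cs (y 0)) (cs (x 1) - cs (y 1))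
    have hp := Real.pi_pos
    nlinarith
  have hs : ∀ μ, |sn (y μ) - sn (x μ)| ≤ 2 * Real.pi * ‖x - y‖ := fun μ => by
    rw [abs_sub_comm]
    have g0 : ‖x μ - y μ‖ ≤ ‖x - y‖ := norm_le_pi_norm (x - y) μ
    exact (abs_sn_sub_le (x μ) (y μ)).trans (by gcongr)
  have hp := Real.pi_lt_d2
  have hn := norm_nonneg (x - y)
  have d1 : ∀ s : ℂ, ‖s‖ = 1 → ‖((mass m y - mass m x : ℝ) : ℂ)
      + s * ((sn (y 0) - sn (x 0) : ℝ) : ℂ)‖ ≤ 19 * ‖x - y‖ := fun s hs1 => by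
    refine (norm_add_le _ _).trans ?_
    rw [norm_mul, hs1, Complex.norm_real, Complex.norm_real, Real.norm_eq_abs, Real.norm_eq_abs]
    nlinarith [hs 0]
  have d2 : ‖((sn (y 1) - sn (x 1) : ℝ) : ℂ)‖ ≤ 19 * ‖x - y‖ := by
    rw [Complex.norm_real, Real.norm_eq_abs]
    nlinarith [hs 1]
  fin_cases i <;> fin_cases j
  · refine (congrArg norm ?_).trans_le (d1 (-Complex.I) (by simp))
    simp [dirac]; ring
  · rw [← norm_neg] at d2
    refine (congrArg norm ?_).trans_le (d2)
    simp [dirac]; ring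
  · refine (congrArg norm ?_).trans_le (d2)
    simp [dirac]
  · refine (congrArg norm ?_).trans_le (d1 Complex.I (by simp))
    simp [dirac]; ring

/-- The continuum massless Dirac symbol. -/
def contDirac (z : ℂ) : Matrix (Fin 2) (Fin 2) ℂ :=
  !![-(Complex.I * (2 * Real.pi * z.re)), -(2 * Real.pi * z.im);
    2 * Real.pi * z.im, Complex.I * (2 * Real.pi * z.re)]

/-- The continuum massless propagator. -/
def contProp (z : ℂ) : Matrix (Fin 2) (Fin 2) ℂ :=
  ((2 * Real.pi * Complex.normSq z : ℝ) : ℂ)⁻¹ • !![Complex.I * z.re, (z.im : ℂ);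
    -z.im, -(Complex.I * z.re)]

lemma contProp_mul_contDirac {z : ℂ} (hz : z ≠ 0) : contProp z * contDirac z = 1 := by
  have hn : ((2 * Real.pi * Complex.normSq z : ℝ) : ℂ) ≠ 0 := by
    have := Complex.normSq_pos.2 hz
    have := Real.pi_pos
    exact_mod_cast (by positivity : 2 * Real.pi * Complex.normSq z ≠ 0)
  rw [contProp, Matrix.smul_mul, inv_smul_eq_iff₀ hn, contDirac]
  ext i j
  fin_cases i <;> fin_cases j <;>
    simp [Matrix.mul_apply, Fin.sum_univ_two, Complex.normSq_apply] <;> ring_nf <;>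
      simp [Complex.I_sq]

lemma contDirac_mul_contProp {z : ℂ} (hz : z ≠ 0) : contDirac z * contProp z = 1 :=
  mul_eq_one_comm.1 (contProp_mul_contDirac hz)

lemma measurable_contProp (i j : Fin 2) : Measurable fun z => contProp z i j := by
  have : Measurable fun z : ℂ => ((2 * Real.pi * Complex.normSq z : ℝ) : ℂ)⁻¹ :=
    (Complex.measurable_ofReal.comp
      (measurable_const.mul Complex.continuous_normSq.measurable)).inv
  have h0 : Measurable fun z : ℂ => (z.re : ℂ) :=
    Complex.measurable_ofReal.comp Complex.measurable_re
  have h1 : Measurable fun z : ℂ => (z.im : ℂ) :=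
    Complex.measurable_ofReal.comp Complex.measurable_im
  refine this.mul ?_
  fin_cases i <;> fin_cases j <;> simp <;> fun_prop

lemma norm_contProp_le {z : ℂ} (hz : z ≠ 0) (i j : Fin 2) : ‖contProp z i j‖ ≤ ‖z‖⁻¹ := by
  have hz' := norm_pos_iff.2 hz
  have hn : ‖(!![Complex.I * z.re, (z.im : ℂ); -z.im, -(Complex.I * z.re)] :
      Matrix (Fin 2) (Fin 2) ℂ) i j‖ ≤ ‖z‖ := by
    fin_cases i <;> fin_cases j <;>
      simp [Complex.abs_re_le_norm z, Complex.abs_im_le_norm z]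
  rw [contProp, Matrix.smul_apply, smul_eq_mul, norm_mul, norm_inv, Complex.norm_real,
    Complex.normSq_eq_norm_sq, Real.norm_of_nonneg (by positivity)]
  have hp := Real.pi_gt_three
  calc (2 * Real.pi * ‖z‖ ^ 2)⁻¹ * _ ≤ (1 * ‖z‖ ^ 2)⁻¹ * ‖z‖ := by gcongr; linarith
    _ = ‖z‖⁻¹ := by field_simp

lemma norm_contDirac_sub_le (z w : ℂ) (i j : Fin 2) :
    ‖contDirac w i j - contDirac z i j‖ ≤ 19 * ‖z - w‖ := by
  have hp := Real.pi_lt_d2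
  have h0 : ‖(2 * Real.pi * (z.re - w.re) : ℂ)‖ ≤ 19 * ‖z - w‖ := by
    have := Complex.abs_re_le_norm (z - w)
    rw [show (2 * Real.pi * (z.re - w.re) : ℂ) = ((2 * Real.pi * (z - w).re : ℝ) : ℂ) by simp,
      Complex.norm_real, Real.norm_eq_abs, abs_mul, abs_of_pos (by positivity)]
    have := abs_nonneg (z - w).re
    nlinarith [Real.pi_pos]
  have h1 : ‖(2 * Real.pi * (z.im - w.im) : ℂ)‖ ≤ 19 * ‖z - w‖ := by
    have := Complex.abs_im_le_norm (z - w)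
    rw [show (2 * Real.pi * (z.im - w.im) : ℂ) = ((2 * Real.pi * (z - w).im : ℝ) : ℂ) by simp,
      Complex.norm_real, Real.norm_eq_abs, abs_mul, abs_of_pos (by positivity)]
    have := abs_nonneg (z - w).im
    nlinarith [Real.pi_pos]
  have h0' : ‖Complex.I * (2 * Real.pi * (z.re - w.re) : ℂ)‖ ≤ 19 * ‖z - w‖ := by
    rwa [norm_mul, Complex.norm_I, one_mul]
  fin_cases i <;> fin_cases j
  · refine (congrArg norm ?_).trans_le (h0'); simp [contDirac]; ring
  · refine (congrArg norm ?_).trans_le (h1); simp [contDirac]; ring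
  · rw [← norm_neg] at h1; refine (congrArg norm ?_).trans_le (h1); simp [contDirac]; ring
  · rw [← norm_neg] at h0'; refine (congrArg norm ?_).trans_le (h0'); simp [contDirac]; ring

lemma abs_sn_sub_linear_le {t : ℝ} (ht : |t| ≤ 1 / 8) :
    |sn (t : UnitAddCircle) - 2 * Real.pi * t| ≤ 40 * t ^ 2 := by
  have hp := Real.pi_lt_d2
  have hp0 := Real.pi_pos
  have hn : ‖(2 * Real.pi * t * Complex.I : ℂ)‖ = 2 * Real.pi * |t| := by
    simp [abs_of_pos hp0]
  -- The second-order bound for the exponential holds on the unit disc; `|t| ≤ 1/8` keeps `2π|t|`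
  -- below 1.
  have h := Complex.norm_exp_sub_one_sub_id_le (x := 2 * Real.pi * t * Complex.I)
    (by rw [hn]; nlinarith [abs_nonneg t])
  rw [← ch_coe, hn] at h
  have h2 := (Complex.abs_im_le_norm _).trans h
  have e : (ch (t : UnitAddCircle) - 1 - 2 * Real.pi * t * Complex.I).im
      = sn (t : UnitAddCircle) - 2 * Real.pi * t := by
    simp [sn]
  rw [e] at h2
  refine h2.trans ?_
  rw [mul_pow, sq_abs, mul_pow]
  have : Real.pi ^ 2 ≤ 10 := by nlinarith
  nlinarith [sq_nonneg t]

/-- Both the Wilson mass and the deviation of the sine from its linear part are bounded by `40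
‖z‖²`. An error of second order is exactly what two inverse distances turn into a bounded one. -/
lemma norm_contDirac_sub_dirac_le {z : ℂ} (hz : ‖z‖ ≤ 1 / 8) (i j : Fin 2) :
    ‖contDirac z i j - dirac 0 (toTorus z) i j‖ ≤ 80 * ‖z‖ ^ 2 := by
  have hre := Complex.abs_re_le_norm z
  have him := Complex.abs_im_le_norm z
  have s0 := abs_sn_sub_linear_le (hre.trans hz)
  have s1 := abs_sn_sub_linear_le (him.trans hz)
  have hn := norm_toTorus_le z
  have q0 : z.re ^ 2 + z.im ^ 2 = ‖z‖ ^ 2 := by rw [Complex.sq_norm, Complex.normSq_apply]; ring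
  have hm : |mass 0 (toTorus z)| ≤ 40 * ‖z‖ ^ 2 := by
    have key : ∀ t : ℝ, |t| ≤ 1 / 8 → 0 ≤ 1 - cs (t : UnitAddCircle) ∧
        1 - cs (t : UnitAddCircle) ≤ 20 * t ^ 2 := fun t ht => by
      have hp := Real.pi_lt_d2
      have h2 : Real.pi ^ 2 ≤ 10 := by nlinarith [Real.pi_pos]
      have h3 := one_sub_cs_le (t : UnitAddCircle)
      rw [norm_coe_of_abs_le (ht.trans (by norm_num)), sq_abs] at h3
      exact ⟨by linarith [le_one_sub_cs (t : UnitAddCircle), sq_nonneg ‖(t : UnitAddCircle)‖],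
        by nlinarith [sq_nonneg t]⟩
    have k0 := key _ (hre.trans hz)
    have k1 := key _ (him.trans hz)
    have e : mass 0 (toTorus z) = (1 - cs (z.re : UnitAddCircle)) + (1 - cs (z.im : UnitAddCircle)) := by
      simp [mass, toTorus]
    rw [e, abs_of_nonneg (by linarith)]
    nlinarith [k0.2, k1.2, sq_nonneg ‖z‖]
  have d1 : ∀ s : ℂ, ‖s‖ = 1 → ‖((mass 0 (toTorus z) : ℝ) : ℂ)
      + s * ((sn (z.re : UnitAddCircle) - 2 * Real.pi * z.re : ℝ) : ℂ)‖ ≤ 80 * ‖z‖ ^ 2 :=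
    fun s hs1 => by
      refine (norm_add_le _ _).trans ?_
      rw [norm_mul, hs1, Complex.norm_real, Complex.norm_real, Real.norm_eq_abs, Real.norm_eq_abs]
      nlinarith [sq_nonneg z.im]
  have d2 : ‖((sn (z.im : UnitAddCircle) - 2 * Real.pi * z.im : ℝ) : ℂ)‖ ≤ 80 * ‖z‖ ^ 2 := by
    rw [Complex.norm_real, Real.norm_eq_abs]
    nlinarith [sq_nonneg z.re, sq_nonneg ‖z‖]
  rw [← norm_neg]
  fin_cases i <;> fin_cases j
  · refine (congrArg norm ?_).trans_le (d1 (-Complex.I) (by simp))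
    simp [dirac, contDirac, toTorus]; ring
  · rw [← norm_neg] at d2
    refine (congrArg norm ?_).trans_le (d2)
    simp [dirac, contDirac, toTorus]; ring
  · refine (congrArg norm ?_).trans_le (d2)
    simp [dirac, contDirac, toTorus]
  · refine (congrArg norm ?_).trans_le (d1 Complex.I (by simp))
    simp [dirac, contDirac, toTorus]; ring

/-- The entries of the massless lattice propagator are singular functions modelled by those of
the continuum propagator. -/
theorem isSingular_prop (i j : Fin 2) :
    IsSingular (fun x => prop 0 x i j) (fun z => contProp z i j) 640 where
  measurable := measurable_prop 0 i j
  measurable_model := measurable_contProp i j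
  norm_le x hx := (norm_prop_le (by norm_num) hx i j).trans
    (le_mul_of_one_le_left (by positivity) (by norm_num))
  lip x y hx hy := by
    have h := sub_eq_mul_sub_mul (prop_mul_dirac (diracDet_pos (m := 0) (by norm_num) hx).ne')
      (dirac_mul_prop (diracDet_pos (m := 0) (by norm_num) hy).ne')
    have := norm_mul_mul_apply_le (norm_prop_le (m := 0) (by norm_num) hx)
      (fun i j => norm_dirac_sub_le 0 x y i j) (norm_prop_le (m := 0) (by norm_num) hy) i j
    rw [← Matrix.sub_apply, h]
    refine this.trans ?_
    have p : 0 ≤ ‖x - y‖ * (‖x‖⁻¹ * ‖y‖⁻¹) := by positivity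
    linarith
  model_norm_le z hz := (norm_contProp_le hz i j).trans
    (le_mul_of_one_le_left (by positivity) (by norm_num))
  model_lip z w hz hw := by
    have h := sub_eq_mul_sub_mul (contProp_mul_contDirac hz) (contDirac_mul_contProp hw)
    have := norm_mul_mul_apply_le (norm_contProp_le hz)
      (fun i j => norm_contDirac_sub_le z w i j) (norm_contProp_le hw) i j
    rw [← Matrix.sub_apply, h]
    refine this.trans ?_
    have p : 0 ≤ ‖z - w‖ * (‖z‖⁻¹ * ‖w‖⁻¹) := by positivity
    linarith
  close z hz hz8 := by
    have hz' := norm_pos_iff.2 hz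
    have h2 := norm_le_two_mul_norm_toTorus_of_norm_le (hz8.trans (by norm_num))
    have hx' : 0 < ‖toTorus z‖ := by linarith
    have hx := norm_pos_iff.1 hx'
    have h := sub_eq_mul_sub_mul (prop_mul_dirac (diracDet_pos (m := 0) (by norm_num) hx).ne')
      (contDirac_mul_contProp hz)
    have := norm_mul_mul_apply_le (norm_prop_le (m := 0) (by norm_num) hx)
      (fun i j => norm_contDirac_sub_dirac_le hz8 i j) (norm_contProp_le hz) i j
    rw [← Matrix.sub_apply, h]
    refine this.trans ?_
    -- The constant `640 = 4 · 80 · 2` collects the four products of matrix entries, the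
    -- second-order error of the symbol and the ratio of the two norms.
    have e : ‖toTorus z‖⁻¹ * (80 * ‖z‖ ^ 2) * ‖z‖⁻¹ = 80 * (‖z‖ * ‖toTorus z‖⁻¹) := by
      field_simp
    have : ‖z‖ * ‖toTorus z‖⁻¹ ≤ 2 := by
      rw [← div_eq_mul_inv, div_le_iff₀ hx']; exact h2
    rw [e]; linarith

/-- Multiplication by a Lipschitz phase preserves the singular model. -/
lemma IsSingular.mul_phase {f : Torus → ℂ} {α : ℂ → ℂ} {K L : ℝ} (hf : IsSingular f α K)
    {v : Torus → ℂ} (hv : Measurable v) (hv1 : ∀ x, ‖v x‖ ≤ 1)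
    (hvL : ∀ x y, ‖v x - v y‖ ≤ L * ‖x - y‖) (hv0 : v 0 = 1) (hL : 0 ≤ L) :
    IsSingular (fun x => v x * f x) α (K * (1 + L)) where
  measurable := hv.mul hf.measurable
  measurable_model := hf.measurable_model
  norm_le x hx := by
    rw [norm_mul]
    have h1 := hf.norm_le x hx
    have h2 := hf.nonneg
    calc ‖v x‖ * ‖f x‖ ≤ 1 * (K * ‖x‖⁻¹) := by gcongr; exact hv1 x
      _ ≤ K * (1 + L) * ‖x‖⁻¹ := by
        rw [one_mul]; gcongr; exact le_mul_of_one_le_right h2 (by linarith)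
  lip x y hx hy := by
    have e : v x * f x - v y * f y = v x * (f x - f y) + (v x - v y) * f y := by ring
    rw [e]
    refine (norm_add_le _ _).trans ?_
    rw [norm_mul, norm_mul]
    have h1 := hf.lip x y hx hy
    have h2 := hf.norm_le y hy
    have h3 := hf.nonneg
    have h4 : 1 ≤ ‖x‖⁻¹ := (one_le_inv₀ (norm_pos_iff.2 hx)).2
      ((norm_torus_le x).trans (by norm_num))
    calc ‖v x‖ * ‖f x - f y‖ + ‖v x - v y‖ * ‖f y‖
        ≤ 1 * (K * (‖x - y‖ * (‖x‖⁻¹ * ‖y‖⁻¹))) + L * ‖x - y‖ * (K * (‖x‖⁻¹ * ‖y‖⁻¹)) := by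
          gcongr
          · exact hv1 x
          · exact hvL x y
          · exact h2.trans (mul_le_mul_of_nonneg_left
              (le_mul_of_one_le_left (by positivity) h4) h3)
      _ = _ := by ring
  model_norm_le z hz := (hf.model_norm_le z hz).trans (by
    have := hf.nonneg
    gcongr; exact le_mul_of_one_le_right this (by linarith))
  model_lip z w hz hw := (hf.model_lip z w hz hw).trans (by
    have := hf.nonneg
    gcongr; exact le_mul_of_one_le_right this (by linarith))
  close z hz hz8 := by
    have hz' := norm_pos_iff.2 hz
    have h2 := norm_le_two_mul_norm_toTorus_of_norm_le (hz8.trans (by norm_num))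
    have hx' : 0 < ‖toTorus z‖ := by linarith
    have e : v (toTorus z) * f (toTorus z) - α z
        = (v (toTorus z) - v 0) * f (toTorus z) + (f (toTorus z) - α z) := by rw [hv0]; ring
    rw [e]
    refine (norm_add_le _ _).trans ?_
    have h1 := hvL (toTorus z) 0
    rw [sub_zero] at h1
    have h3 := hf.norm_le _ (norm_pos_iff.1 hx')
    have h4 := hf.close z hz hz8
    rw [norm_mul]
    calc _ ≤ L * ‖toTorus z‖ * (K * ‖toTorus z‖⁻¹) + K := by gcongr
      _ = K * (1 + L) := by field_simp; ring

/-! ### The bubble on the torus -/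

/-- The vertex at which the momentum `x` leaves and `x'` enters. -/
def leftVertex (μ : Fin 2) (x x' : Torus) : Matrix (Fin 2) (Fin 2) ℂ :=
  (1 / 2 : ℂ) • (ch (-x μ) • (gamma μ - 1) + ch (x' μ) • (gamma μ + 1))

/-- The vertex at which the momentum `x'` leaves and `x` enters. -/
def rightVertex (ν : Fin 2) (x x' : Torus) : Matrix (Fin 2) (Fin 2) ℂ :=
  (1 / 2 : ℂ) • (ch (-x' ν) • (gamma ν - 1) + ch (x ν) • (gamma ν + 1))

/-- The integrand of the bubble, for a propagator `g` in lattice units. -/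
def bubbleSymbol (g : Torus → Matrix (Fin 2) (Fin 2) ℂ) (μ ν : Fin 2) (x x' : Torus) : ℂ :=
  1 / 4 * (leftVertex μ x x' * g x * rightVertex ν x x' * g x').trace

/-- The massless bubble. -/
def massless (μ ν : Fin 2) (q : Torus) : ℂ := ∫ x, bubbleSymbol (prop 0) μ ν x (x + q)

/-- The matrix of the vertex of orientation `s`. -/
def halfVertex (μ : Fin 2) (s : Bool) : Matrix (Fin 2) (Fin 2) ℂ :=
  (1 / 2 : ℂ) • (gamma μ + if s then (-1 : Matrix (Fin 2) (Fin 2) ℂ) else 1)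

/-- The phase attached to the propagator between two vertices of orientations `s` and `s'`. -/
def phase (μ ν : Fin 2) (s s' : Bool) (x : Torus) : ℂ :=
  (if s then ch (-x μ) else 1) * (if s' then 1 else ch (x ν))

lemma matrix_trace_mul_four (A G B H : Matrix (Fin 2) (Fin 2) ℂ) :
    (A * G * B * H).trace = ∑ i, ∑ j, ∑ k, ∑ l, A i j * B k l * (G j k * H l i) := by
  simp only [Matrix.trace_fin_two, Matrix.mul_apply, Fin.sum_univ_two]
  ring

/-- Expanding each vertex in its two orientations lets every phase be attached to the propagator
with the same argument. Each summand becomes a function of `x` times a function of `x'`, the form to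
which the correlation estimates apply. -/
lemma bubbleSymbol_eq_sum (g : Torus → Matrix (Fin 2) (Fin 2) ℂ) (μ ν : Fin 2) (x x' : Torus) :
    bubbleSymbol g μ ν x x' = ∑ s : Bool, ∑ s' : Bool, ∑ i, ∑ j, ∑ k, ∑ l,
      1 / 4 * (halfVertex μ s i j * halfVertex ν s' k l) *
        ((phase μ ν s s' x * g x j k) * (phase ν μ s' s x' * g x' l i)) := by
  have hL : leftVertex μ x x' = ch (-x μ) • halfVertex μ true + ch (x' μ) • halfVertex μ false := by
    simp only [leftVertex, halfVertex, smul_add, smul_sub]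
    simp only [smul_comm _ (1 / 2 : ℂ)]
    simp [sub_eq_add_neg]
  have hR : rightVertex ν x x'
      = ch (-x' ν) • halfVertex ν true + ch (x ν) • halfVertex ν false := by
    simp only [rightVertex, halfVertex, smul_add, smul_sub]
    simp only [smul_comm _ (1 / 2 : ℂ)]
    simp [sub_eq_add_neg]
  have e : ∀ s s' : Bool, ∑ i, ∑ j, ∑ k, ∑ l, 1 / 4 * (halfVertex μ s i j * halfVertex ν s' k l) *
        ((phase μ ν s s' x * g x j k) * (phase ν μ s' s x' * g x' l i))
      = 1 / 4 * (phase μ ν s s' x * phase ν μ s' s x') *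
        (halfVertex μ s * g x * halfVertex ν s' * g x').trace := fun s s' => by
    rw [matrix_trace_mul_four]
    simp only [Finset.mul_sum]
    refine Finset.sum_congr rfl fun i _ => Finset.sum_congr rfl fun j _ =>
      Finset.sum_congr rfl fun k _ => Finset.sum_congr rfl fun l _ => by ring
  rw [Finset.sum_congr rfl fun s _ => Finset.sum_congr rfl fun s' _ => e s s']
  simp only [Fintype.sum_bool, bubbleSymbol, hL, hR, phase]
  simp only [add_mul, mul_add, Matrix.smul_mul, Matrix.mul_smul, Matrix.trace_add,
    Matrix.trace_smul, smul_eq_mul, if_true, Bool.false_eq_true, if_false]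
  ring

lemma measurable_ch_apply (μ : Fin 2) : Measurable fun x : Torus => ch (x μ) :=
  (continuous_ch_apply μ).measurable

lemma measurable_ch_neg_apply (μ : Fin 2) : Measurable fun x : Torus => ch (-x μ) :=
  (continuous_ch.comp (continuous_apply μ).neg).measurable

lemma continuous_phase (μ ν : Fin 2) (s s' : Bool) : Continuous (phase μ ν s s') := by
  unfold phase
  have h0 := continuous_ch.comp (continuous_apply (A := fun _ : Fin 2 => UnitAddCircle) μ).neg
  have h1 := continuous_ch_apply ν
  simp only [Function.comp_def] at h0
  cases s <;> cases s' <;> simp <;> fun_prop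

lemma norm_phase (μ ν : Fin 2) (s s' : Bool) (x : Torus) : ‖phase μ ν s s' x‖ = 1 := by
  unfold phase
  cases s <;> cases s' <;> simp

lemma norm_phase_sub_le (μ ν : Fin 2) (s s' : Bool) (x y : Torus) :
    ‖phase μ ν s s' x - phase μ ν s s' y‖ ≤ 4 * Real.pi * ‖x - y‖ := by
  set a : UnitAddCircle → ℂ := fun t => if s then ch (-t) else 1
  set b : UnitAddCircle → ℂ := fun t => if s' then 1 else ch t
  have hp := Real.pi_pos
  have ha : ‖a (x μ) - a (y μ)‖ ≤ 2 * Real.pi * ‖x - y‖ := by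
    have g0 : ‖x μ - y μ‖ ≤ ‖x - y‖ := norm_le_pi_norm (x - y) μ
    simp only [a]
    split_ifs
    · refine (norm_ch_sub_le _ _).trans ?_
      rw [neg_sub_neg, norm_sub_rev]
      gcongr
    · simp; positivity
  have hb : ‖b (x ν) - b (y ν)‖ ≤ 2 * Real.pi * ‖x - y‖ := by
    have g0 : ‖x ν - y ν‖ ≤ ‖x - y‖ := norm_le_pi_norm (x - y) ν
    simp only [b]
    split_ifs
    · simp; positivity
    · exact (norm_ch_sub_le _ _).trans (by gcongr)
  have ha1 : ‖a (y μ)‖ = 1 := by simp only [a]; split_ifs <;> simp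
  have hb1 : ‖b (x ν)‖ = 1 := by simp only [b]; split_ifs <;> simp
  have e : phase μ ν s s' x - phase μ ν s s' y
      = (a (x μ) - a (y μ)) * b (x ν) + a (y μ) * (b (x ν) - b (y ν)) := by
    simp only [phase, a, b]; ring
  rw [e]
  refine (norm_add_le _ _).trans ?_
  rw [norm_mul, norm_mul, ha1, hb1]
  linarith

lemma isSingular_phase_prop (μ ν : Fin 2) (s s' : Bool) (i j : Fin 2) :
    IsSingular (fun x => phase μ ν s s' x * prop 0 x i j) (fun z => contProp z i j)
      (640 * (1 + 4 * Real.pi)) :=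
  (isSingular_prop i j).mul_phase (continuous_phase μ ν s s').measurable
    (fun x => (norm_phase μ ν s s' x).le) (norm_phase_sub_le μ ν s s')
    (by cases s <;> cases s' <;> simp [phase]) (by positivity)

lemma HasModel.const_mul {J : Torus → ℂ} {M : ℂ → ℂ} (h : HasModel J M) (a : ℂ) :
    HasModel (fun q => a * J q) (fun w => a * M w) := by
  obtain ⟨c, A, h⟩ := h
  refine ⟨a * c, ‖a‖ * A, fun w hw0 hw => ?_⟩
  rw [← mul_sub, ← mul_sub, norm_mul, mul_assoc]
  exact mul_le_mul_of_nonneg_left (h w hw0 hw) (norm_nonneg a)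

lemma HasModel.sum {ι : Type*} (s : Finset ι) {J : ι → Torus → ℂ} {M : ι → ℂ → ℂ}
    (h : ∀ i ∈ s, HasModel (J i) (M i)) :
    HasModel (fun q => ∑ i ∈ s, J i q) (fun w => ∑ i ∈ s, M i w) := by
  choose! c A h using h
  refine ⟨∑ i ∈ s, c i, ∑ i ∈ s, A i, fun w hw0 hw => ?_⟩
  rw [← Finset.sum_sub_distrib, ← Finset.sum_sub_distrib, Finset.sum_mul]
  exact norm_sum_le_of_le _ fun i hi => h i hi w hw0 hw

/-- The index set of the expansion of the bubble into products of propagator entries. -/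
abbrev BubbleIndex := Bool × Bool × Fin 2 × Fin 2 × Fin 2 × Fin 2

/-- The coefficients of the expansion of the bubble. -/
def bubbleCoeff (μ ν : Fin 2) (p : BubbleIndex) : ℂ :=
  1 / 4 * (halfVertex μ p.1 p.2.2.1 p.2.2.2.1 * halfVertex ν p.2.1 p.2.2.2.2.1 p.2.2.2.2.2)

/-- The first factor in the expansion of the bubble. -/
def bubbleFst (g : Torus → Matrix (Fin 2) (Fin 2) ℂ) (μ ν : Fin 2) (p : BubbleIndex) (x : Torus) :
    ℂ :=
  phase μ ν p.1 p.2.1 x * g x p.2.2.2.1 p.2.2.2.2.1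

/-- The second factor in the expansion of the bubble. -/
def bubbleSnd (g : Torus → Matrix (Fin 2) (Fin 2) ℂ) (μ ν : Fin 2) (p : BubbleIndex) (x : Torus) :
    ℂ :=
  phase ν μ p.2.1 p.1 x * g x p.2.2.2.2.2 p.2.2.1

lemma bubbleSymbol_eq (g : Torus → Matrix (Fin 2) (Fin 2) ℂ) (μ ν : Fin 2) (x x' : Torus) :
    bubbleSymbol g μ ν x x'
      = ∑ p : BubbleIndex, bubbleCoeff μ ν p * (bubbleFst g μ ν p x * bubbleSnd g μ ν p x') := by
  rw [bubbleSymbol_eq_sum]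
  simp only [Fintype.sum_prod_type, bubbleCoeff, bubbleFst, bubbleSnd]

lemma isSingular_bubbleFst (μ ν : Fin 2) (p : BubbleIndex) :
    IsSingular (bubbleFst (prop 0) μ ν p) (fun z => contProp z p.2.2.2.1 p.2.2.2.2.1)
      (640 * (1 + 4 * Real.pi)) := isSingular_phase_prop _ _ _ _ _ _

lemma isSingular_bubbleSnd (μ ν : Fin 2) (p : BubbleIndex) :
    IsSingular (bubbleSnd (prop 0) μ ν p) (fun z => contProp z p.2.2.2.2.2 p.2.2.1)
      (640 * (1 + 4 * Real.pi)) := isSingular_phase_prop _ _ _ _ _ _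

lemma massless_eq_sum (μ ν : Fin 2) {q : Torus} (hq : q ≠ 0) :
    massless μ ν q = ∑ p : BubbleIndex, bubbleCoeff μ ν p *
      ∫ x, bubbleFst (prop 0) μ ν p x * bubbleSnd (prop 0) μ ν p (x + q) := by
  simp only [massless, bubbleSymbol_eq]
  rw [integral_finsetSum]
  · simp only [integral_const_mul]
  · intro p _
    exact ((isSingular_bubbleFst μ ν p).integrable_mul_shift (isSingular_bubbleSnd μ ν p)
      hq).const_mul _

/-- At zero momentum all phases equal one and the Wilson parts `∓1` of the two orientations cancel,
leaving the continuum vertex. -/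
lemma sum_halfVertex (μ : Fin 2) : ∑ s, halfVertex μ s = gamma μ := by
  simp only [Fintype.sum_bool, halfVertex, if_true, Bool.false_eq_true, if_false]
  rw [← smul_add, show gamma μ + -1 + (gamma μ + 1) = (2 : ℂ) • gamma μ by rw [two_smul]; abel,
    smul_smul]
  norm_num

lemma sum_bubbleCoeff_mul (μ ν : Fin 2) (G H : Matrix (Fin 2) (Fin 2) ℂ) :
    ∑ p : BubbleIndex, bubbleCoeff μ ν p * (G p.2.2.2.1 p.2.2.2.2.1 * H p.2.2.2.2.2 p.2.2.1)
      = 1 / 4 * (gamma μ * G * gamma ν * H).trace := by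
  simp only [Fintype.sum_prod_type, bubbleCoeff]
  have e : ∀ s s' : Bool, ∑ i, ∑ j, ∑ k, ∑ l, 1 / 4 * (halfVertex μ s i j * halfVertex ν s' k l) *
        (G j k * H l i) = 1 / 4 * (halfVertex μ s * G * halfVertex ν s' * H).trace :=
      fun s s' => by
    rw [matrix_trace_mul_four]
    simp only [Finset.mul_sum]
    refine Finset.sum_congr rfl fun i _ => Finset.sum_congr rfl fun j _ =>
      Finset.sum_congr rfl fun k _ => Finset.sum_congr rfl fun l _ => by ring
  simp only [e]
  rw [← sum_halfVertex μ, ← sum_halfVertex ν]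
  simp only [Fintype.sum_bool, add_mul, mul_add, Matrix.trace_add]
  ring

/-- The real-linear functional selecting the component `μ, ν` of a traceless symmetric tensor. -/
def tensorPart (μ ν : Fin 2) (ξ : ℂ) : ℝ :=
  if μ = ν then (if μ = 0 then ξ.re else -ξ.re) else -ξ.im

lemma tensorPart_real_mul (μ ν : Fin 2) (r : ℝ) (ξ : ℂ) :
    tensorPart μ ν (r * ξ) = r * tensorPart μ ν ξ := by
  unfold tensorPart
  split_ifs <;> simp

lemma integral_tensorPart (μ ν : Fin 2) {f : ℂ → ℂ} (hf : Integrable f) :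
    ∫ z, tensorPart μ ν (f z) = tensorPart μ ν (∫ z, f z) := by
  have h0 : ∫ z, (f z).re = (∫ z, f z).re := integral_re hf
  have h1 : ∫ z, (f z).im = (∫ z, f z).im := integral_im hf
  unfold tensorPart
  split_ifs <;> simp [integral_neg, h0, h1]

/-- In two dimensions the trace with two vertices couples only equal chiralities: `z⁻¹ w⁻¹` and its
conjugate occur, but no mixed products. The tensor is therefore a real-linear image of a single
complex number. -/
lemma trace_gamma_contProp {z w : ℂ} (hz : z ≠ 0) (hw : w ≠ 0) (μ ν : Fin 2) :
    1 / 4 * (gamma μ * contProp z * gamma ν * contProp w).trace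
      = ((-(1 / (8 * Real.pi ^ 2)) * tensorPart μ ν (z⁻¹ * w⁻¹) : ℝ) : ℂ) := by
  have hz' : (Complex.normSq z : ℂ) ≠ 0 := by exact_mod_cast (Complex.normSq_pos.2 hz).ne'
  have hw' : (Complex.normSq w : ℂ) ≠ 0 := by exact_mod_cast (Complex.normSq_pos.2 hw).ne'
  have hp : (Real.pi : ℂ) ≠ 0 := by exact_mod_cast Real.pi_ne_zero
  fin_cases μ <;> fin_cases ν <;>
    simp [gamma, contProp, Matrix.trace_fin_two, tensorPart,
      Complex.inv_re, Complex.inv_im] <;>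
    field_simp <;> ring_nf <;> simp only [Complex.I_sq, Complex.I_pow_four] <;> ring

/-- The explicit part of the limiting bubble, as a function on the plane. -/
def explicitBubble (μ ν : Fin 2) (w : ℂ) : ℂ :=
  ((1 / (8 * Real.pi) * tensorPart μ ν (starRingEnd ℂ w / w) : ℝ) : ℂ)

/-- The sum is taken before integrating: the summed integrand is a trace, so only the chiral
integral has to be evaluated and no entrywise model integral is. -/
lemma sum_model_eq (μ ν : Fin 2) {w : ℂ} (hw0 : w ≠ 0) (hw : ‖w‖ ≤ 1 / 32) :
    ∑ p : BubbleIndex, bubbleCoeff μ ν p * ∫ z, cutModel (fun z => contProp z p.2.2.2.1 p.2.2.2.2.1) z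
        * contProp (z + w) p.2.2.2.2.2 p.2.2.1 = explicitBubble μ ν w := by
  have hI := integrable_chiral hw0 (hw.trans (by norm_num))
  have e : ∑ p : BubbleIndex, bubbleCoeff μ ν p *
        ∫ z, cutModel (fun z => contProp z p.2.2.2.1 p.2.2.2.2.1) z
          * contProp (z + w) p.2.2.2.2.2 p.2.2.1
      = ∫ z, ((-(1 / (8 * Real.pi ^ 2)) *
          tensorPart μ ν ((cutoff z : ℂ) * (z⁻¹ * (z + w)⁻¹)) : ℝ) : ℂ) := by
    simp only [← integral_const_mul]
    rw [← integral_finsetSum]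
    · refine integral_congr_ae ?_
      filter_upwards [ae_ne_plane 0, ae_ne_plane (-w)] with z h1 h2
      have h3 : z + w ≠ 0 := fun h => h2 (eq_neg_of_add_eq_zero_left h)
      rw [tensorPart_real_mul, mul_left_comm, Complex.ofReal_mul,
        ← trace_gamma_contProp h1 h3, ← sum_bubbleCoeff_mul, Finset.mul_sum]
      refine Finset.sum_congr rfl fun p _ => ?_
      simp only [cutModel]
      ring
    · intro p _
      exact ((isSingular_bubbleFst μ ν p).integrable_cutModel_mul_model
        (isSingular_bubbleSnd μ ν p) hw0 (hw.trans (by norm_num))).const_mul _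
  rw [e, integral_complex_ofReal, integral_const_mul, integral_tensorPart μ ν hI, explicitBubble]
  have h := chiralIntegral_eq hw0 hw
  rw [chiralIntegral] at h
  rw [h, ← Complex.ofReal_neg, tensorPart_real_mul]
  have := Real.pi_ne_zero
  congr 1
  field_simp

/-- Near the origin, the massless bubble is the explicit continuum expression up to a constant and
an error of order `|w| ^ (1/2)`. -/
theorem exists_massless_sub_le (μ ν : Fin 2) : ∃ (c : ℂ) (A : ℝ), ∀ w : ℂ, w ≠ 0 → ‖w‖ ≤ 1 / 32 →
    ‖massless μ ν (toTorus w) - explicitBubble μ ν w - c‖ ≤ A * √‖w‖ := by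
  have hp : ∀ p : BubbleIndex, HasModel
      (fun q => ∫ x, bubbleFst (prop 0) μ ν p x * bubbleSnd (prop 0) μ ν p (x + q))
      (fun w => ∫ z, cutModel (fun z => contProp z p.2.2.2.1 p.2.2.2.2.1) z
        * contProp (z + w) p.2.2.2.2.2 p.2.2.1) := fun p => by
    have h := (isSingular_bubbleFst μ ν p).hasModel (isSingular_bubbleSnd μ ν p)
    exact h
  have h := HasModel.sum (Finset.univ : Finset BubbleIndex) fun p _ =>
    (hp p).const_mul (bubbleCoeff μ ν p)
  obtain ⟨c, A, h⟩ := h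
  refine ⟨c, A, fun w hw0 hw => ?_⟩
  have h1 := h w hw0 (hw.trans (by norm_num))
  have hq : toTorus w ≠ 0 := by
    have := norm_le_two_mul_norm_toTorus_of_norm_le (hw.trans (by norm_num))
    have := norm_pos_iff.2 hw0
    exact norm_pos_iff.1 (by linarith)
  rw [← sum_model_eq μ ν hw0 hw, massless_eq_sum μ ν hq]
  exact h1

/-- A bound on the massless bubble, uniform away from the origin. -/
theorem exists_norm_massless_le (μ ν : Fin 2) : ∃ A : ℝ, ∀ q : Torus, q ≠ 0 →
    ‖massless μ ν q‖ ≤ A * (√‖q‖)⁻¹ := by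
  set K := 640 * (1 + 4 * Real.pi)
  refine ⟨∑ p : BubbleIndex, ‖bubbleCoeff μ ν p‖ *
    (K * K * (2 * ∫ x : Torus, majorant ‖x‖)), fun q hq => ?_⟩
  rw [massless_eq_sum μ ν hq, Finset.sum_mul]
  refine norm_sum_le_of_le _ fun p _ => ?_
  rw [norm_mul, mul_assoc]
  refine mul_le_mul_of_nonneg_left ?_ (norm_nonneg _)
  refine ((isSingular_bubbleFst μ ν p).norm_integral_mul_shift_le (isSingular_bubbleSnd μ ν p)
    hq).trans_eq ?_
  ring

/-! ### The tadpole on the torus and the Ward identity -/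

/-- The integrand of the tadpole of orientation `s`, for a propagator `g` in lattice units. -/
def tadpoleSymbol (g : Torus → Matrix (Fin 2) (Fin 2) ℂ) (μ : Fin 2) (s : Bool) (x : Torus) : ℂ :=
  (if s then -ch (-x μ) else ch (x μ)) * (halfVertex μ s * g x).trace

/-- Exchange of the two coordinates. -/
def swapTorus (x : Torus) : Torus := fun μ => x (Equiv.swap 0 1 μ)

lemma tadpoleSymbol_prop_true (m : ℝ) (μ : Fin 2) (x : Torus) :
    tadpoleSymbol (prop m) μ true x
      = (diracDet m x : ℂ)⁻¹ * (ch (-x μ) * (mass m x - Complex.I * sn (x μ))) := by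
  fin_cases μ <;>
    simp [tadpoleSymbol, halfVertex, gamma, prop, Matrix.trace_fin_two, Matrix.mul_apply,
      Fin.sum_univ_two] <;> ring_nf

lemma tadpoleSymbol_prop_false (m : ℝ) (μ : Fin 2) (x : Torus) :
    tadpoleSymbol (prop m) μ false x
      = (diracDet m x : ℂ)⁻¹ * (ch (x μ) * (mass m x + Complex.I * sn (x μ))) := by
  fin_cases μ <;>
    simp [tadpoleSymbol, halfVertex, gamma, prop, Matrix.trace_fin_two, Matrix.mul_apply,
      Fin.sum_univ_two] <;> ring_nf

lemma mass_neg (m : ℝ) (x : Torus) : mass m (-x) = mass m x := by simp [mass]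

lemma mass_swap (m : ℝ) (x : Torus) : mass m (swapTorus x) = mass m x := by
  simp [mass, swapTorus]; ring

lemma diracDet_neg (m : ℝ) (x : Torus) : diracDet m (-x) = diracDet m x := by
  simp [diracDet, mass_neg]

lemma diracDet_swap (m : ℝ) (x : Torus) : diracDet m (swapTorus x) = diracDet m x := by
  simp [diracDet, mass_swap, swapTorus]; ring

/-- Reflection exchanges the orientations, and the swap of coordinates exchanges the directions.
Both symmetries hold pointwise, so they serve the integral as well as the finite lattice averages.
-/
lemma tadpoleSymbol_neg (m : ℝ) (μ : Fin 2) (x : Torus) :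
    tadpoleSymbol (prop m) μ false x = tadpoleSymbol (prop m) μ true (-x) := by
  rw [tadpoleSymbol_prop_true, tadpoleSymbol_prop_false, mass_neg, diracDet_neg]
  simp

lemma tadpoleSymbol_swap (m : ℝ) (x : Torus) :
    tadpoleSymbol (prop m) 1 true x = tadpoleSymbol (prop m) 0 true (swapTorus x) := by
  rw [tadpoleSymbol_prop_true, tadpoleSymbol_prop_true, mass_swap, diracDet_swap]
  simp [swapTorus]

/-- The massless tadpole. -/
def tadpoleLimit : ℂ := ∫ x, tadpoleSymbol (prop 0) 0 true x

lemma integral_tadpoleSymbol (μ : Fin 2) (s : Bool) :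
    ∫ x, tadpoleSymbol (prop 0) μ s x = tadpoleLimit := by
  have h1 : ∫ x, tadpoleSymbol (prop 0) 1 true x = tadpoleLimit := by
    simp only [tadpoleSymbol_swap]
    exact (volume_measurePreserving_piCongrLeft (fun _ : Fin 2 => UnitAddCircle)
      (Equiv.swap 0 1)).symm.integral_comp'
      (f := (MeasurableEquiv.piCongrLeft (fun _ : Fin 2 => UnitAddCircle) (Equiv.swap 0 1)).symm)
      (tadpoleSymbol (prop 0) 0 true)
  have ht : ∀ μ : Fin 2, ∫ x, tadpoleSymbol (prop 0) μ true x = tadpoleLimit := by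
    intro μ
    fin_cases μ
    · rfl
    · exact h1
  cases s
  · simp only [tadpoleSymbol_neg]
    have : (volume : Measure Torus).IsNegInvariant :=
      Measure.IsAddHaarMeasure.isNegInvariant_of_regular _
    rw [integral_neg_eq_self (tadpoleSymbol (prop 0) μ true), ht]
  · exact ht μ

lemma measurable_tadpoleSymbol (m : ℝ) (μ : Fin 2) (s : Bool) :
    Measurable (tadpoleSymbol (prop m) μ s) := by
  have h0 := measurable_ch_apply μ
  have h1 := measurable_ch_neg_apply μ
  have h := measurable_prop m
  unfold tadpoleSymbol
  simp only [Matrix.trace_fin_two, Matrix.mul_apply, Fin.sum_univ_two]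
  have hp : Measurable fun x : Torus => (halfVertex μ s 0 0 * prop m x 0 0
      + halfVertex μ s 0 1 * prop m x 1 0 + (halfVertex μ s 1 0 * prop m x 0 1
      + halfVertex μ s 1 1 * prop m x 1 1)) := by
    have h00 := h 0 0
    have h01 := h 0 1
    have h10 := h 1 0
    have h11 := h 1 1
    fun_prop
  refine Measurable.mul ?_ hp
  cases s
  · simpa using h0
  · simp only [if_true]; exact h1.neg

lemma norm_tadpoleSymbol_le {m : ℝ} (hm : |m| ≤ 1 / 2) {x : Torus} (hx : x ≠ 0) (μ : Fin 2)
    (s : Bool) : ‖tadpoleSymbol (prop m) μ s x‖ ≤ 2 * ‖x‖⁻¹ := by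
  have key : ∀ t : Torus, t ≠ 0 → ‖tadpoleSymbol (prop m) μ true t‖ ≤ 2 * ‖t‖⁻¹ := by
    intro t ht
    have h0 : (mass m t - Complex.I * sn (t 0) : ℂ) = propNum m t 1 1 := rfl
    have hn : ∀ i j, ‖(diracDet m t : ℂ)⁻¹ * propNum m t i j‖ ≤ ‖t‖⁻¹ := norm_prop_le hm ht
    rw [tadpoleSymbol_prop_true, mul_left_comm, norm_mul, norm_ch, one_mul]
    fin_cases μ
    · exact (hn 1 1).trans (by linarith [inv_nonneg.2 (norm_nonneg t)])
    -- `mass - i sn(t 1)` is not an entry of the numerator, but it is half the trace minus `i` times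
    -- an off-diagonal entry.
    · have e : (diracDet m t : ℂ)⁻¹ * (mass m t - Complex.I * sn (t 1))
          = ((diracDet m t : ℂ)⁻¹ * propNum m t 0 0 + (diracDet m t : ℂ)⁻¹ * propNum m t 1 1) / 2
            - Complex.I * ((diracDet m t : ℂ)⁻¹ * propNum m t 0 1) := by
        simp [propNum]; ring
      have e1 := hn 0 0
      have e2 := hn 1 1
      have e3 := hn 0 1
      simp only [Fin.mk_one]
      rw [e]
      refine (norm_sub_le _ _).trans ?_
      rw [norm_div, norm_mul Complex.I, Complex.norm_I, one_mul]
      have := norm_add_le ((diracDet m t : ℂ)⁻¹ * propNum m t 0 0)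
        ((diracDet m t : ℂ)⁻¹ * propNum m t 1 1)
      norm_num at this ⊢
      norm_num at e1 e2 e3
      linarith
  cases s
  · rw [tadpoleSymbol_neg]
    simpa using key (-x) (neg_ne_zero.2 hx)
  · exact key x hx

lemma integrable_inv_norm : Integrable fun x : Torus => ‖x‖⁻¹ := by
  refine integrable_majorant_torus.mono' measurable_norm.inv.aestronglyMeasurable ?_
  filter_upwards [ae_ne_torus 0] with x hx
  rw [norm_inv, norm_norm]
  exact inv_le_majorant (norm_pos_iff.2 hx) (by linarith [norm_torus_le x])

lemma integrable_tadpoleSymbol (μ : Fin 2) (s : Bool) :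
    Integrable (tadpoleSymbol (prop 0) μ s) := by
  refine (integrable_inv_norm.const_mul 2).mono'
    (measurable_tadpoleSymbol 0 μ s).aestronglyMeasurable ?_
  filter_upwards [ae_ne_torus 0] with x hx
  exact norm_tadpoleSymbol_le (by norm_num) hx μ s

/-- The Ward identity at the vertex: its lattice divergence is a difference of inverse propagators.
For a momentum along the axis `μ`, only the component `μ` enters the divergence. -/
lemma smul_leftVertex_single (m : ℝ) (μ : Fin 2) (t : UnitAddCircle) (x : Torus) :
    (1 - ch (-t)) • leftVertex μ x (x + Pi.single μ t)
      = dirac m x - dirac m (x + Pi.single μ t) := by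
  have e1 : (1 - ch (-t)) * ch (-x μ) = ch (-x μ) - ch (-(x μ + t)) := by
    rw [neg_add, ch_add]; ring
  have e2 : (1 - ch (-t)) * ch (x μ + t) = ch (x μ + t) - ch (x μ) := by
    rw [sub_mul, one_mul, ← ch_add]; congr 2; abel
  rw [leftVertex, smul_comm, smul_add, smul_smul, smul_smul, Pi.add_apply, Pi.single_eq_same, e1,
    e2]
  simp only [ch_neg_eq]
  simp only [ch_eq]
  ext i j
  fin_cases μ <;> fin_cases i <;> fin_cases j <;>
    simp [gamma, dirac, mass] <;> ring_nf <;> simp [Complex.I_sq] <;> ring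

/-- With `D` the Dirac symbol and `g` its inverse, `g(x+q) (D(x) - D(x+q)) g(x) = g(x+q) - g(x)`.
The divergence of the bubble thus has a single propagator in each term, and splitting the remaining
vertex by orientation produces tadpoles. -/
lemma one_sub_ch_mul_bubbleSymbol (μ ν : Fin 2) (t : UnitAddCircle) {x : Torus} (hx : x ≠ 0)
    (hx' : x + Pi.single μ t ≠ 0) :
    (1 - ch (-t)) * bubbleSymbol (prop 0) μ ν x (x + Pi.single μ t)
      = 1 / 4 * (-tadpoleSymbol (prop 0) ν true (x + Pi.single μ t)
        + ch (-(Pi.single μ t : Torus) ν) *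
            tadpoleSymbol (prop 0) ν false (x + Pi.single μ t)
        + ch (-(Pi.single μ t : Torus) ν) * tadpoleSymbol (prop 0) ν true x
        - tadpoleSymbol (prop 0) ν false x) := by
  set q : Torus := Pi.single μ t with hq
  have hd := diracDet_pos (m := 0) (by norm_num) hx
  have hd' := diracDet_pos (m := 0) (by norm_num) hx'
  set V := rightVertex ν x (x + q) with hV
  have h1 : (1 - ch (-t)) * bubbleSymbol (prop 0) μ ν x (x + q)
      = 1 / 4 * ((V * prop 0 (x + q)).trace - (V * prop 0 x).trace) := by
    rw [bubbleSymbol, mul_left_comm]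
    congr 1
    rw [← smul_eq_mul (1 - ch (-t)), ← Matrix.trace_smul, ← Matrix.smul_mul, ← Matrix.smul_mul,
      ← Matrix.smul_mul, hq, smul_leftVertex_single 0, ← hq, ← hV]
    simp only [sub_mul, Matrix.trace_sub]
    rw [dirac_mul_prop hd.ne', one_mul,
      Matrix.trace_mul_comm (dirac 0 (x + q) * prop 0 x * V) (prop 0 (x + q)),
      ← mul_assoc, ← mul_assoc, prop_mul_dirac hd'.ne', one_mul, Matrix.trace_mul_comm (prop 0 x)]
  have hR : V = ch (-(x + q) ν) • halfVertex ν true + ch (x ν) • halfVertex ν false := by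
    simp only [hV, rightVertex, halfVertex, smul_add, smul_sub]
    simp only [smul_comm _ (1 / 2 : ℂ)]
    simp [sub_eq_add_neg]
  rw [h1, hR]
  simp only [add_mul, Matrix.smul_mul, Matrix.trace_add, Matrix.trace_smul, smul_eq_mul,
    tadpoleSymbol, if_true, Bool.false_eq_true, if_false]
  have e1 : ch (-q ν) * ch ((x + q) ν) = ch (x ν) := by
    rw [← ch_add]; congr 1; simp
  have e2 : ch (-(x + q) ν) = ch (-q ν) * ch (-x ν) := by
    rw [← ch_add]; congr 1; simp
  rw [← e1, e2]
  ring

/-- The Ward identity along the coordinate axes. -/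
theorem massless_single (μ ν : Fin 2) {t : UnitAddCircle} (ht : t ≠ 0) :
    massless μ ν (Pi.single μ t) = -(1 / 2) * kron μ ν * tadpoleLimit := by
  set q : Torus := Pi.single μ t with hq
  have hne : 1 - ch (-t) ≠ 0 := by
    intro h
    have h1 := le_norm_ch_sub_one (-t)
    rw [norm_sub_rev, h, norm_zero, norm_neg] at h1
    exact ht (norm_le_zero_iff.1 (by linarith))
  have hT := integrable_tadpoleSymbol ν true
  have hF := integrable_tadpoleSymbol ν false
  have h : (1 - ch (-t)) * massless μ ν q
      = 1 / 4 * (-2 * (1 - ch (-q ν)) * tadpoleLimit) := by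
    rw [massless, ← integral_const_mul]
    have e : ∫ x, (1 - ch (-t)) * bubbleSymbol (prop 0) μ ν x (x + q)
        = ∫ x, 1 / 4 * (-tadpoleSymbol (prop 0) ν true (x + q)
        + ch (-q ν) * tadpoleSymbol (prop 0) ν false (x + q)
        + ch (-q ν) * tadpoleSymbol (prop 0) ν true x
        - tadpoleSymbol (prop 0) ν false x) := by
      refine integral_congr_ae ?_
      filter_upwards [ae_norm_pos q] with x hx
      exact one_sub_ch_mul_bubbleSymbol μ ν t (norm_pos_iff.1 hx.1) (norm_pos_iff.1 hx.2)
    have i1 : Integrable fun x => -tadpoleSymbol (prop 0) ν true (x + q) :=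
      (hT.comp_add_right q).neg
    have i2 : Integrable fun x => ch (-q ν) * tadpoleSymbol (prop 0) ν false (x + q) :=
      (hF.comp_add_right q).const_mul _
    have i3 : Integrable fun x => ch (-q ν) * tadpoleSymbol (prop 0) ν true x := hT.const_mul _
    have i12 : Integrable fun x => -tadpoleSymbol (prop 0) ν true (x + q)
        + ch (-q ν) * tadpoleSymbol (prop 0) ν false (x + q) := i1.add i2
    have i123 : Integrable fun x => -tadpoleSymbol (prop 0) ν true (x + q)
        + ch (-q ν) * tadpoleSymbol (prop 0) ν false (x + q)
        + ch (-q ν) * tadpoleSymbol (prop 0) ν true x := i12.add i3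
    rw [e, integral_const_mul, integral_sub i123 hF, integral_add i12 i3, integral_add i1 i2,
      integral_neg, integral_const_mul, integral_const_mul,
      integral_add_right_eq_self (tadpoleSymbol (prop 0) ν true),
      integral_add_right_eq_self (tadpoleSymbol (prop 0) ν false)]
    simp only [integral_tadpoleSymbol]
    ring
  -- For `ν = μ` the factor `1 - ch (-q ν)` on the right is the divergence factor itself and
  -- cancels; for `ν ≠ μ` it vanishes.
  by_cases hμν : μ = ν
  · subst hμν
    have hqμ : q μ = t := by rw [hq, Pi.single_eq_same]
    rw [hqμ] at h
    refine mul_left_cancel₀ hne (h.trans ?_)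
    simp only [kron, if_true]
    ring
  · have hqν : q ν = 0 := by rw [hq, Pi.single_eq_of_ne (Ne.symm hμν)]
    rw [hqν] at h
    refine mul_left_cancel₀ hne (h.trans ?_)
    simp [kron, hμν]

/-- The value at the origin of the regular part of the bubble. -/
def regularZero (μ ν : Fin 2) : ℂ := -kron μ ν * (tadpoleLimit / 2 + 1 / (8 * Real.pi))

/-- The unit vector in direction `μ`, as a complex number. -/
def axis (μ : Fin 2) : ℂ := if μ = 0 then 1 else Complex.I

lemma norm_axis (μ : Fin 2) : ‖axis μ‖ = 1 := by unfold axis; split_ifs <;> simp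

lemma toTorus_axis (μ : Fin 2) (t : ℝ) : toTorus (t * axis μ) = Pi.single μ (t : UnitAddCircle) := by
  ext i
  fin_cases μ <;> fin_cases i <;> simp [toTorus, axis]

lemma explicitBubble_axis (μ ν : Fin 2) {t : ℝ} (ht : t ≠ 0) :
    explicitBubble μ ν (t * axis μ) = kron μ ν / (8 * Real.pi) := by
  have ht' : (t : ℂ) ≠ 0 := by exact_mod_cast ht
  have e : starRingEnd ℂ (t * axis μ) / (t * axis μ) = if μ = 0 then 1 else -1 := by
    fin_cases μ
    · simp [axis, ht']
    · simp only [axis, Fin.mk_one, one_ne_zero, if_false, map_mul, Complex.conj_ofReal,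
        Complex.conj_I]
      field_simp
  rw [explicitBubble, e]
  fin_cases μ <;> fin_cases ν <;> simp [tensorPart, kron]

/-- The regular part of the massless bubble is Hölder continuous at the origin. -/
theorem exists_massless_sub_explicit_le (μ ν : Fin 2) : ∃ A : ℝ, ∀ w : ℂ, w ≠ 0 → ‖w‖ ≤ 1 / 32 →
    ‖massless μ ν (toTorus w) - explicitBubble μ ν w - regularZero μ ν‖ ≤ A * √‖w‖ := by
  obtain ⟨c, A, h⟩ := exists_massless_sub_le μ ν
  refine ⟨A, fun w hw0 hw => ?_⟩
  -- On the axis `μ` both the massless bubble and its explicit part are constant in `t`. Their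
  -- difference is `regularZero`, whose distance to the unknown constant `c` is at most `A √t` for
  -- all small `t`, hence zero.
  have hb : ∀ t : ℝ, 0 < t → t ≤ 1 / 32 → ‖regularZero μ ν - c‖ ≤ A * √t := by
    intro t ht0 ht
    have hn : ‖(t : ℂ) * axis μ‖ = t := by
      rw [norm_mul, norm_axis, mul_one, Complex.norm_real, Real.norm_of_nonneg ht0.le]
    have h1 := h (t * axis μ) (norm_pos_iff.1 (by rw [hn]; exact ht0)) (by rw [hn]; exact ht)
    have htc : (t : UnitAddCircle) ≠ 0 := by
      have : |t| ≤ 1 / 2 := by rw [abs_of_pos ht0]; linarith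
      rw [← norm_pos_iff, norm_coe_of_abs_le this, abs_of_pos ht0]
      exact ht0
    rw [toTorus_axis, massless_single μ ν htc, explicitBubble_axis μ ν ht0.ne', hn] at h1
    convert h1 using 2
    rw [regularZero]; ring
  have hlim : Tendsto (fun t : ℝ => A * √t) (𝓝[>] 0) (𝓝 0) := by
    have : ContinuousAt (fun t : ℝ => A * √t) 0 := by fun_prop
    simpa [ContinuousAt] using this.tendsto.mono_left nhdsWithin_le_nhds
  have hle : ‖regularZero μ ν - c‖ ≤ 0 := by
    refine ge_of_tendsto hlim ?_
    filter_upwards [Ioc_mem_nhdsGT (show (0 : ℝ) < 1 / 32 by norm_num)] with t ht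
    exact hb t ht.1 ht.2
  rw [sub_eq_zero.1 (norm_le_zero_iff.1 hle)]
  exact h w hw0 hw

/-! ### Averages over the dual lattice -/

instance : IsProbabilityMeasure (volume : Measure UnitAddCircle) := ⟨UnitAddCircle.measure_univ⟩

/-- The point of the torus labelled by an element of the dual lattice. -/
def dualPoint {n : ℕ+} (k : DualSite n) : Torus := fun μ => ZMod.toAddCircle (k μ)

lemma dualPoint_add {n : ℕ+} (k l : DualSite n) : dualPoint (k + l) = dualPoint k + dualPoint l := by
  ext μ; simp [dualPoint]

lemma dualPoint_neg {n : ℕ+} (k : DualSite n) : dualPoint (-k) = -dualPoint k := by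
  ext μ; simp [dualPoint]

/-- The average of a function over the dual lattice. -/
def latticeAvg (n : ℕ+) (f : Torus → ℂ) : ℂ :=
  (((n : ℕ) : ℂ) ^ 2)⁻¹ * ∑ k : DualSite n, f (dualPoint k)

lemma exists_dualPoint_near (n : ℕ+) (x : Torus) :
    ∃ k : DualSite n, ‖x - dualPoint k‖ ≤ 1 / (n : ℕ) := by
  have hn : (0 : ℝ) < (n : ℕ) := by exact_mod_cast n.pos
  have key : ∀ y : UnitAddCircle, ∃ j : ZMod (n : ℕ), ‖y - ZMod.toAddCircle j‖ ≤ 1 / (n : ℕ) := by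
    intro y
    obtain ⟨t, rfl⟩ := QuotientAddGroup.mk_surjective y
    refine ⟨((round ((n : ℕ) * t) : ℤ) : ZMod (n : ℕ)), ?_⟩
    rw [ZMod.toAddCircle_intCast]
    change ‖((t : UnitAddCircle)) - _‖ ≤ _
    rw [← AddCircle.coe_sub, UnitAddCircle.norm_eq]
    refine (round_le (t - (round ((n : ℕ) * t) : ℝ) / (n : ℕ)) 0).trans ?_
    have h := abs_sub_round ((n : ℕ) * t : ℝ)
    rw [Int.cast_zero, sub_zero,
      show t - (round ((n : ℕ) * t) : ℝ) / (n : ℕ)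
        = ((n : ℕ) * t - round ((n : ℕ) * t : ℝ)) / (n : ℕ) by field_simp, abs_div, abs_of_pos hn]
    gcongr
    linarith
  choose j hj using fun μ => key (x μ)
  refine ⟨j, (pi_norm_le_iff_of_nonneg (by positivity)).2 fun μ => ?_⟩
  exact hj μ

lemma card_dualSite (n : ℕ+) : (Fintype.card (DualSite n) : ℂ) = ((n : ℕ) : ℂ) ^ 2 := by
  simp [ZMod.card]

/-- A Riemann sum differs from the integral by at most the oscillation at the lattice scale. -/
lemma norm_integral_sub_latticeAvg_le (n : ℕ+) {f : Torus → ℂ} (hf : Continuous f) {ε : ℝ}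
    (h : ∀ x y, ‖x - y‖ ≤ 1 / (n : ℕ) → ‖f x - f y‖ ≤ ε) :
    ‖(∫ x, f x) - latticeAvg n f‖ ≤ ε := by
  have hn : (((n : ℕ) : ℂ) ^ 2) ≠ 0 := pow_ne_zero _ (by exact_mod_cast n.ne_zero)
  -- Averaging over all translates of the grid does not change the integral, and the average is
  -- invariant under lattice translations. Any point can thus be moved to within `1/n` of the origin
  -- before comparing with the Riemann sum.
  set A : Torus → ℂ := fun x => (((n : ℕ) : ℂ) ^ 2)⁻¹ * ∑ k : DualSite n, f (x + dualPoint k)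
    with hA
  have hint : ∀ q : Torus, Integrable fun x => f (x + q) := fun q =>
    (hf.comp (continuous_add_const q)).integrable_of_hasCompactSupport
      (HasCompactSupport.of_compactSpace _)
  have hAint : ∫ x, A x = ∫ x, f x := by
    simp only [hA]
    rw [integral_const_mul, integral_finsetSum _ fun k _ => hint _]
    simp only [integral_add_right_eq_self]
    rw [Finset.sum_const, Finset.card_univ, nsmul_eq_mul, card_dualSite, inv_mul_cancel_left₀ hn]
  have hAc : Integrable A := (integrable_finsetSum _ fun k _ => hint _).const_mul _
  have hA0 : latticeAvg n f = A 0 := by simp [hA, latticeAvg]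
  have hle : ∀ x, ‖A x - A 0‖ ≤ ε := by
    intro x
    obtain ⟨k₀, hk₀⟩ := exists_dualPoint_near n x
    have e : A x = A (x - dualPoint k₀) := by
      simp only [hA]
      congr 1
      refine Fintype.sum_equiv (Equiv.addRight k₀) _ _ fun k => ?_
      simp only [Equiv.coe_addRight, dualPoint_add]
      congr 1; abel
    rw [e]
    simp only [hA]
    rw [← mul_sub, ← Finset.sum_sub_distrib, norm_mul, norm_inv]
    have hs : ‖∑ k : DualSite n, (f (x - dualPoint k₀ + dualPoint k) - f (0 + dualPoint k))‖
        ≤ ∑ _k : DualSite n, ε := by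
      refine norm_sum_le_of_le _ fun k _ => h _ _ ?_
      simpa using hk₀
    rw [Finset.sum_const, Finset.card_univ, nsmul_eq_mul] at hs
    have hc : ((Fintype.card (DualSite n) : ℕ) : ℝ) = ‖((n : ℕ) : ℂ) ^ 2‖ := by
      rw [← card_dualSite]; simp
    rw [hc] at hs
    rw [inv_mul_le_iff₀ (norm_pos_iff.2 hn)]
    exact hs
  rw [← hAint, hA0]
  have e2 : (∫ x, A x) - A 0 = ∫ x, (A x - A 0) := by
    rw [integral_sub hAc (integrable_const _)]; simp
  rw [e2]
  refine (norm_integral_le_of_norm_le_const (C := ε) (Eventually.of_forall hle)).trans_eq ?_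
  simp

/-- Riemann sums of a jointly continuous function converge uniformly in the parameter. -/
theorem tendstoUniformly_latticeAvg {F : Torus → Torus → ℂ}
    (hF : Continuous fun z : Torus × Torus => F z.1 z.2) :
    TendstoUniformly (fun (n : ℕ+) q => latticeAvg n fun x => F x q) (fun q => ∫ x, F x q)
      atTop := by
  have hu := CompactSpace.uniformContinuous_of_continuous hF
  rw [Metric.uniformContinuous_iff] at hu
  rw [Metric.tendstoUniformly_iff]
  intro ε hε
  obtain ⟨δ, hδ, hu⟩ := hu (ε / 2) (half_pos hε)
  obtain ⟨n₀, hn₀⟩ := exists_nat_gt (1 / δ)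
  filter_upwards [eventually_ge_atTop n₀.toPNat'] with n hn q
  have hn1 : n₀ ≤ (n : ℕ) := by
    rcases Nat.eq_zero_or_pos n₀ with h0 | h0
    · omega
    · have : (n₀.toPNat' : ℕ) ≤ n := hn
      rwa [Nat.toPNat'_coe, if_pos h0] at this
  have hnpos : (0 : ℝ) < (n : ℕ) := by exact_mod_cast n.pos
  have hnδ : 1 / ((n : ℕ) : ℝ) < δ := by
    rw [div_lt_iff₀ hnpos]
    rw [div_lt_iff₀ hδ] at hn₀
    have : (n₀ : ℝ) ≤ (n : ℕ) := by exact_mod_cast hn1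
    nlinarith
  rw [dist_eq_norm]
  refine (norm_integral_sub_latticeAvg_le n (ε := ε / 2) ?_ fun x y hxy => ?_).trans_lt
    (half_lt_self hε)
  · exact hF.comp (Continuous.prodMk_left q)
  · rw [← dist_eq_norm]
    refine (hu (a := (x, q)) (b := (y, q)) ?_).le
    rw [Prod.dist_eq, dist_self, max_eq_left dist_nonneg, dist_eq_norm]
    exact hxy.trans_lt hnδ

/-- The point of the torus with a given momentum. -/
def momTorus (N : ℤ) (k : Mom) : Torus :=
  fun μ => ((spacing N * k μ / (2 * Real.pi) : ℝ) : UnitAddCircle)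

lemma spacing_pos (N : ℤ) : 0 < spacing N := by unfold spacing; positivity

lemma continuous_momTorus (N : ℤ) : Continuous (momTorus N) := by
  refine continuous_pi fun μ => (AddCircle.continuous_mk' 1).comp ?_
  fun_prop

lemma momTorus_momentum (N : ℤ) {n : ℕ+} (k : DualSite n) :
    momTorus N (momentum N k) = dualPoint k := by
  have hn : (((n : ℕ) : ℝ)) ≠ 0 := by exact_mod_cast n.ne_zero
  have ha := (spacing_pos N).ne'
  have hp := Real.pi_ne_zero
  funext μ
  have h := ZMod.toAddCircle_intCast (N := n) (k μ).valMinAbs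
  rw [ZMod.coe_valMinAbs] at h
  rw [dualPoint, h, momTorus, momentum, boxSide]
  congr 1
  simp only
  field_simp

/-- A family of averages of a continuous function over the dual lattice extends continuously to the
Brillouin zone, and converges uniformly to the integral. -/
theorem extendsWithUniformLimit_latticeAvg (N : ℤ) {F : Torus → Torus → ℂ}
    (hF : Continuous fun z : Torus × Torus => F z.1 z.2) :
    ExtendsWithUniformLimit N (fun n p => latticeAvg n fun x => F x (dualPoint p))
      (fun p => ∫ x, F x (momTorus N p)) := by
  refine ⟨fun n p => latticeAvg n fun x => F x (momTorus N p), fun n => ?_, fun n p => ?_, ?_⟩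
  · refine Continuous.continuousOn ?_
    unfold latticeAvg
    refine continuous_const.mul (continuous_finsetSum _ fun k _ => ?_)
    exact hF.comp (continuous_const.prodMk (continuous_momTorus N))
  · simp only [momTorus_momentum]
  · exact ((tendstoUniformly_latticeAvg hF).comp (momTorus N)).tendstoUniformlyOn

lemma ExtendsWithUniformLimit.add {N : ℤ} {F F' : (n : ℕ+) → DualSite n → ℂ} {G G' : Mom → ℂ}
    (h : ExtendsWithUniformLimit N F G) (h' : ExtendsWithUniformLimit N F' G') :
    ExtendsWithUniformLimit N (fun n p => F n p + F' n p) (fun p => G p + G' p) := by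
  obtain ⟨E, h1, h2, h3⟩ := h
  obtain ⟨E', h1', h2', h3'⟩ := h'
  exact ⟨fun n p => E n p + E' n p, fun n => (h1 n).add (h1' n),
    fun n p => by beta_reduce; rw [h2, h2'], h3.add h3'⟩

lemma ExtendsWithUniformLimit.const_mul {N : ℤ} {F : (n : ℕ+) → DualSite n → ℂ} {G : Mom → ℂ}
    (h : ExtendsWithUniformLimit N F G) (c : ℂ) :
    ExtendsWithUniformLimit N (fun n p => c * F n p) (fun p => c * G p) := by
  obtain ⟨E, h1, h2, h3⟩ := h
  exact ⟨fun n p => c * E n p, fun n => (h1 n).const_smul c, fun n p => by beta_reduce; rw [h2],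
    (uniformContinuous_const_smul c).comp_tendstoUniformlyOn h3⟩

lemma FullLimits.linear {N : ℤ} {F F' : (m : ℝ) → (n : ℕ+) → DualSite n → ℂ} {G G' : Mom → ℂ}
    (h : FullLimits N F G) (h' : FullLimits N F' G') (c c' : ℂ) :
    FullLimits N (fun m n p => c * F m n p + c' * F' m n p) (fun p => c * G p + c' * G' p) := by
  obtain ⟨F₁, h1, h2⟩ := h
  obtain ⟨F₁', h1', h2'⟩ := h'
  exact ⟨fun m p => c * F₁ m p + c' * F₁' m p,
    fun m hm0 hm => ((h1 m hm0 hm).const_mul c).add ((h1' m hm0 hm).const_mul c'),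
    fun p hp hp0 => ((h2 p hp hp0).const_mul c).add ((h2' p hp hp0).const_mul c')⟩

lemma UVLimits.linear {N : ℤ} {F F' : (M m : ℝ) → (n : ℕ+) → DualSite n → ℂ} {G G' : Mom → ℂ}
    (h : UVLimits N F G) (h' : UVLimits N F' G') (c c' : ℂ) :
    UVLimits N (fun M m n p => c * F M m n p + c' * F' M m n p)
      (fun p => c * G p + c' * G' p) := by
  obtain ⟨F₁, F₂, h1, h2, h3⟩ := h
  obtain ⟨F₁', F₂', h1', h2', h3'⟩ := h'
  exact ⟨fun M m p => c * F₁ M m p + c' * F₁' M m p, fun M p => c * F₂ M p + c' * F₂' M p,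
    fun M m hM hN hm0 hm =>
      ((h1 M m hM hN hm0 hm).const_mul c).add ((h1' M m hM hN hm0 hm).const_mul c'),
    fun M hM hN p hp hp0 =>
      ((h2 M hM hN p hp hp0).const_mul c).add ((h2' M hM hN p hp hp0).const_mul c'),
    fun p hp hp0 => ((h3 p hp hp0).const_mul c).add ((h3' p hp hp0).const_mul c')⟩

lemma FullLimits.congr_limit {N : ℤ} {F : (m : ℝ) → (n : ℕ+) → DualSite n → ℂ} {G G' : Mom → ℂ}
    (h : FullLimits N F G) (hG : ∀ p ∈ brillouin (spacing N), p ≠ 0 → G p = G' p) :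
    FullLimits N F G' := by
  obtain ⟨F₁, h1, h2⟩ := h
  exact ⟨F₁, h1, fun p hp hp0 => hG p hp hp0 ▸ h2 p hp hp0⟩

lemma UVLimits.congr_limit {N : ℤ} {F : (M m : ℝ) → (n : ℕ+) → DualSite n → ℂ} {G G' : Mom → ℂ}
    (h : UVLimits N F G) (hG : ∀ p ∈ brillouin (spacing N), p ≠ 0 → G p = G' p) :
    UVLimits N F G' := by
  obtain ⟨F₁, F₂, h1, h2, h3⟩ := h
  exact ⟨F₁, F₂, h1, h2, fun p hp hp0 => hG p hp hp0 ▸ h3 p hp hp0⟩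

lemma ExtendsWithUniformLimit.congr {N : ℤ} {F F' : (n : ℕ+) → DualSite n → ℂ} {G : Mom → ℂ}
    (h : ExtendsWithUniformLimit N F G) (hF : ∀ n p, F n p = F' n p) :
    ExtendsWithUniformLimit N F' G := by
  have : F = F' := funext fun n => funext fun p => hF n p
  exact this ▸ h

/-! ### The lattice quantities as averages over the dual lattice -/

/-- The plane wave `exp (-i k · x)`. -/
def planeWave {n : ℕ+} (k : DualSite n) (x : Site n) : ℂ := ∏ μ, ZMod.stdAddChar (-(k μ * x μ))

section PlaneWave

variable {n : ℕ+} (k l : DualSite n) (x y : Site n)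

lemma planeWave_add_right : planeWave k (x + y) = planeWave k x * planeWave k y := by
  simp only [planeWave, ← Finset.prod_mul_distrib, ← AddChar.map_add_eq_mul]
  refine Finset.prod_congr rfl fun μ _ => ?_
  congr 1; simp only [Pi.add_apply]; ring

lemma planeWave_add_left : planeWave (k + l) x = planeWave k x * planeWave l x := by
  simp only [planeWave, ← Finset.prod_mul_distrib, ← AddChar.map_add_eq_mul]
  refine Finset.prod_congr rfl fun μ _ => ?_
  congr 1; simp only [Pi.add_apply]; ring

lemma planeWave_neg_left : planeWave (-k) x = planeWave k (-x) := by
  simp only [planeWave]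
  refine Finset.prod_congr rfl fun μ _ => ?_
  congr 1; simp only [Pi.neg_apply]; ring

@[simp] lemma planeWave_zero_right : planeWave k (0 : Site n) = 1 := by simp [planeWave]

lemma ch_toAddCircle (j : ZMod (n : ℕ)) : ch (ZMod.toAddCircle j) = ZMod.stdAddChar j := rfl

lemma planeWave_step (μ : Fin 2) : planeWave k (latticeStep μ) = ch (-dualPoint k μ) := by
  rw [dualPoint, ← map_neg, ch_toAddCircle, planeWave,
    Finset.prod_eq_single μ (fun ν _ h => by simp [latticeStep, h]) (by simp)]
  simp [latticeStep]

lemma planeWave_neg_step (μ : Fin 2) : planeWave k (-latticeStep μ) = ch (dualPoint k μ) := by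
  rw [← planeWave_neg_left, planeWave_step, dualPoint_neg]; simp

/-- The factors `a` and `2π/L` combine to `2π/n`, so the exponential depends only on residues modulo
`n`: the choice of representatives is immaterial and character identities apply. -/
lemma exp_pairing (N : ℤ) :
    Complex.exp (-Complex.I * (pairing (momentum N k) (position N x) : ℂ)) = planeWave k x := by
  have hn : ((n : ℕ) : ℂ) ≠ 0 := by exact_mod_cast n.ne_zero
  have ha : (spacing N : ℂ) ≠ 0 := by exact_mod_cast (spacing_pos N).ne'
  rw [pairing, planeWave, Complex.ofReal_sum, Finset.mul_sum, Complex.exp_sum]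
  refine Finset.prod_congr rfl fun μ _ => ?_
  have e : -(k μ * x μ) = ((-((k μ).valMinAbs * (x μ).valMinAbs) : ℤ) : ZMod (n : ℕ)) := by
    push_cast
    rfl
  rw [e, ZMod.stdAddChar_coe]
  congr 1
  simp only [momentum, position, boxSide]
  push_cast
  field_simp

lemma exp_pairing_sub (N : ℤ) :
    Complex.exp (-Complex.I * (pairing (momentum N k)
      (fun α => position N x α - position N y α) : ℂ)) = planeWave k (x - y) := by
  have e : -Complex.I * (pairing (momentum N k) (fun α => position N x α - position N y α) : ℂ)
      = -Complex.I * (pairing (momentum N k) (position N x) : ℂ)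
        - -Complex.I * (pairing (momentum N k) (position N y) : ℂ) := by
    simp only [pairing, mul_sub, Finset.sum_sub_distrib]
    push_cast
    ring
  have h : planeWave k x = planeWave k (x - y) * planeWave k y := by
    rw [← planeWave_add_right, sub_add_cancel]
  rw [e, Complex.exp_sub, exp_pairing, exp_pairing, h, mul_div_assoc, div_self, mul_one]
  rw [← exp_pairing k y N]
  exact Complex.exp_ne_zero _

lemma sum_planeWave : ∑ x : Site n, planeWave k x = if k = 0 then ((n : ℕ) : ℂ) ^ 2 else 0 := by
  have h1 : ∑ x : Site n, planeWave k x
      = ∏ μ : Fin 2, ∑ j : ZMod (n : ℕ), (ZMod.stdAddChar (-(k μ * j)) : ℂ) := by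
    rw [Finset.prod_univ_sum, Fintype.piFinset_univ]
    rfl
  have h2 : ∀ μ : Fin 2, ∑ j : ZMod (n : ℕ), (ZMod.stdAddChar (-(k μ * j)) : ℂ)
      = if k μ = 0 then ((n : ℕ) : ℂ) else 0 := by
    intro μ
    have h := AddChar.sum_mulShift (-(k μ)) (ZMod.isPrimitive_stdAddChar (n : ℕ))
    simp only [neg_eq_zero, ZMod.card] at h
    push_cast at h
    rw [← h]
    refine Finset.sum_congr rfl fun j _ => ?_
    congr 1; ring
  rw [h1, Fin.prod_univ_two, h2, h2]
  have : k = 0 ↔ k 0 = 0 ∧ k 1 = 0 := by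
    rw [funext_iff, Fin.forall_fin_two]; rfl
  by_cases ha : k 0 = 0 <;> by_cases hb : k 1 = 0 <;> simp [this, ha, hb, sq]

end PlaneWave

lemma cs_coe (t : ℝ) : cs (t : UnitAddCircle) = Real.cos (2 * Real.pi * t) := by
  rw [cs, ch_coe, show (2 * Real.pi * t * Complex.I : ℂ)
    = ((2 * Real.pi * t : ℝ) : ℂ) * Complex.I by push_cast; ring, Complex.exp_ofReal_mul_I_re]

lemma sn_coe (t : ℝ) : sn (t : UnitAddCircle) = Real.sin (2 * Real.pi * t) := by
  rw [sn, ch_coe, show (2 * Real.pi * t * Complex.I : ℂ)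
    = ((2 * Real.pi * t : ℝ) : ℂ) * Complex.I by push_cast; ring, Complex.exp_ofReal_mul_I_im]

lemma diracSymbol_eq (N : ℤ) (m : ℝ) (k : Mom) :
    diracSymbol N m k = ((2 : ℂ) ^ N) • dirac ((2 : ℝ) ^ (-N) * m) (momTorus N k) := by
  have hp := Real.pi_ne_zero
  have earg : ∀ μ, 2 * Real.pi * (spacing N * k μ / (2 * Real.pi)) = (2 : ℝ) ^ (-N) * k μ :=
    fun μ => by rw [spacing]; field_simp
  have hN : (2 : ℝ) ^ N * (2 : ℝ) ^ (-N) = 1 := by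
    rw [← zpow_add₀ (by norm_num)]; simp
  have hs : ∀ μ, latticeSin N k μ = (2 : ℝ) ^ N * sn (momTorus N k μ) := fun μ => by
    rw [momTorus, sn_coe, earg, latticeSin]
  have hm : m + wilsonMass N k = (2 : ℝ) ^ N * mass ((2 : ℝ) ^ (-N) * m) (momTorus N k) := by
    have key : ∀ μ, 1 - cs (momTorus N k μ)
        = 2 * Real.sin ((2 : ℝ) ^ (-N - 1) * k μ) ^ 2 := fun μ => by
      rw [momTorus, cs_coe, earg, zpow_sub₀ (by norm_num), zpow_one,
        show (2 : ℝ) ^ (-N) * k μ = 2 * ((2 : ℝ) ^ (-N) / 2 * k μ) by ring, Real.cos_two_mul]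
      have := Real.sin_sq_add_cos_sq ((2 : ℝ) ^ (-N) / 2 * k μ)
      linarith
    rw [mass, key, key, wilsonMass, Fin.sum_univ_two]
    linear_combination (-m) * hN
  rw [diracSymbol, hm, Fin.sum_univ_two, hs, hs]
  ext i j
  fin_cases i <;> fin_cases j <;> simp [gamma, dirac] <;> ring_nf <;> simp [Complex.I_sq]

/-- A propagator with weight `W` in lattice units. -/
def weightedProp (W : Torus → ℝ) (m : ℝ) (x : Torus) : Matrix (Fin 2) (Fin 2) ℂ :=
  (W x : ℂ) • prop m x

section Finite

variable {N : ℤ} {n : ℕ+} {m : ℝ} {w : Mom → ℝ} {W : Torus → ℝ}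

lemma inv_diracSymbol (hm0 : m ≠ 0) (hm : |(2 : ℝ) ^ (-N) * m| ≤ 1 / 2) (k : Mom) :
    (diracSymbol N m k)⁻¹ = ((2 : ℂ) ^ (-N)) • prop ((2 : ℝ) ^ (-N) * m) (momTorus N k) := by
  refine Matrix.inv_eq_left_inv ?_
  have hN : (2 : ℂ) ^ (-N) * (2 : ℂ) ^ N = 1 := by
    rw [← zpow_add₀ (by norm_num)]; simp
  have h0 : (2 : ℝ) ^ (-N) * m ≠ 0 := mul_ne_zero (by positivity) hm0
  rw [diracSymbol_eq, Matrix.smul_mul, Matrix.mul_smul, smul_smul, hN, one_smul,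
    prop_mul_dirac (diracDet_pos_of_mass hm h0 _).ne']

lemma propagator_apply (hm0 : m ≠ 0) (hm : |(2 : ℝ) ^ (-N) * m| ≤ 1 / 2)
    (hw : ∀ k : DualSite n, w (momentum N k) = W (dualPoint k)) (x : Site n) (i j : Fin 2) :
    propagator N m w x i j = (2 : ℂ) ^ N * (((n : ℕ) : ℂ) ^ 2)⁻¹ *
      ∑ k : DualSite n, planeWave k x * weightedProp W ((2 : ℝ) ^ (-N) * m) (dualPoint k) i j := by
  have hn : ((n : ℕ) : ℂ) ≠ 0 := by exact_mod_cast n.ne_zero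
  have h2 : (2 : ℂ) ^ N ≠ 0 := zpow_ne_zero _ (by norm_num)
  simp only [propagator, exp_pairing, hw, inv_diracSymbol hm0 hm, momTorus_momentum]
  rw [Matrix.smul_apply, Matrix.sum_apply, smul_eq_mul, Finset.mul_sum, Finset.mul_sum]
  refine Finset.sum_congr rfl fun k _ => ?_
  simp only [Matrix.smul_apply, smul_eq_mul, weightedProp, boxSide, spacing]
  push_cast
  rw [zpow_neg]
  field_simp

/-- The site carrying `ψ⁺` in the bilinear of a bosonic label, relative to its base point. -/
def srcStep (μ : Fin 2) (s : Bool) : Site n := if s then 0 else latticeStep μ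

/-- The site carrying `ψ⁻` in the bilinear of a bosonic label, relative to its base point. -/
def tgtStep (μ : Fin 2) (s : Bool) : Site n := if s then latticeStep μ else 0

/-- The Boolean orientation of a sign. -/
def orient (ε : ℤˣ) : Bool := ε = 1

lemma siteInt_delta (f : Site n → ℂ) (y : Site n) :
    siteInt N (fun x => latticeDelta N (x - y) * f x) = f y := by
  have h : ((2 : ℂ) ^ (-N)) ^ 2 * (2 : ℂ) ^ (2 * N) = 1 := by
    rw [← zpow_natCast, ← zpow_mul, ← zpow_add₀ (by norm_num)]
    simp [mul_comm]
  simp only [siteInt, latticeDelta, sub_eq_zero, ite_mul, zero_mul, Finset.sum_ite_eq',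
    Finset.mem_univ, if_true, spacing]
  push_cast
  rw [← mul_assoc, h, one_mul]

lemma fermionInt_const_mul (c : ℂ) (f : FermionLabel n → ℂ) :
    fermionInt N (fun η => c * f η) = c * fermionInt N f := by
  simp only [fermionInt, siteInt, Finset.mul_sum]
  refine Finset.sum_congr rfl fun s _ => Finset.sum_congr rfl fun x _ => by ring

lemma fermionInt_delta (f : FermionLabel n → ℂ) (y : Site n) :
    fermionInt N (fun η => latticeDelta N (η.1 - y) * f η) = ∑ s, f (y, s) := by
  simp only [fermionInt]
  refine Finset.sum_congr rfl fun s _ => ?_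
  exact siteInt_delta (fun x => f (x, s)) y

lemma bareVertex_eq (y : Site n) (μ : Fin 2) (ε : ℤˣ) (η η' : FermionLabel n) :
    bareVertex N (y, μ, ε) η η' = latticeDelta N (η.1 - (y + srcStep μ (orient ε))) *
      (latticeDelta N (η'.1 - (y + tgtStep μ (orient ε))) *
        (((ε : ℤ) : ℂ) * halfVertex μ (orient ε) η.2 η'.2)) := by
  obtain ⟨x, s⟩ := η
  obtain ⟨x', s'⟩ := η'
  rcases Int.units_eq_one_or ε with rfl | rfl
  · simp [bareVertex, orient, srcStep, tgtStep, halfVertex, sub_eq_add_neg, add_assoc]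
    ring_nf
  · have h : (-1 : ℤˣ) ≠ 1 := by decide
    simp [bareVertex, orient, srcStep, tgtStep, halfVertex, sub_eq_add_neg, add_assoc, h]
    ring_nf

lemma fermionInt_bareVertex (y : Site n) (μ : Fin 2) (ε : ℤˣ)
    (f : FermionLabel n → FermionLabel n → ℂ) :
    fermionInt N (fun η => fermionInt N fun η' => bareVertex N (y, μ, ε) η η' * f η η')
      = ((ε : ℤ) : ℂ) * ∑ i, ∑ j, halfVertex μ (orient ε) i j *
          f (y + srcStep μ (orient ε), i) (y + tgtStep μ (orient ε), j) := by
  simp only [bareVertex_eq, mul_assoc, fermionInt_const_mul]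
  rw [fermionInt_delta]
  simp only [fermionInt_delta, Finset.mul_sum]

lemma bubble_eq (x y : Site n) (μ ν : Fin 2) (ε ε' : ℤˣ) :
    bubble N m w (x, μ, ε) (y, ν, ε') = 1 / 2 * (((ε : ℤ) : ℂ) * ((ε' : ℤ) : ℂ) *
      ∑ i, ∑ j, ∑ k, ∑ l, halfVertex μ (orient ε) i j * halfVertex ν (orient ε') k l *
        (propagator N m w (x - y + (tgtStep μ (orient ε) - srcStep ν (orient ε'))) j k *
          propagator N m w (-(x - y) + (tgtStep ν (orient ε') - srcStep μ (orient ε))) l i)) := by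
  have e : ∀ (η₁ η₁' η₂ η₂' : FermionLabel n),
      bareVertex N (x, μ, ε) η₁ η₁' * bareVertex N (y, ν, ε') η₂ η₂'
        * propagatorEntry N m w η₁' η₂ * propagatorEntry N m w η₂' η₁
      = bareVertex N (x, μ, ε) η₁ η₁' * (bareVertex N (y, ν, ε') η₂ η₂'
        * (propagatorEntry N m w η₁' η₂ * propagatorEntry N m w η₂' η₁)) := fun _ _ _ _ => by ring
  simp only [bubble, e, fermionInt_const_mul, fermionInt_bareVertex]
  simp only [Finset.mul_sum]
  refine Finset.sum_congr rfl fun i _ => Finset.sum_congr rfl fun j _ =>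
    Finset.sum_congr rfl fun k _ => Finset.sum_congr rfl fun l _ => ?_
  simp only [propagatorEntry]
  rw [show x + tgtStep μ (orient ε) - (y + srcStep ν (orient ε'))
      = x - y + (tgtStep μ (orient ε) - srcStep ν (orient ε')) by abel,
    show y + tgtStep ν (orient ε') - (x + srcStep μ (orient ε))
      = -(x - y) + (tgtStep ν (orient ε') - srcStep μ (orient ε)) by abel]
  ring

/-- The finite-volume tadpole is an average over the dual lattice. -/
theorem tadpole_eq_latticeAvg (hm0 : m ≠ 0) (hm : |(2 : ℝ) ^ (-N) * m| ≤ 1 / 2)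
    (hw : ∀ k : DualSite n, w (momentum N k) = W (dualPoint k)) (y : Site n) (μ : Fin 2)
    (ε : ℤˣ) :
    tadpole N m w (y, μ, ε) = latticeAvg n
      (tadpoleSymbol (weightedProp W ((2 : ℝ) ^ (-N) * m)) μ (orient ε)) := by
  have hN : (2 : ℂ) ^ (-N) * (2 : ℂ) ^ N = 1 := by
    rw [← zpow_add₀ (by norm_num)]; simp
  rw [tadpole, fermionInt_bareVertex]
  simp only [propagatorEntry]
  rw [show y + tgtStep μ (orient ε) - (y + srcStep μ (orient ε))
    = tgtStep μ (orient ε) - srcStep μ (orient ε) by abel]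
  simp only [propagator_apply hm0 hm hw, latticeAvg]
  have hph : ∀ k : DualSite n, -((ε : ℤ) : ℂ) *
      planeWave k (tgtStep μ (orient ε) - srcStep μ (orient ε))
      = if orient ε then -ch (-dualPoint k μ) else ch (dualPoint k μ) := by
    intro k
    rcases Int.units_eq_one_or ε with rfl | rfl
    · simp [orient, srcStep, tgtStep, planeWave_step]
    · have h : (-1 : ℤˣ) ≠ 1 := by decide
      simp [orient, srcStep, tgtStep, h, planeWave_neg_step]
  simp only [tadpoleSymbol, ← hph, Matrix.trace_fin_two, Matrix.mul_apply, Fin.sum_univ_two,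
    Finset.mul_sum, ← Finset.sum_add_distrib]
  refine Finset.sum_congr rfl fun k _ => ?_
  linear_combination (-(((ε : ℤ) : ℂ)) * planeWave k (tgtStep μ (orient ε) - srcStep μ (orient ε)) *
    (((n : ℕ) : ℂ) ^ 2)⁻¹ *
    (halfVertex μ (orient ε) 0 0 * weightedProp W ((2 : ℝ) ^ (-N) * m) (dualPoint k) 0 0
    + halfVertex μ (orient ε) 0 1 * weightedProp W ((2 : ℝ) ^ (-N) * m) (dualPoint k) 1 0
    + halfVertex μ (orient ε) 1 0 * weightedProp W ((2 : ℝ) ^ (-N) * m) (dualPoint k) 0 1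
    + halfVertex μ (orient ε) 1 1 * weightedProp W ((2 : ℝ) ^ (-N) * m) (dualPoint k) 1 1)) * hN

/-- Momentum conservation: the summand depends only on `x - y`, so one sum yields a Kronecker delta
times `n²` and the other a further `n²`. -/
lemma sum_sum_planeWave (p k k' : DualSite n) (d d' : Site n) :
    ∑ x : Site n, ∑ y : Site n, planeWave p (x - y) *
      (planeWave k (x - y + d) * planeWave k' (-(x - y) + d'))
      = if k' = k + p then ((n : ℕ) : ℂ) ^ 4 * (planeWave k d * planeWave k' d') else 0 := by
  have e : ∀ x y : Site n, planeWave p (x - y) *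
      (planeWave k (x - y + d) * planeWave k' (-(x - y) + d'))
      = planeWave (k + p - k') (x - y) * (planeWave k d * planeWave k' d') := by
    intro x y
    rw [sub_eq_add_neg (k + p) k']
    simp only [planeWave_add_right, planeWave_add_left, planeWave_neg_left]
    ring
  have e2 : ∀ x : Site n, ∑ y : Site n, planeWave (k + p - k') (x - y)
      = ∑ z : Site n, planeWave (k + p - k') z := fun x =>
    Fintype.sum_equiv (Equiv.subLeft x) _ _ fun y => rfl
  simp only [e, ← Finset.sum_mul, e2, sum_planeWave, Finset.sum_const, Finset.card_univ,
    nsmul_eq_mul, card_dualSite]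
  have : k + p - k' = 0 ↔ k' = k + p := by rw [sub_eq_zero, eq_comm]
  simp only [this]
  split_ifs <;> ring

lemma bubbleSymbol_eq_sum_trace (g : Torus → Matrix (Fin 2) (Fin 2) ℂ) (μ ν : Fin 2)
    (x x' : Torus) :
    bubbleSymbol g μ ν x x' = ∑ s : Bool, ∑ s' : Bool, 1 / 4 *
      (phase μ ν s s' x * phase ν μ s' s x') *
        (halfVertex μ s * g x * halfVertex ν s' * g x').trace := by
  rw [bubbleSymbol_eq_sum]
  refine Finset.sum_congr rfl fun s _ => Finset.sum_congr rfl fun s' _ => ?_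
  rw [matrix_trace_mul_four]
  simp only [Finset.mul_sum]
  refine Finset.sum_congr rfl fun i _ => Finset.sum_congr rfl fun j _ =>
    Finset.sum_congr rfl fun k _ => Finset.sum_congr rfl fun l _ => by ring

lemma planeWave_steps_eq_phase (k : DualSite n) (μ ν : Fin 2) (s s' : Bool) :
    planeWave k (tgtStep μ s - srcStep ν s') = phase μ ν s s' (dualPoint k) := by
  rw [sub_eq_add_neg, planeWave_add_right]
  cases s <;> cases s' <;>
    simp [tgtStep, srcStep, phase, planeWave_step, planeWave_neg_step]

lemma sum_units_eq_sum_bool (f : Bool → ℂ) : ∑ ε : ℤˣ, f (orient ε) = ∑ s : Bool, f s := by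
  have h : (-1 : ℤˣ) ≠ 1 := by decide
  rw [UnitsInt.univ, Finset.sum_pair h.symm]
  simp [orient, h]

lemma units_mul_self_cast (ε : ℤˣ) : ((ε : ℤ) : ℂ) * ((ε : ℤ) : ℂ) = 1 := by
  rcases Int.units_eq_one_or ε with rfl | rfl <;> simp

lemma sum_sum_mul_comm {ι : Type*} [Fintype ι] (a : ι → ι → ℂ)
    (t : Fin 2 → Fin 2 → Fin 2 → Fin 2 → ι → ι → ℂ) :
    ∑ i, ∑ j, ∑ k, ∑ l, ∑ q, ∑ q', a q q' * t i j k l q q'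
      = ∑ q, ∑ q', a q q' * ∑ i, ∑ j, ∑ k, ∑ l, t i j k l q q' := by
  simp only [Fin.sum_univ_two, mul_add, Finset.sum_add_distrib]

/-- After both propagators are expanded in plane waves, the position sums force `k' = k + p`. The
prefactors `L⁻²`, `a⁴`, `(2^N n⁻²)²` and `n⁴` multiply to `n⁻²`, so all powers of the spacing
cancel. -/
lemma sum_bubble_eq (hm0 : m ≠ 0) (hm : |(2 : ℝ) ^ (-N) * m| ≤ 1 / 2)
    (hw : ∀ k : DualSite n, w (momentum N k) = W (dualPoint k)) (p : DualSite n) (μ ν : Fin 2)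
    (ε ε' : ℤˣ) :
    ((ε : ℤ) : ℂ) * ((ε' : ℤ) : ℂ) * (((boxSide N n : ℂ) ^ 2)⁻¹ *
      siteInt N fun x : Site n => siteInt N fun y : Site n => planeWave p (x - y) *
        bubble N m w (x, μ, ε) (y, ν, ε'))
      = (((n : ℕ) : ℂ) ^ 2)⁻¹ * ∑ k : DualSite n, 1 / 2 *
        (phase μ ν (orient ε) (orient ε') (dualPoint k) *
          phase ν μ (orient ε') (orient ε) (dualPoint k + dualPoint p)) *
        (halfVertex μ (orient ε) * weightedProp W ((2 : ℝ) ^ (-N) * m) (dualPoint k) *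
          halfVertex ν (orient ε') *
          weightedProp W ((2 : ℝ) ^ (-N) * m) (dualPoint k + dualPoint p)).trace := by
  set G := fun k : DualSite n => weightedProp W ((2 : ℝ) ^ (-N) * m) (dualPoint k) with hG
  generalize hs : orient ε = s
  generalize hs' : orient ε' = s'
  obtain ⟨d, hd⟩ : ∃ d : Site n, tgtStep μ s - srcStep ν s' = d := ⟨_, rfl⟩
  obtain ⟨d', hd'⟩ : ∃ d' : Site n, tgtStep ν s' - srcStep μ s = d' := ⟨_, rfl⟩
  have hn : ((n : ℕ) : ℂ) ≠ 0 := by exact_mod_cast n.ne_zero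
  have hB : ∀ x y : Site n, planeWave p (x - y) * bubble N m w (x, μ, ε) (y, ν, ε')
      = ((ε : ℤ) : ℂ) * ((ε' : ℤ) : ℂ) * (1 / 2 * ((2 : ℂ) ^ N * (((n : ℕ) : ℂ) ^ 2)⁻¹) ^ 2) *
        ∑ k : DualSite n, ∑ k' : DualSite n, (planeWave p (x - y) *
          (planeWave k (x - y + d) * planeWave k' (-(x - y) + d'))) *
          (halfVertex μ s * G k * halfVertex ν s' * G k').trace := by
    intro x y
    rw [bubble_eq, hs, hs', hd, hd']
    simp only [propagator_apply hm0 hm hw, matrix_trace_mul_four]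
    have e : ∀ i j k l : Fin 2, halfVertex μ s i j * halfVertex ν s' k l *
        ((2 : ℂ) ^ N * (((n : ℕ) : ℂ) ^ 2)⁻¹ * (∑ q : DualSite n, planeWave q (x - y + d) *
            weightedProp W ((2 : ℝ) ^ (-N) * m) (dualPoint q) j k) *
          ((2 : ℂ) ^ N * (((n : ℕ) : ℂ) ^ 2)⁻¹ *
            (∑ q' : DualSite n, planeWave q' (-(x - y) + d') *
            weightedProp W ((2 : ℝ) ^ (-N) * m) (dualPoint q') l i)))
        = ((2 : ℂ) ^ N * (((n : ℕ) : ℂ) ^ 2)⁻¹) ^ 2 * ∑ q : DualSite n, ∑ q' : DualSite n,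
          (planeWave q (x - y + d) * planeWave q' (-(x - y) + d')) *
            (halfVertex μ s i j * halfVertex ν s' k l * (G q j k * G q' l i)) := by
      intro i j k l
      have h := Finset.sum_mul_sum (Finset.univ : Finset (DualSite n)) Finset.univ
        (fun q => planeWave q (x - y + d) *
            weightedProp W ((2 : ℝ) ^ (-N) * m) (dualPoint q) j k)
        (fun q' => planeWave q' (-(x - y) + d') *
            weightedProp W ((2 : ℝ) ^ (-N) * m) (dualPoint q') l i)
      rw [show ∀ a b c e f : ℂ, a * b * (c * e * (c * f)) = c ^ 2 * (a * b * (e * f)) from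
        fun a b c e f => by ring, h, Finset.mul_sum]
      congr 1
      refine Finset.sum_congr rfl fun q _ => ?_
      rw [Finset.mul_sum]
      refine Finset.sum_congr rfl fun q' _ => ?_
      simp only [hG]; ring
    simp only [e, ← Finset.mul_sum]
    have hcomm : ∑ i : Fin 2, ∑ j : Fin 2, ∑ k : Fin 2, ∑ l : Fin 2, ∑ q : DualSite n,
        ∑ q' : DualSite n, (planeWave q (x - y + d) * planeWave q' (-(x - y) + d')) *
            (halfVertex μ s i j * halfVertex ν s' k l * (G q j k * G q' l i))
        = ∑ q : DualSite n, ∑ q' : DualSite n, (planeWave q (x - y + d) *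
          planeWave q' (-(x - y) + d')) * ∑ i : Fin 2, ∑ j : Fin 2, ∑ k : Fin 2, ∑ l : Fin 2,
            (halfVertex μ s i j * halfVertex ν s' k l * (G q j k * G q' l i)) := by
      exact sum_sum_mul_comm _ _
    rw [hcomm]
    simp only [Finset.mul_sum]
    refine Finset.sum_congr rfl fun q _ => Finset.sum_congr rfl fun q' _ =>
      Finset.sum_congr rfl fun i _ => Finset.sum_congr rfl fun j _ =>
      Finset.sum_congr rfl fun k _ => Finset.sum_congr rfl fun l _ => by ring
  simp only [hB, siteInt, ← Finset.mul_sum]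
  have hswap : ∑ x : Site n, ∑ y : Site n, ∑ k : DualSite n, ∑ k' : DualSite n,
      (planeWave p (x - y) * (planeWave k (x - y + d) * planeWave k' (-(x - y) + d'))) *
          (halfVertex μ s * G k * halfVertex ν s' * G k').trace
      = ∑ k : DualSite n, ((n : ℕ) : ℂ) ^ 4 * (planeWave k d * planeWave (k + p) d') *
          (halfVertex μ s * G k * halfVertex ν s' * G (k + p)).trace := by
    have h1 : ∀ x : Site n, ∑ y : Site n, ∑ k : DualSite n, ∑ k' : DualSite n,
      (planeWave p (x - y) * (planeWave k (x - y + d) * planeWave k' (-(x - y) + d'))) *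
          (halfVertex μ s * G k * halfVertex ν s' * G k').trace
        = ∑ k : DualSite n, ∑ k' : DualSite n, ∑ y : Site n,
      (planeWave p (x - y) * (planeWave k (x - y + d) * planeWave k' (-(x - y) + d'))) *
          (halfVertex μ s * G k * halfVertex ν s' * G k').trace := fun x => by
      rw [Finset.sum_comm]
      refine Finset.sum_congr rfl fun k _ => ?_
      rw [Finset.sum_comm]
    simp only [h1]
    rw [Finset.sum_comm]
    refine Finset.sum_congr rfl fun k _ => ?_
    rw [Finset.sum_comm]
    simp only [← Finset.sum_mul, sum_sum_planeWave, ite_mul, zero_mul, Finset.sum_ite_eq',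
      Finset.mem_univ, if_true]
  rw [hswap]
  simp only [← hd, ← hd', planeWave_steps_eq_phase, Finset.mul_sum]
  refine Finset.sum_congr rfl fun k _ => ?_
  simp only [hG, dualPoint_add, boxSide, spacing]
  -- Each sign occurs twice, once in the vertex and once in the definition of the Fourier transform
  -- of the bubble, and its square is one.
  have h1 := units_mul_self_cast ε
  have h2 := units_mul_self_cast ε'
  have hN : (2 : ℂ) ^ N ≠ 0 := zpow_ne_zero _ (by norm_num)
  push_cast
  generalize (halfVertex μ s * weightedProp W ((2 : ℝ) ^ (-N) * m) (dualPoint k) *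
    halfVertex ν s' * weightedProp W ((2 : ℝ) ^ (-N) * m) (dualPoint k + dualPoint p)).trace = t
  rw [zpow_neg]
  field_simp
  linear_combination (((ε' : ℤ) : ℂ) ^ 2 * phase μ ν s s' (dualPoint k) *
    phase ν μ s' s (dualPoint k + dualPoint p) * t) * h1 +
    (phase μ ν s s' (dualPoint k) * phase ν μ s' s (dualPoint k + dualPoint p) * t) * h2

/-- The finite-volume bubble is an average over the dual lattice. -/
theorem bubbleHat_eq_latticeAvg (hm0 : m ≠ 0) (hm : |(2 : ℝ) ^ (-N) * m| ≤ 1 / 2)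
    (hw : ∀ k : DualSite n, w (momentum N k) = W (dualPoint k)) (p : DualSite n) (μ ν : Fin 2) :
    bubbleHat N m w μ ν p = latticeAvg n fun x =>
      bubbleSymbol (weightedProp W ((2 : ℝ) ^ (-N) * m)) μ ν x (x + dualPoint p) := by
  simp only [bubbleHat, exp_pairing_sub, sum_bubble_eq hm0 hm hw, latticeAvg,
    bubbleSymbol_eq_sum_trace]
  set f : Bool → Bool → ℂ := fun s s' => (((n : ℕ) : ℂ) ^ 2)⁻¹ * ∑ k : DualSite n, 1 / 2 *
        (phase μ ν s s' (dualPoint k) * phase ν μ s' s (dualPoint k + dualPoint p)) *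
        (halfVertex μ s * weightedProp W ((2 : ℝ) ^ (-N) * m) (dualPoint k) * halfVertex ν s' *
          weightedProp W ((2 : ℝ) ^ (-N) * m) (dualPoint k + dualPoint p)).trace with hf
  have h : ∑ ε : ℤˣ, ∑ ε' : ℤˣ, f (orient ε) (orient ε') = ∑ s : Bool, ∑ s' : Bool, f s s' := by
    rw [← sum_units_eq_sum_bool fun s => ∑ s' : Bool, f s s']
    exact Finset.sum_congr rfl fun ε _ => sum_units_eq_sum_bool (f (orient ε))
  rw [h]
  simp only [hf, Fintype.sum_bool, Finset.mul_sum, ← Finset.sum_add_distrib]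
  refine Finset.sum_congr rfl fun k _ => by ring

end Finite

/-! ### Momentum weights on the torus -/

/-- Momentum weights with the reflection symmetries of the lattice and values in `[-1, 1]`. -/
structure IsWeight (W : Torus → ℝ) : Prop where
  continuous : Continuous W
  neg : ∀ x, W (-x) = W x
  swap : ∀ x, W (swapTorus x) = W x
  abs_le : ∀ x, |W x| ≤ 1

lemma isWeight_one : IsWeight fun _ => 1 :=
  ⟨continuous_const, fun _ => rfl, fun _ => rfl, fun _ => by simp⟩

lemma weightedProp_one (m : ℝ) : weightedProp (fun _ => 1) m = prop m := by
  funext x; simp [weightedProp]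

/-- The Euclidean distance to the origin of the torus. -/
def torusRadius (x : Torus) : ℝ := √(‖x 0‖ ^ 2 + ‖x 1‖ ^ 2)

lemma torusRadius_pos {x : Torus} (hx : x ≠ 0) : 0 < torusRadius x := by
  refine Real.sqrt_pos.2 ?_
  by_contra! h
  refine hx (funext fun μ => ?_)
  have h0 := sq_nonneg ‖x 0‖
  have h1 := sq_nonneg ‖x 1‖
  fin_cases μ
  · exact norm_eq_zero.1 (pow_eq_zero_iff two_ne_zero |>.1 (by linarith : ‖x 0‖ ^ 2 = 0))
  · exact norm_eq_zero.1 (pow_eq_zero_iff two_ne_zero |>.1 (by linarith : ‖x 1‖ ^ 2 = 0))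

/-- The ultraviolet weight as a function on the torus. -/
def torusWeight (χ : ℝ → ℝ) (h N : ℤ) (x : Torus) : ℝ :=
  1 - χ ((2 : ℝ) ^ (-h) * (2 * Real.pi * (2 : ℝ) ^ N * torusRadius x))

lemma norm_dualPoint {n : ℕ+} (k : DualSite n) (μ : Fin 2) :
    ‖dualPoint k μ‖ = |((k μ).valMinAbs : ℝ)| / (n : ℕ) := by
  have hn : (0 : ℝ) < (n : ℕ) := by exact_mod_cast n.pos
  have h := ZMod.toAddCircle_intCast (N := n) (k μ).valMinAbs
  rw [ZMod.coe_valMinAbs] at h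
  have h2 : (((k μ).valMinAbs.natAbs : ℕ) : ℝ) ≤ (n : ℕ) / 2 := by
    have h3 := ZMod.natAbs_valMinAbs_le (k μ)
    rw [le_div_iff₀ (by norm_num)]
    exact_mod_cast (Nat.le_div_iff_mul_le (by norm_num)).1 h3
  rw [Nat.cast_natAbs, Int.cast_abs] at h2
  have h4 : |((k μ).valMinAbs : ℝ) / (n : ℕ)| = |((k μ).valMinAbs : ℝ)| / (n : ℕ) := by
    rw [abs_div, abs_of_pos hn]
  rw [dualPoint, h, norm_coe_of_abs_le, h4]
  rw [h4, div_le_iff₀ hn]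
  linarith

/-- Each component is represented by the residue closest to zero, so the length of a momentum is
determined by its point on the torus. This makes the ultraviolet weight a continuous function there.
-/
lemma norm_momentum (N : ℤ) {n : ℕ+} (k : DualSite n) :
    ‖momentum N k‖ = 2 * Real.pi * (2 : ℝ) ^ N * torusRadius (dualPoint k) := by
  have hc : (0 : ℝ) ≤ 2 * Real.pi * (2 : ℝ) ^ N := by positivity
  have e : ∀ μ, ‖momentum N k μ‖ ^ 2 = (2 * Real.pi * (2 : ℝ) ^ N) ^ 2 * ‖dualPoint k μ‖ ^ 2 := by
    intro μ
    rw [norm_dualPoint, Real.norm_eq_abs, sq_abs, div_pow, sq_abs]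
    simp only [momentum, boxSide, spacing, zpow_neg]
    field_simp
  rw [EuclideanSpace.norm_eq, Fin.sum_univ_two, e, e, ← mul_add, Real.sqrt_mul (sq_nonneg _),
    Real.sqrt_sq hc, torusRadius]

lemma uvWeight_momentum (χ : ℝ → ℝ) (h N : ℤ) {n : ℕ+} (k : DualSite n) :
    uvWeight χ h (momentum N k) = torusWeight χ h N (dualPoint k) := by
  rw [uvWeight, torusWeight, norm_momentum]

lemma isWeight_torusWeight {χ : ℝ → ℝ} (hχ : IsCutoff χ) (h N : ℤ) :
    IsWeight (torusWeight χ h N) := by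
  refine ⟨?_, fun x => ?_, fun x => ?_, fun x => ?_⟩
  · have h0 := continuous_norm.comp (continuous_apply (A := fun _ : Fin 2 => UnitAddCircle) 0)
    have h1 := continuous_norm.comp (continuous_apply (A := fun _ : Fin 2 => UnitAddCircle) 1)
    simp only [Function.comp_def] at h0 h1
    have hc := hχ.smooth.continuous
    unfold torusWeight torusRadius
    fun_prop
  · simp [torusWeight, torusRadius]
  · simp [torusWeight, torusRadius, swapTorus, add_comm]
  · have hr : 0 ≤ (2 : ℝ) ^ (-h) * (2 * Real.pi * (2 : ℝ) ^ N * torusRadius x) := by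
      have : 0 ≤ torusRadius x := Real.sqrt_nonneg _
      positivity
    have h0 := hχ.nonneg _ hr
    have h1 := hχ.anti (Set.mem_Ici.2 le_rfl) (Set.mem_Ici.2 hr) hr
    rw [hχ.one_of_le 0 ⟨le_rfl, by norm_num⟩] at h1
    rw [torusWeight, abs_le]
    constructor <;> linarith

lemma zpow_massScale_le {M : ℝ} (hM : 0 < M) : (2 : ℝ) ^ massScale M ≤ M := by
  rw [← Real.rpow_intCast, ← Real.le_logb_iff_rpow_le one_lt_two hM]
  exact Int.floor_le _

/-- Since `2^(massScale M) ≤ M`, the argument of `χ` at a fixed nonzero momentum is at least 1 once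
`M` is below the length of that momentum. -/
lemma eventually_torusWeight_eq_one {χ : ℝ → ℝ} (hχ : IsCutoff χ) (N : ℤ) {x : Torus}
    (hx : x ≠ 0) : ∀ᶠ M in 𝓝[>] (0 : ℝ), torusWeight χ (massScale M) N x = 1 := by
  have hr : 0 < 2 * Real.pi * (2 : ℝ) ^ N * torusRadius x := by
    have := torusRadius_pos hx
    positivity
  filter_upwards [Ioc_mem_nhdsGT hr] with M hM
  rw [torusWeight, hχ.zero_of_ge _ _, sub_zero]
  rw [zpow_neg, ← div_eq_inv_mul, le_div_iff₀ (by positivity), one_mul]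
  exact (zpow_massScale_le hM.1).trans hM.2

/-! ### Dominated families of propagators -/

/-- Measurable propagators bounded by the inverse distance to the origin. -/
structure IsDominated (g : Torus → Matrix (Fin 2) (Fin 2) ℂ) : Prop where
  measurable : ∀ i j, Measurable fun x => g x i j
  norm_le : ∀ x, x ≠ 0 → ∀ i j, ‖g x i j‖ ≤ ‖x‖⁻¹

lemma IsWeight.isDominated {W : Torus → ℝ} (hW : IsWeight W) {m : ℝ} (hm : |m| ≤ 1 / 2) :
    IsDominated (weightedProp W m) := by
  refine ⟨fun i j => ?_, fun x hx i j => ?_⟩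
  · exact (Complex.measurable_ofReal.comp hW.continuous.measurable).mul (measurable_prop m i j)
  · rw [weightedProp, Matrix.smul_apply, smul_eq_mul, norm_mul, Complex.norm_real,
      Real.norm_eq_abs]
    exact (mul_le_of_le_one_left (norm_nonneg _) (hW.abs_le x)).trans (norm_prop_le hm hx i j)

namespace IsDominated

variable {g : Torus → Matrix (Fin 2) (Fin 2) ℂ}

lemma measurable_bubbleSymbol (hg : IsDominated g) (μ ν : Fin 2) (q : Torus) :
    Measurable fun x => bubbleSymbol g μ ν x (x + q) := by
  simp only [bubbleSymbol_eq]
  refine Finset.measurable_fun_sum _ fun p _ => measurable_const.mul (Measurable.mul ?_ ?_)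
  · exact (continuous_phase _ _ _ _).measurable.mul (hg.measurable _ _)
  · exact ((continuous_phase _ _ _ _).measurable.mul (hg.measurable _ _)).comp
      (measurable_add_const q)

lemma norm_bubbleSymbol_le (hg : IsDominated g) (μ ν : Fin 2) {x q : Torus} (hq : q ≠ 0)
    (hx : 0 < ‖x‖) (hxq : 0 < ‖x + q‖) :
    ‖bubbleSymbol g μ ν x (x + q)‖ ≤ (∑ p : BubbleIndex, ‖bubbleCoeff μ ν p‖) *
      ((√‖q‖)⁻¹ * (majorant ‖x‖ + majorant ‖x + q‖)) := by
  rw [bubbleSymbol_eq, Finset.sum_mul]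
  refine norm_sum_le_of_le _ fun p _ => ?_
  rw [norm_mul, bubbleFst, bubbleSnd, norm_mul, norm_mul, norm_mul, norm_phase, norm_phase, one_mul,
    one_mul]
  refine mul_le_mul_of_nonneg_left ?_ (norm_nonneg _)
  refine le_trans ?_ (inv_mul_inv_le_majorant' hx hxq (norm_le_add_norm x q) (norm_pos_iff.2 hq))
  exact mul_le_mul (hg.norm_le _ (norm_pos_iff.1 hx) _ _) (hg.norm_le _ (norm_pos_iff.1 hxq) _ _)
    (norm_nonneg _) (by positivity)

lemma measurable_tadpoleSymbol (hg : IsDominated g) (μ : Fin 2) (s : Bool) :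
    Measurable (tadpoleSymbol g μ s) := by
  unfold tadpoleSymbol
  simp only [Matrix.trace, Matrix.diag_apply, Matrix.mul_apply]
  refine Measurable.mul ?_ (Finset.measurable_fun_sum _ fun i _ =>
    Finset.measurable_fun_sum _ fun j _ => measurable_const.mul (hg.measurable _ _))
  cases s
  · simpa using measurable_ch_apply μ
  · simp only [if_true]
    exact (measurable_ch_neg_apply μ).neg

lemma norm_tadpoleSymbol_le (hg : IsDominated g) (μ : Fin 2) (s : Bool) {x : Torus} (hx : x ≠ 0) :
    ‖tadpoleSymbol g μ s x‖ ≤ (∑ i, ∑ j, ‖halfVertex μ s i j‖) * ‖x‖⁻¹ := by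
  have h1 : ‖(if s then -ch (-x μ) else ch (x μ))‖ = 1 := by split_ifs <;> simp
  rw [tadpoleSymbol, norm_mul, h1, one_mul]
  simp only [Matrix.trace, Matrix.diag_apply, Matrix.mul_apply, Finset.sum_mul]
  refine norm_sum_le_of_le _ fun i _ => norm_sum_le_of_le _ fun j _ => ?_
  rw [norm_mul]
  exact mul_le_mul_of_nonneg_left (hg.norm_le _ hx _ _) (norm_nonneg _)

end IsDominated

section Limits

variable {ι : Type*} {l : Filter ι} [l.IsCountablyGenerated]
  {G : ι → Torus → Matrix (Fin 2) (Fin 2) ℂ} {g : Torus → Matrix (Fin 2) (Fin 2) ℂ}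

/-- Dominated convergence with one majorant for all dominated propagators, integrable because `q ≠
0` separates the poles. It is applied both to `m → 0` at fixed weight and to `M → 0` at zero mass.
-/
theorem tendsto_integral_bubbleSymbol (hG : ∀ᶠ t in l, IsDominated (G t))
    (hlim : ∀ x, x ≠ 0 → ∀ i j, Tendsto (fun t => G t x i j) l (𝓝 (g x i j))) (μ ν : Fin 2)
    {q : Torus} (hq : q ≠ 0) :
    Tendsto (fun t => ∫ x, bubbleSymbol (G t) μ ν x (x + q)) l
      (𝓝 (∫ x, bubbleSymbol g μ ν x (x + q))) := by
  refine tendsto_integral_filter_of_dominated_convergence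
    (fun x => (∑ p : BubbleIndex, ‖bubbleCoeff μ ν p‖) *
      ((√‖q‖)⁻¹ * (majorant ‖x‖ + majorant ‖x + q‖))) ?_ ?_ ?_ ?_
  · filter_upwards [hG] with t ht
    exact (ht.measurable_bubbleSymbol μ ν q).aestronglyMeasurable
  · filter_upwards [hG] with t ht
    filter_upwards [ae_norm_pos q] with x hx
    exact ht.norm_bubbleSymbol_le μ ν hq hx.1 hx.2
  · exact ((integrable_majorant_add q).const_mul _).const_mul _
  · filter_upwards [ae_norm_pos q] with x hx
    simp only [bubbleSymbol_eq]
    refine tendsto_finsetSum _ fun p _ => Tendsto.const_mul _ (Tendsto.mul ?_ ?_)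
    · exact (hlim x (norm_pos_iff.1 hx.1) _ _).const_mul _
    · exact (hlim _ (norm_pos_iff.1 hx.2) _ _).const_mul _

theorem tendsto_integral_tadpoleSymbol (hG : ∀ᶠ t in l, IsDominated (G t))
    (hlim : ∀ x, x ≠ 0 → ∀ i j, Tendsto (fun t => G t x i j) l (𝓝 (g x i j))) (μ : Fin 2)
    (s : Bool) :
    Tendsto (fun t => ∫ x, tadpoleSymbol (G t) μ s x) l (𝓝 (∫ x, tadpoleSymbol g μ s x)) := by
  refine tendsto_integral_filter_of_dominated_convergence
    (fun x => (∑ i, ∑ j, ‖halfVertex μ s i j‖) * ‖x‖⁻¹) ?_ ?_ ?_ ?_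
  · filter_upwards [hG] with t ht
    exact (ht.measurable_tadpoleSymbol μ s).aestronglyMeasurable
  · filter_upwards [hG] with t ht
    filter_upwards [ae_ne_torus 0] with x hx
    exact ht.norm_tadpoleSymbol_le μ s hx
  · exact integrable_inv_norm.const_mul _
  · filter_upwards [ae_ne_torus 0] with x hx
    simp only [tadpoleSymbol, Matrix.trace, Matrix.diag_apply, Matrix.mul_apply]
    exact Tendsto.const_mul _ (tendsto_finsetSum _ fun i _ => tendsto_finsetSum _ fun j _ =>
      (hlim x hx _ _).const_mul _)

end Limits

lemma eventually_abs_mul_le (s : ℝ) : ∀ᶠ m in 𝓝[≠] (0 : ℝ), |s * m| ≤ 1 / 2 := by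
  have : ContinuousAt (fun m : ℝ => |s * m|) 0 := by fun_prop
  have h := this.tendsto.mono_left (nhdsWithin_le_nhds (s := {0}ᶜ))
  simp only [mul_zero, abs_zero] at h
  filter_upwards [h.eventually (gt_mem_nhds (show (0 : ℝ) < 1 / 2 by norm_num))] with m hm
  exact hm.le

namespace IsWeight

variable {W : Torus → ℝ}

lemma tendsto_weightedProp (W : Torus → ℝ) (s : ℝ) {x : Torus} (hx : x ≠ 0) (i j : Fin 2) :
    Tendsto (fun m => weightedProp W (s * m) x i j) (𝓝[≠] 0) (𝓝 (weightedProp W 0 x i j)) :=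
  ((tendsto_prop hx i j s).const_mul (W x : ℂ)).mono_left nhdsWithin_le_nhds

lemma eventually_isDominated (hW : IsWeight W) (s : ℝ) :
    ∀ᶠ m in 𝓝[≠] (0 : ℝ), IsDominated (weightedProp W (s * m)) := by
  filter_upwards [eventually_abs_mul_le s] with m hm
  exact hW.isDominated hm

lemma tendsto_bubble (hW : IsWeight W) (s : ℝ) (μ ν : Fin 2) {q : Torus} (hq : q ≠ 0) :
    Tendsto (fun m => ∫ x, bubbleSymbol (weightedProp W (s * m)) μ ν x (x + q)) (𝓝[≠] 0)
      (𝓝 (∫ x, bubbleSymbol (weightedProp W 0) μ ν x (x + q))) :=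
  tendsto_integral_bubbleSymbol (hW.eventually_isDominated s)
    (fun _ hx i j => tendsto_weightedProp W s hx i j) μ ν hq

lemma tendsto_tadpole (hW : IsWeight W) (s : ℝ) (μ : Fin 2) (t : Bool) :
    Tendsto (fun m => ∫ x, tadpoleSymbol (weightedProp W (s * m)) μ t x) (𝓝[≠] 0)
      (𝓝 (∫ x, tadpoleSymbol (weightedProp W 0) μ t x)) :=
  tendsto_integral_tadpoleSymbol (hW.eventually_isDominated s)
    (fun _ hx i j => tendsto_weightedProp W s hx i j) μ t

lemma continuous_weightedProp (hW : IsWeight W) {m : ℝ} (h0 : m ≠ 0) (hm : |m| ≤ 1 / 2)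
    (i j : Fin 2) : Continuous fun x => weightedProp W m x i j :=
  (Complex.continuous_ofReal.comp hW.continuous).mul (continuous_prop hm h0 i j)

variable {N : ℤ} {m : ℝ} {w : Mom → ℝ}

lemma extends_bubbleHat (hW : IsWeight W) (hm0 : m ≠ 0) (hm : |(2 : ℝ) ^ (-N) * m| ≤ 1 / 2)
    (hw : ∀ (n : ℕ+) (k : DualSite n), w (momentum N k) = W (dualPoint k)) (μ ν : Fin 2) :
    ExtendsWithUniformLimit N (fun _ => bubbleHat N m w μ ν) fun p =>
      ∫ x, bubbleSymbol (weightedProp W ((2 : ℝ) ^ (-N) * m)) μ ν x (x + momTorus N p) := by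
  have h0 : (2 : ℝ) ^ (-N) * m ≠ 0 := mul_ne_zero (by positivity) hm0
  refine (extendsWithUniformLimit_latticeAvg N
    (F := fun x q => bubbleSymbol (weightedProp W ((2 : ℝ) ^ (-N) * m)) μ ν x (x + q)) ?_).congr
    fun n p => (bubbleHat_eq_latticeAvg hm0 hm (hw n) p μ ν).symm
  simp only [bubbleSymbol_eq, bubbleFst, bubbleSnd]
  refine continuous_finsetSum _ fun p _ => continuous_const.mul (Continuous.mul ?_ ?_)
  · exact ((continuous_phase _ _ _ _).mul (hW.continuous_weightedProp h0 hm _ _)).comp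
      continuous_fst
  · exact ((continuous_phase _ _ _ _).mul (hW.continuous_weightedProp h0 hm _ _)).comp
      (continuous_fst.add continuous_snd)

lemma extends_tadpole (hW : IsWeight W) (hm0 : m ≠ 0) (hm : |(2 : ℝ) ^ (-N) * m| ≤ 1 / 2)
    (hw : ∀ (n : ℕ+) (k : DualSite n), w (momentum N k) = W (dualPoint k)) :
    ExtendsWithUniformLimit N (fun n _ => tadpole N m w ((0, 0, 1) : BosonLabel n)) fun _ =>
      ∫ x, tadpoleSymbol (weightedProp W ((2 : ℝ) ^ (-N) * m)) 0 true x := by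
  have h0 : (2 : ℝ) ^ (-N) * m ≠ 0 := mul_ne_zero (by positivity) hm0
  refine (extendsWithUniformLimit_latticeAvg N
    (F := fun x _ => tadpoleSymbol (weightedProp W ((2 : ℝ) ^ (-N) * m)) 0 true x) ?_).congr
    fun n p => (tadpole_eq_latticeAvg hm0 hm (hw n) 0 0 1).symm
  have hc : Continuous (tadpoleSymbol (weightedProp W ((2 : ℝ) ^ (-N) * m)) 0 true) := by
    unfold tadpoleSymbol
    simp only [Matrix.trace, Matrix.diag_apply, Matrix.mul_apply, if_true]
    have h1 : Continuous fun x : Torus => ch (-x 0) := continuous_ch.comp (continuous_apply 0).neg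
    refine h1.neg.mul ?_
    exact continuous_finsetSum _ fun i _ => continuous_finsetSum _ fun j _ =>
      continuous_const.mul (hW.continuous_weightedProp h0 hm _ _)
  exact hc.comp continuous_fst

/-- The finite-volume tadpole does not depend on its label. -/
lemma tadpole_eq (hW : IsWeight W) (hm0 : m ≠ 0) (hm : |(2 : ℝ) ^ (-N) * m| ≤ 1 / 2)
    {n : ℕ+} (hw : ∀ k : DualSite n, w (momentum N k) = W (dualPoint k)) (b b' : BosonLabel n) :
    tadpole N m w b = tadpole N m w b' := by
  set M := (2 : ℝ) ^ (-N) * m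
  have hs : ∀ (μ : Fin 2) (s : Bool) (x : Torus),
      tadpoleSymbol (weightedProp W M) μ s x = W x * tadpoleSymbol (prop M) μ s x := by
    intro μ s x
    rw [tadpoleSymbol, tadpoleSymbol, weightedProp, Matrix.mul_smul, Matrix.trace_smul,
      smul_eq_mul, mul_left_comm]
  have hneg : ∀ μ, latticeAvg n (tadpoleSymbol (weightedProp W M) μ false)
      = latticeAvg n (tadpoleSymbol (weightedProp W M) μ true) := fun μ => by
    rw [latticeAvg, latticeAvg]
    congr 1
    refine Fintype.sum_equiv (Equiv.neg _) _ _ fun k => ?_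
    rw [Equiv.neg_apply, dualPoint_neg, hs, hs, hW.neg, tadpoleSymbol_neg]
  have hswap : latticeAvg n (tadpoleSymbol (weightedProp W M) 1 true)
      = latticeAvg n (tadpoleSymbol (weightedProp W M) 0 true) := by
    rw [latticeAvg, latticeAvg]
    congr 1
    refine Fintype.sum_equiv ((Equiv.swap (0 : Fin 2) 1).arrowCongr (Equiv.refl _)) _ _
      fun k => ?_
    have e : dualPoint ((Equiv.swap (0 : Fin 2) 1).arrowCongr (Equiv.refl (ZMod (n : ℕ))) k)
        = swapTorus (dualPoint k) := by
      funext μ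
      fin_cases μ <;> simp [dualPoint, swapTorus, Equiv.arrowCongr]
    rw [e, hs, hs, hW.swap, tadpoleSymbol_swap]
  have hall : ∀ b : BosonLabel n, tadpole N m w b
      = latticeAvg n (tadpoleSymbol (weightedProp W M) 0 true) := by
    rintro ⟨y, μ, ε⟩
    rw [tadpole_eq_latticeAvg hm0 hm hw]
    have h1 : ∀ μ : Fin 2, latticeAvg n (tadpoleSymbol (weightedProp W M) μ true)
        = latticeAvg n (tadpoleSymbol (weightedProp W M) 0 true) := by
      intro μ
      fin_cases μ
      · rfl
      · exact hswap
    cases orient ε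
    · rw [hneg, h1]
    · exact h1 μ
  rw [hall b, hall b']

end IsWeight

/-! ### The regular part of the bubble -/

/-- The complex coordinate `q / 2π` of a momentum. -/
def planePoint (q : Mom) : ℂ := ⟨q 0 / (2 * Real.pi), q 1 / (2 * Real.pi)⟩

lemma momTorus_eq (N : ℤ) (p : Mom) : momTorus N p = toTorus (planePoint (spacing N • p)) := by
  funext μ
  fin_cases μ <;> simp [momTorus, toTorus, planePoint]

lemma norm_planePoint (q : Mom) : ‖planePoint q‖ = ‖q‖ / (2 * Real.pi) := by
  have hp := Real.pi_pos
  rw [EuclideanSpace.norm_eq, Fin.sum_univ_two, Complex.norm_def, Complex.normSq_apply, planePoint,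
    Real.norm_eq_abs, Real.norm_eq_abs, sq_abs, sq_abs,
    show q 0 / (2 * Real.pi) * (q 0 / (2 * Real.pi)) + q 1 / (2 * Real.pi) * (q 1 / (2 * Real.pi))
      = (q 0 ^ 2 + q 1 ^ 2) / (2 * Real.pi) ^ 2 by ring, Real.sqrt_div' _ (by positivity),
    Real.sqrt_sq (by positivity)]

lemma planePoint_mem_cell {q : Mom} (hq : q ∈ brillouin 1) : planePoint q ∈ cell := by
  have hp := Real.pi_pos
  have key : ∀ μ, q μ / (2 * Real.pi) ∈ Set.Ioc (-1 / 2 : ℝ) (1 / 2) := fun μ => by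
    have h := hq μ
    rw [div_one] at h
    constructor
    · rw [lt_div_iff₀ (by positivity)]; linarith [h.1]
    · rw [div_le_iff₀ (by positivity)]; linarith [h.2]
  exact ⟨key 0, key 1⟩

lemma smul_mem_brillouin {N : ℤ} {p : Mom} (hp : p ∈ brillouin (spacing N)) :
    spacing N • p ∈ brillouin 1 := by
  intro μ
  have ha := spacing_pos N
  have h := hp μ
  rw [PiLp.smul_apply, smul_eq_mul, div_one]
  constructor
  · have := mul_lt_mul_of_pos_left h.1 ha
    rwa [mul_neg, mul_div_cancel₀ _ ha.ne'] at this
  · have := mul_le_mul_of_nonneg_left h.2 ha.le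
    rwa [mul_div_cancel₀ _ ha.ne'] at this

/-- The half-open Brillouin zone is a fundamental domain, so no nonzero momentum in it is identified
with the origin. -/
lemma momTorus_ne_zero {N : ℤ} {p : Mom} (hp : p ∈ brillouin (spacing N)) (hp0 : p ≠ 0) :
    momTorus N p ≠ 0 := by
  have h1 := norm_le_two_mul_norm_toTorus_of_mem_cell (planePoint_mem_cell (smul_mem_brillouin hp))
  have h2 : 0 < ‖planePoint (spacing N • p)‖ := by
    have := norm_pos_iff.2 (smul_ne_zero (spacing_pos N).ne' hp0)
    have := Real.pi_pos
    rw [norm_planePoint]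
    positivity
  rw [momTorus_eq, ← norm_pos_iff]
  linarith

lemma norm_mom_sq (p : Mom) : (‖p‖ : ℂ) ^ 2 = (p 0 : ℂ) ^ 2 + (p 1 : ℂ) ^ 2 := by
  have h := EuclideanSpace.norm_sq_eq p
  rw [Fin.sum_univ_two, Real.norm_eq_abs, Real.norm_eq_abs, sq_abs, sq_abs] at h
  exact_mod_cast h

/-- The quotient `conj(w)/w` is homogeneous of degree zero, so neither the spacing nor the factor
`2π` survives; its real and imaginary parts are `(p₀² - p₁²)/|p|²` and `-2 p₀ p₁/|p|²`. -/
lemma explicitBubble_planePoint (μ ν : Fin 2) {a : ℝ} (ha : a ≠ 0) {p : Mom} (hp : p ≠ 0) :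
    explicitBubble μ ν (planePoint (a • p)) = 1 / (8 * (Real.pi : ℂ) * (‖p‖ : ℂ) ^ 2)
      * (2 * (p μ : ℂ) * (p ν : ℂ) - (‖p‖ : ℂ) ^ 2 * kron μ ν) := by
  have h0 : p 0 ^ 2 + p 1 ^ 2 ≠ 0 := by
    have h := EuclideanSpace.norm_sq_eq p
    rw [Fin.sum_univ_two, Real.norm_eq_abs, Real.norm_eq_abs, sq_abs, sq_abs] at h
    rw [← h]
    exact pow_ne_zero _ (norm_ne_zero_iff.2 hp)
  have h0c : (p 0 : ℂ) ^ 2 + (p 1 : ℂ) ^ 2 ≠ 0 := by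
    intro h
    exact h0 (Complex.ofReal_injective (by push_cast; exact h))
  have hpi := Real.pi_ne_zero
  have hpic : (Real.pi : ℂ) ≠ 0 := by exact_mod_cast hpi
  have e : starRingEnd ℂ (planePoint (a • p)) / planePoint (a • p)
      = ⟨(p 0 ^ 2 - p 1 ^ 2) / (p 0 ^ 2 + p 1 ^ 2), -(2 * p 0 * p 1) / (p 0 ^ 2 + p 1 ^ 2)⟩ := by
    have hz : planePoint (a • p) ≠ 0 := by
      have := norm_pos_iff.2 (smul_ne_zero ha hp)
      have := Real.pi_pos
      rw [← norm_pos_iff, norm_planePoint]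
      positivity
    rw [div_eq_iff hz]
    apply Complex.ext <;> simp [planePoint] <;> field_simp <;> ring
  rw [explicitBubble, e, norm_mom_sq]
  fin_cases μ <;> fin_cases ν <;> simp [tensorPart, kron] <;> field_simp <;> ring

/-- The regular part of the massless bubble. -/
def regularPart (μ ν : Fin 2) (q : Mom) : ℂ :=
  if q = 0 then regularZero μ ν
  else massless μ ν (toTorus (planePoint q)) - explicitBubble μ ν (planePoint q)

lemma massless_eq_limitBubble (N : ℤ) (μ ν : Fin 2) {p : Mom} (hp : p ≠ 0) :
    massless μ ν (momTorus N p) = limitBubble N regularPart μ ν p := by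
  have ha := (spacing_pos N).ne'
  rw [limitBubble, regularPart, if_neg (smul_ne_zero ha hp), ← explicitBubble_planePoint μ ν ha hp,
    momTorus_eq]
  ring

lemma norm_explicitBubble_le (μ ν : Fin 2) (w : ℂ) : ‖explicitBubble μ ν w‖ ≤ 1 := by
  have h1 : ‖starRingEnd ℂ w / w‖ ≤ 1 := by
    rw [norm_div, RCLike.norm_conj]
    exact div_self_le_one _
  have h2 : |tensorPart μ ν (starRingEnd ℂ w / w)| ≤ 1 := by
    have hr := (Complex.abs_re_le_norm _).trans h1
    have hi := (Complex.abs_im_le_norm _).trans h1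
    unfold tensorPart
    split_ifs <;> simpa using by assumption
  have h3 : |1 / (8 * Real.pi)| ≤ 1 := by
    have := Real.pi_gt_three
    rw [abs_of_pos (by positivity), div_le_one (by positivity)]
    linarith
  rw [explicitBubble, Complex.norm_real, Real.norm_eq_abs, abs_mul]
  exact mul_le_one₀ h3 (abs_nonneg _) h2

/-- Close to the origin this is the Hölder estimate obtained from the Ward identity. Elsewhere in
the zone the massless bubble and its explicit part are bounded, and `√‖q‖ ≥ 1/8` absorbs the bound
`D` at the price of a factor 8. -/
lemma exists_regularPart_sub_le (μ ν : Fin 2) : ∃ C : ℝ, 0 ≤ C ∧ ∀ q ∈ brillouin 1,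
    ‖regularPart μ ν q - regularPart μ ν 0‖ ≤ C * √‖q‖ := by
  obtain ⟨A, hA⟩ := exists_massless_sub_explicit_le μ ν
  obtain ⟨B, hB⟩ := exists_norm_massless_le μ ν
  set D := |B| * 8 + 1 + ‖regularZero μ ν‖ with hD
  have hD0 : 0 ≤ D := by positivity
  refine ⟨|A| + D * 8, by positivity, fun q hq => ?_⟩
  have hpi := Real.pi_gt_three
  rcases eq_or_ne q 0 with rfl | hq0
  · simp
  have hq' := norm_pos_iff.2 hq0
  set z := planePoint q with hz
  have hzn : ‖z‖ = ‖q‖ / (2 * Real.pi) := norm_planePoint q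
  have hz' : 0 < ‖z‖ := by rw [hzn]; positivity
  have hzq : ‖z‖ ≤ ‖q‖ := by
    rw [hzn]; exact div_le_self hq'.le (by linarith)
  have hsq : √‖z‖ ≤ √‖q‖ := Real.sqrt_le_sqrt hzq
  rw [regularPart, if_neg hq0, regularPart, if_pos rfl, ← hz]
  rcases le_or_gt ‖z‖ (1 / 32) with h | h
  · refine (hA z (norm_pos_iff.1 hz') h).trans ?_
    calc A * √‖z‖ ≤ |A| * √‖q‖ := mul_le_mul (le_abs_self A) hsq (Real.sqrt_nonneg _) (abs_nonneg _)
      _ ≤ (|A| + D * 8) * √‖q‖ :=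
        mul_le_mul_of_nonneg_right (by linarith) (Real.sqrt_nonneg _)
  · have h64 : 1 / 64 ≤ ‖toTorus z‖ := by
      have := norm_le_two_mul_norm_toTorus_of_mem_cell (planePoint_mem_cell hq)
      rw [← hz] at this
      linarith
    have hs : (1 / 8 : ℝ) ≤ √‖toTorus z‖ := Real.le_sqrt_of_sq_le (by linarith)
    have hs2 : (1 / 8 : ℝ) ≤ √‖q‖ := Real.le_sqrt_of_sq_le (by linarith)
    have h1 : ‖massless μ ν (toTorus z)‖ ≤ |B| * 8 := by
      refine (hB _ (norm_pos_iff.1 (by linarith))).trans ?_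
      refine mul_le_mul (le_abs_self B) ?_ (by positivity) (abs_nonneg _)
      rw [inv_le_comm₀ (by linarith) (by norm_num)]
      linarith
    have h2 := norm_explicitBubble_le μ ν z
    calc ‖massless μ ν (toTorus z) - explicitBubble μ ν z - regularZero μ ν‖
        ≤ ‖massless μ ν (toTorus z)‖ + ‖explicitBubble μ ν z‖ + ‖regularZero μ ν‖ :=
          (norm_sub_le _ _).trans (add_le_add_left (norm_sub_le _ _) _)
      _ ≤ D := by rw [hD]; linarith
      _ ≤ D * 8 * √‖q‖ := by nlinarith
      _ ≤ _ := mul_le_mul_of_nonneg_right (by linarith [abs_nonneg A]) (Real.sqrt_nonneg _)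

/-- The value of `regularZero` gives `-4 R(0) = 2 δ T₀ + δ/(2π)`. The tadpole cancels, and `δ/(2π)`
completes the explicit term `-4 (2 p p - |p|² δ)/(8π|p|²)` to the transverse tensor. -/
lemma limitCurrent_eq (N : ℤ) (μ ν : Fin 2) {p : Mom} (hp : p ≠ 0) :
    -2 * kron μ ν * tadpoleLimit + -4 * limitBubble N regularPart μ ν p
      = limitCurrent N regularPart μ ν p := by
  have hn : (‖p‖ : ℂ) ≠ 0 := by exact_mod_cast norm_ne_zero_iff.2 hp
  have hpi : (Real.pi : ℂ) ≠ 0 := by exact_mod_cast Real.pi_ne_zero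
  have h0 : regularPart μ ν 0 = regularZero μ ν := if_pos rfl
  rw [limitBubble, limitCurrent, h0, regularZero]
  field_simp
  ring

/-! ### The limits of the free correlations -/

lemma currentHat_eq (N : ℤ) {n : ℕ+} (m : ℝ) (w : Mom → ℝ) (μ ν : Fin 2) (p : DualSite n) :
    -2 * kron μ ν * tadpole N m w ((0, 0, 1) : BosonLabel n) + -4 * bubbleHat N m w μ ν p
      = currentHat N m w μ ν p := by
  rw [currentHat]; ring

lemma abs_zpow_mul_le {N : ℤ} {m : ℝ} (hm : |m| < (2 : ℝ) ^ (N - 1)) :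
    |(2 : ℝ) ^ (-N) * m| ≤ 1 / 2 := by
  rw [abs_mul, abs_of_pos (by positivity), zpow_neg, inv_mul_le_iff₀ (by positivity)]
  rw [zpow_sub_one₀ (by norm_num)] at hm
  linarith

lemma abs_zpow_mul_le_of_massScale {N : ℤ} {M m : ℝ} (hM : massScale M < N)
    (hm : |m| < (2 : ℝ) ^ massScale M) : |(2 : ℝ) ^ (-N) * m| ≤ 1 / 2 :=
  abs_zpow_mul_le (hm.trans_le (zpow_le_zpow_right₀ one_le_two (by omega)))

theorem fullLimits_bubbleHat (N : ℤ) (μ ν : Fin 2) :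
    FullLimits N (fun m _ => bubbleHat N m fullWeight μ ν) (limitBubble N regularPart μ ν) := by
  refine ⟨_, fun m hm0 hm => isWeight_one.extends_bubbleHat hm0 (abs_zpow_mul_le hm)
    (fun _ _ => rfl) μ ν, fun p hp hp0 => ?_⟩
  have h := isWeight_one.tendsto_bubble ((2 : ℝ) ^ (-N)) μ ν (momTorus_ne_zero hp hp0)
  rw [← massless_eq_limitBubble N μ ν hp0, massless, ← weightedProp_one 0]
  exact h

theorem fullLimits_tadpole (N : ℤ) :
    FullLimits N (fun m n _ => tadpole N m fullWeight ((0, 0, 1) : BosonLabel n))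
      (fun _ => tadpoleLimit) := by
  refine ⟨_, fun m hm0 hm => isWeight_one.extends_tadpole hm0 (abs_zpow_mul_le hm)
    (fun _ _ => rfl), fun p hp hp0 => ?_⟩
  have h := isWeight_one.tendsto_tadpole ((2 : ℝ) ^ (-N)) 0 true
  rw [tadpoleLimit, ← weightedProp_one 0]
  exact h

theorem fullLimits_currentHat (N : ℤ) (μ ν : Fin 2) :
    FullLimits N (fun m _ => currentHat N m fullWeight μ ν) (limitCurrent N regularPart μ ν) := by
  have h := ((fullLimits_tadpole N).linear (fullLimits_bubbleHat N μ ν) (-2 * kron μ ν)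
    (-4)).congr_limit fun p _ hp0 => limitCurrent_eq N μ ν hp0
  simp only [currentHat_eq] at h
  exact h

section Ultraviolet

variable {χ : ℝ → ℝ} (N : ℤ)

lemma tendsto_weightedProp_torusWeight (hχ : IsCutoff χ) {x : Torus} (hx : x ≠ 0) (i j : Fin 2) :
    Tendsto (fun M => weightedProp (torusWeight χ (massScale M) N) 0 x i j) (𝓝[>] 0)
      (𝓝 (prop 0 x i j)) := by
  refine tendsto_const_nhds.congr' ?_
  filter_upwards [eventually_torusWeight_eq_one hχ N hx] with M hM
  simp [weightedProp, hM]

theorem uvLimits_bubbleHat (hχ : IsCutoff χ) (μ ν : Fin 2) :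
    UVLimits N (fun M m _ => bubbleHat N m (uvWeight χ (massScale M)) μ ν)
      (limitBubble N regularPart μ ν) := by
  refine ⟨_, _, fun M m _ hMN hm0 hm => (isWeight_torusWeight hχ (massScale M) N).extends_bubbleHat
    hm0 (abs_zpow_mul_le_of_massScale hMN hm) (fun _ k => uvWeight_momentum χ _ N k) μ ν,
    fun M _ _ p hp hp0 => (isWeight_torusWeight hχ (massScale M) N).tendsto_bubble
      ((2 : ℝ) ^ (-N)) μ ν (momTorus_ne_zero hp hp0), fun p hp hp0 => ?_⟩
  rw [← massless_eq_limitBubble N μ ν hp0, massless]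
  exact tendsto_integral_bubbleSymbol
    (Eventually.of_forall fun M => (isWeight_torusWeight hχ _ N).isDominated (by norm_num))
    (fun x hx i j => tendsto_weightedProp_torusWeight N hχ hx i j) μ ν (momTorus_ne_zero hp hp0)

theorem uvLimits_tadpole (hχ : IsCutoff χ) :
    UVLimits N (fun M m n _ => tadpole N m (uvWeight χ (massScale M)) ((0, 0, 1) : BosonLabel n))
      (fun _ => tadpoleLimit) := by
  refine ⟨_, fun M _ => _, fun M m _ hMN hm0 hm =>
    (isWeight_torusWeight hχ (massScale M) N).extends_tadpole
    hm0 (abs_zpow_mul_le_of_massScale hMN hm) (fun _ k => uvWeight_momentum χ _ N k),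
    fun M _ _ p hp hp0 => (isWeight_torusWeight hχ (massScale M) N).tendsto_tadpole
      ((2 : ℝ) ^ (-N)) 0 true, fun p hp hp0 => ?_⟩
  exact tendsto_integral_tadpoleSymbol
    (Eventually.of_forall fun M => (isWeight_torusWeight hχ _ N).isDominated (by norm_num))
    (fun x hx i j => tendsto_weightedProp_torusWeight N hχ hx i j) 0 true

theorem uvLimits_currentHat (hχ : IsCutoff χ) (μ ν : Fin 2) :
    UVLimits N (fun M m _ => currentHat N m (uvWeight χ (massScale M)) μ ν)
      (limitCurrent N regularPart μ ν) := by
  have h := ((uvLimits_tadpole N hχ).linear (uvLimits_bubbleHat N hχ μ ν) (-2 * kron μ ν)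
    (-4)).congr_limit fun p _ hp0 => limitCurrent_eq N μ ν hp0
  simp only [currentHat_eq] at h
  exact h

end Ultraviolet

end LatticeQED

end

/-! ### Assembly of the proposition -/

theorem proposition5p1 :
    ∃ (C : ℝ) (R : Fin 2 → Fin 2 → LatticeQED.Mom → ℂ) (T : ℂ),
      0 < C ∧
      (∀ μ ν : Fin 2, ∀ q ∈ LatticeQED.brillouin 1,
        ‖R μ ν q - R μ ν 0‖ ≤ C * ‖q‖ ^ (1 / 2 : ℝ)) ∧
      ∀ N : ℤ,
        -- the full propagator: the tadpole does not depend on its label, and is regarded as a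
        -- function constant in the momentum; then the bubble and the current correlation
        ((∀ (m : ℝ) (n : ℕ+) (b b' : LatticeQED.BosonLabel n),
            m ≠ 0 → |m| < (2 : ℝ) ^ (N - 1) →
              LatticeQED.tadpole N m LatticeQED.fullWeight b
                = LatticeQED.tadpole N m LatticeQED.fullWeight b') ∧
          LatticeQED.FullLimits N
            (fun m n _ => LatticeQED.tadpole N m LatticeQED.fullWeight
              ((0, 0, 1) : LatticeQED.BosonLabel n))
            (fun _ => T) ∧
          ∀ μ ν : Fin 2,
            LatticeQED.FullLimits N
              (fun m _ => LatticeQED.bubbleHat N m LatticeQED.fullWeight μ ν)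
              (LatticeQED.limitBubble N R μ ν) ∧
            LatticeQED.FullLimits N
              (fun m _ => LatticeQED.currentHat N m LatticeQED.fullWeight μ ν)
              (LatticeQED.limitCurrent N R μ ν)) ∧
        -- the ultraviolet propagator: the same, with the same limits
        ∀ χ : ℝ → ℝ, LatticeQED.IsCutoff χ →
          ((∀ (M m : ℝ) (n : ℕ+) (b b' : LatticeQED.BosonLabel n),
              0 < M → LatticeQED.massScale M < N → m ≠ 0 →
              |m| < (2 : ℝ) ^ LatticeQED.massScale M →
                LatticeQED.tadpole N m (LatticeQED.uvWeight χ (LatticeQED.massScale M)) b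
                  = LatticeQED.tadpole N m (LatticeQED.uvWeight χ (LatticeQED.massScale M)) b') ∧
            LatticeQED.UVLimits N
              (fun M m n _ => LatticeQED.tadpole N m
                (LatticeQED.uvWeight χ (LatticeQED.massScale M))
                ((0, 0, 1) : LatticeQED.BosonLabel n))
              (fun _ => T) ∧
            ∀ μ ν : Fin 2,
              LatticeQED.UVLimits N
                (fun M m _ => LatticeQED.bubbleHat N m
                  (LatticeQED.uvWeight χ (LatticeQED.massScale M)) μ ν)
                (LatticeQED.limitBubble N R μ ν) ∧
              LatticeQED.UVLimits N
                (fun M m _ => LatticeQED.currentHat N m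
                  (LatticeQED.uvWeight χ (LatticeQED.massScale M)) μ ν)
                (LatticeQED.limitCurrent N R μ ν)) := by
  choose C hC0 hC using fun μ ν => LatticeQED.exists_regularPart_sub_le μ ν
  -- The sum dominates the Hölder constants of all four components; adding 1 makes it strictly
  -- positive.
  refine ⟨(∑ μ, ∑ ν, C μ ν) + 1, LatticeQED.regularPart, LatticeQED.tadpoleLimit, ?_, ?_, ?_⟩
  · have : 0 ≤ ∑ μ, ∑ ν, C μ ν :=
      Finset.sum_nonneg fun μ _ => Finset.sum_nonneg fun ν _ => hC0 μ ν
    linarith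
  · intro μ ν q hq
    rw [← Real.sqrt_eq_rpow]
    refine (hC μ ν q hq).trans (mul_le_mul_of_nonneg_right ?_ (Real.sqrt_nonneg _))
    have h1 : C μ ν ≤ ∑ ν, C μ ν :=
      Finset.single_le_sum (fun ν _ => hC0 μ ν) (Finset.mem_univ ν)
    have h2 : ∑ ν, C μ ν ≤ ∑ μ, ∑ ν, C μ ν :=
      Finset.single_le_sum (f := fun μ => ∑ ν, C μ ν)
        (fun μ _ => Finset.sum_nonneg fun ν _ => hC0 μ ν) (Finset.mem_univ μ)
    linarith
  · intro N
    refine ⟨⟨fun m n b b' hm0 hm => ?_, LatticeQED.fullLimits_tadpole N, fun μ ν =>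
      ⟨LatticeQED.fullLimits_bubbleHat N μ ν, LatticeQED.fullLimits_currentHat N μ ν⟩⟩,
      fun χ hχ => ⟨fun M m n b b' _ hMN hm0 hm => ?_, LatticeQED.uvLimits_tadpole N hχ, fun μ ν =>
      ⟨LatticeQED.uvLimits_bubbleHat N hχ μ ν, LatticeQED.uvLimits_currentHat N hχ μ ν⟩⟩⟩
    · exact LatticeQED.isWeight_one.tadpole_eq hm0 (LatticeQED.abs_zpow_mul_le hm)
        (fun _ => rfl) b b'
    · exact (LatticeQED.isWeight_torusWeight hχ (LatticeQED.massScale M) N).tadpole_eq hm0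
        (LatticeQED.abs_zpow_mul_le_of_massScale hMN hm)
        (fun k => LatticeQED.uvWeight_momentum χ _ N k) b b'
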